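/- Let $\mathbb R^4_1$ be Lorentz–Minkowski space with metric $\langle x,y\rangle=-x_0y_0+x_1y_1+x_2y_2+x_3y_3$, let $H^3=\{\langle x,x\rangle=-1,\ x_0>0\}$ and $S^3_1=\{\langle x,x\rangle=1\}$, and let $M^2$ be a connected smooth $2$-manifold. A smooth map $f:M^2\to H^3$ is a front if near each point there is a smooth unit normal field $\nu$, that is, a smooth map into $S^3_1$ with $\langle f,\nu\rangle=0$ and $\langle df,\nu\rangle=0$, such that $(f,\nu)$ is an immersion; put $f_\delta=(\cosh\delta)f+(\sinh\delta)\nu$ and $\nu_\delta=(\cosh\delta)\nu+(\sinh\delta)f$. For an immersion with unit normal field $\nu$ let $H$ be the mean curvature (with second fundamental form $-\langle df,d\nu\rangle$) and $K$ the Gaussian curvature. A front $f$ is a horospherical linear Weingarten front if it has at least one regular point and if near each point there are a unit normal field $\nu$ and $\delta_0\in\mathbb R$ such that $f_{\delta_0}$ is an immersion with $a(H-1)+bK=0$ for some real $(a,b)\neq(0,0)$. For $\varepsilon\in\mathbb R$, $W_\varepsilon(M^2)$ is the set of horospherical linear Weingarten fronts $f:M^2\to H^3$ which near each point have a unit normal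 field with respect to which $2\varepsilon(H-1)+(1-\varepsilon)K=0$ at all regular points. Let $\varepsilon<0$ and $f\in W_\varepsilon(M^2)$, and suppose that $f(M^2)$ is not contained in a totally geodesic plane or in an equidistant surface of one (that is, $\langle f,v\rangle$ is not constant for any $v$ with $\langle v,v\rangle>0$). Then $f$ has a unit normal field $\nu$ defined on all of $M^2$ such that $2\varepsilon(H-1)+(1-\varepsilon)K=0$ with respect to $\nu$ at every regular point of $f$. For every such $\nu$ there is a real number $\delta$ such that $\nu_\delta:M^2\to S^3_1$ is a CMC-1 front with unit normal field $f_\delta$ (that is, $(\nu_\delta,f_\delta)$ is an immersion, $\nu_\delta$ has regular points, and at all of them its mean curvature, with respect to $f_\delta$ and the second fundamental form $-\langle d\nu_\delta,df_\delta\rangle$, is $1$), and such that the singular set of $\nu_\delta$ (the points where $d\nu_\delta$ is not injective) consists only of isolated points of $M^2$. If moreover $f(M^2)$ is not contained in a horosphere, then $\delta$ is the unique real number for which $\nu_\delta$ is a CMC-1 front with unit normal field $f_\delta$. -/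

import Mathlib

open scoped Manifold ContDiff Topology

namespace HypFront

/-- The vector space underlying Lorentz-Minkowski 4-space. -/
abbrev R41 : Type := Fin 4 → ℝ

/-- The Lorentz metric of signature `(-,+,+,+)`. -/
def lor (x y : R41) : ℝ := -(x 0 * y 0) + x 1 * y 1 + x 2 * y 2 + x 3 * y 3

/-- Hyperbolic 3-space, as the upper sheet of the hyperboloid. -/
def H3 : Set R41 := {x | lor x x = -1 ∧ 0 < x 0}

/-- De Sitter 3-space. -/
def S31 : Set R41 := {x | lor x x = 1}

noncomputable section

variable {M : Type*} [TopologicalSpace M] [ChartedSpace (EuclideanSpace ℝ (Fin 2)) M]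

/-- The differential of `g : M → R41` at `p`, as a linear map on the tangent plane (which is
identified with the plane through the preferred chart at `p`). -/
def diff (g : M → R41) (p : M) : EuclideanSpace ℝ (Fin 2) →L[ℝ] R41 :=
  mfderiv (𝓡 2) 𝓘(ℝ, R41) g p

/-- `p` is a regular point of `g` if `dg` is injective at `p`; otherwise it is singular. -/
def IsRegularPt (g : M → R41) (p : M) : Prop := Function.Injective (diff g p)

/-- The singular set of `g`. -/
def singularSet (g : M → R41) : Set M := {p | ¬ IsRegularPt g p}

/-- The coordinate basis of the tangent plane. -/
def tbasis (i : Fin 2) : EuclideanSpace ℝ (Fin 2) := EuclideanSpace.single i 1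

/-- Gram matrix of the first fundamental form `I = ⟨dg, dg⟩` at `p`. -/
def firstForm (g : M → R41) (p : M) : Matrix (Fin 2) (Fin 2) ℝ :=
  Matrix.of fun i j => lor (diff g p (tbasis i)) (diff g p (tbasis j))

/-- Gram matrix of the second fundamental form `II = -⟨dg, dn⟩` of `g` with respect to the
normal field `n`, at `p`. -/
def secondForm (g n : M → R41) (p : M) : Matrix (Fin 2) (Fin 2) ℝ :=
  Matrix.of fun i j => -lor (diff g p (tbasis i)) (diff n p (tbasis j))

/-- Mean curvature at a regular point: half the trace of the shape operator `I⁻¹ II`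
(the operator `A` with `dn = - dg ∘ A`). -/
def meanCurv (g n : M → R41) (p : M) : ℝ :=
  ((firstForm g p)⁻¹ * secondForm g n p).trace / 2

/-- Gaussian curvature, at a regular point, of a surface in hyperbolic 3-space: the curvature
`-1` of the ambient space plus the determinant of the shape operator `I⁻¹ II`. -/
def gaussCurv (g n : M → R41) (p : M) : ℝ :=
  -1 + ((firstForm g p)⁻¹ * secondForm g n p).det

/-- For `g` with values in one of the two quadrics `H3`, `S31` and `N` the other one: on the
open set `U`, `n` is a smooth `N`-valued unit normal field of `g`. -/
def IsUnitNormalOn (N : Set R41) (g n : M → R41) (U : Set M) : Prop :=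
  ContMDiffOn (𝓡 2) 𝓘(ℝ, R41) ∞ n U ∧
  ∀ p ∈ U, n p ∈ N ∧ lor (g p) (n p) = 0 ∧ ∀ v, lor (diff g p v) (n p) = 0

/-- The pair `(g, n)` is an immersion at every point of `U`. -/
def PairImmersionOn (g n : M → R41) (U : Set M) : Prop :=
  ∀ p ∈ U, ∀ v, diff g p v = 0 → diff n p v = 0 → v = 0

/-- A front in hyperbolic 3-space, not necessarily co-orientable: a smooth map which locally
has a unit normal field `ν` such that the Legendrian lift `(f, ν)` is an immersion. -/
def IsFrontH3 (f : M → R41) : Prop :=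
  ContMDiff (𝓡 2) 𝓘(ℝ, R41) ∞ f ∧ (∀ p, f p ∈ H3) ∧
  ∀ p, ∃ U : Set M, IsOpen U ∧ p ∈ U ∧
    ∃ ν : M → R41, IsUnitNormalOn S31 f ν U ∧ PairImmersionOn f ν U

/-- `par δ f ν = (cosh δ) f + (sinh δ) ν` is the parallel front `f_δ`, and
`par δ ν f = (cosh δ) ν + (sinh δ) f` is its unit normal field `ν_δ`. -/
def par (δ : ℝ) (f ν : M → R41) : M → R41 :=
  fun p => Real.cosh δ • f p + Real.sinh δ • ν p

/-- On `U`, `f` is a horospherical linear Weingarten immersion, with respect to the unit normal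
field `ν`. -/
def IsHLWImmersionOn (f ν : M → R41) (U : Set M) : Prop :=
  (∀ p ∈ U, IsRegularPt f p) ∧
  ∃ a b : ℝ, a ^ 2 + b ^ 2 ≠ 0 ∧
    ∀ p ∈ U, a * (meanCurv f ν p - 1) + b * gaussCurv f ν p = 0

/-- A horospherical linear Weingarten front: a front with at least one regular point, such that
near each point some parallel front is a horospherical linear Weingarten immersion. -/
def IsHLWFront (f : M → R41) : Prop :=
  IsFrontH3 f ∧ (∃ p, IsRegularPt f p) ∧
  ∀ p, ∃ U : Set M, IsOpen U ∧ p ∈ U ∧ ∃ ν : M → R41, IsUnitNormalOn S31 f ν U ∧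
    ∃ δ₀ : ℝ, IsHLWImmersionOn (par δ₀ f ν) (par δ₀ ν f) U

/-- The relation `2ε(H - 1) + (1 - ε)K = 0` at all regular points of `f` in `U`, with respect to
the normal field `ν`. -/
def SatisfiesLW (ε : ℝ) (f ν : M → R41) (U : Set M) : Prop :=
  ∀ p ∈ U, IsRegularPt f p →
    2 * ε * (meanCurv f ν p - 1) + (1 - ε) * gaussCurv f ν p = 0

variable (M) in
/-- The class `W_ε(M)` for real `ε`: horospherical linear Weingarten fronts which satisfy
`2ε(H - 1) + (1 - ε)K = 0` with respect to suitable local unit normal fields. Global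
co-orientability is not required. -/
def W (ε : ℝ) : Set (M → R41) :=
  {f | IsHLWFront f ∧ ∀ p, ∃ U : Set M, IsOpen U ∧ p ∈ U ∧
    ∃ ν : M → R41, IsUnitNormalOn S31 f ν U ∧ SatisfiesLW ε f ν U}

/-- `g` is a (spacelike, co-oriented) CMC-1 front in de Sitter 3-space, with unit normal field
`n` in hyperbolic 3-space: `(g, n)` is a Legendrian immersion, `g` has regular points, and its
mean curvature is one at all of them. -/
def IsCMC1FrontS31 (g n : M → R41) : Prop :=
  ContMDiff (𝓡 2) 𝓘(ℝ, R41) ∞ g ∧ (∀ p, g p ∈ S31) ∧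
  IsUnitNormalOn H3 g n Set.univ ∧ PairImmersionOn g n Set.univ ∧
  (∃ p, IsRegularPt g p) ∧ ∀ p, IsRegularPt g p → meanCurv g n p = 1

/-- Every point of `S` is an isolated point of `S`. -/
def ConsistsOfIsolatedPoints (S : Set M) : Prop := ∀ p ∈ S, ∀ᶠ q in 𝓝[≠] p, q ∉ S

/-- The image of `f` lies in a totally geodesic plane or in one of its equidistant surfaces:
`⟨f, v⟩` is constant for some spacelike vector `v`. -/
def InEquidistant (f : M → R41) : Prop :=
  ∃ v : R41, 0 < lor v v ∧ ∃ c : ℝ, ∀ p, lor (f p) v = c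

/-- The image of `f` lies in a horosphere: `⟨f, v⟩` is constant for some lightlike vector `v`. -/
def InHorosphere (f : M → R41) : Prop :=
  ∃ v : R41, v ≠ 0 ∧ lor v v = 0 ∧ ∃ c : ℝ, ∀ p, lor (f p) v = c

end

end HypFront

open HypFront

namespace HypFront

/-! ### Linear algebra of Lorentz-Minkowski space -/

/-! Let `G = f + ν` be the light-cone lift of the hyperbolic Gauss map, and let `A`, `B`, `C` be the
area form of `f`, the mixed area form of `f` and `ν`, and the area form of `ν`, all measured by
`wed` on the plane orthogonal to `f` and `ν`. Multiplied by the area form, the Weingarten relation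
becomes `(1 - ε)C - εB - (1 + ε)A = 0`, which makes sense at singular points (`WRel`). Since `f_δ +
ν_δ = e^δ G`, mean curvature one of `ν_δ` says that the mixed area of `G` and `ν_δ` vanishes, that
is, `2 sinh δ A + (sinh δ + cosh δ)B + 2 cosh δ C = 0`. Multiplied by `e^δ`, this is the Weingarten
relation exactly when `e^{2δ} = -ε`; so `ε < 0` supplies `δ` (`WRel.mixedZero`,
`Normal.meanCurv_par_eq_one_iff`).

Vanishing mixed area, together with the symmetry of `⟨dG, dν_δ⟩`, is a trace-free condition. Hence
`dν_δ` vanishes entirely wherever it has a kernel (`eq_zero_of_mixed`), and there `G` is immersed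
because `(f, ν)` is. Stereographic projection of `G` is then a conformal coordinate in which `⟨dν_δ,
dG⟩` is the real part of a holomorphic quadratic differential (`differentiableOn_hopf`). Its zeros
are isolated or fill a neighborhood (`Normal.isolated_or_zero`); in the second case `ν_δ` is
constant on the connected surface, and `f` lies in an equidistant surface.

For the global normal, regular points are shown to be dense (`dense_regular`), so two local normals
agree up to sign. If both signs satisfied the relation, then `B = 0` and `(1 - ε)C = (1 + ε)A`. This
contradicts the sign of a trace-free determinant when `ε > -1`, forces a constant normal when `ε =
-1`, and gives two opposite constant principal curvatures when `ε < -1`. The last case is excluded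
by `Normal.lor_focal_eq_zero`, a rigidity statement of Cartan type that also serves the density
proof.

For uniqueness, the relations for two values of `δ` differ by a nonzero multiple of `A + B + C`, the
area form of `G`. So `dG` degenerates, hence vanishes; `G` is constant and `f` lies in a horosphere.
-/

lemma lor_comm (x y : R41) : lor x y = lor y x := by simp only [lor]; ring

lemma lor_add_left (x y z : R41) : lor (x + y) z = lor x z + lor y z := by
  simp only [lor, Pi.add_apply]; ring

lemma lor_add_right (x y z : R41) : lor x (y + z) = lor x y + lor x z := by
  simp only [lor, Pi.add_apply]; ring

lemma lor_sub_left (x y z : R41) : lor (x - y) z = lor x z - lor y z := by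
  simp only [lor, Pi.sub_apply]; ring

lemma lor_sub_right (x y z : R41) : lor x (y - z) = lor x y - lor x z := by
  simp only [lor, Pi.sub_apply]; ring

lemma lor_smul_left (c : ℝ) (x y : R41) : lor (c • x) y = c * lor x y := by
  simp only [lor, Pi.smul_apply, smul_eq_mul]; ring

lemma lor_smul_right (c : ℝ) (x y : R41) : lor x (c • y) = c * lor x y := by
  simp only [lor, Pi.smul_apply, smul_eq_mul]; ring

lemma lor_neg_right (x y : R41) : lor x (-y) = -lor x y := by
  simp only [lor, Pi.neg_apply]; ring

@[simp] lemma lor_zero_left (x : R41) : lor 0 x = 0 := by simp [lor]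

@[simp] lemma lor_zero_right (x : R41) : lor x 0 = 0 := by simp [lor]

/-- The orthogonal complement of a timelike vector is positive definite. -/
lemma lor_self_pos {f a : R41} (hf : lor f f = -1) (h : lor a f = 0) (ha : a ≠ 0) :
    0 < lor a a := by
  simp only [lor] at *
  have h1 : a 0 * f 0 = a 1 * f 1 + a 2 * f 2 + a 3 * f 3 := by linarith
  have hC : (a 0 * f 0) ^ 2 ≤
      (a 1 ^ 2 + a 2 ^ 2 + a 3 ^ 2) * (f 1 ^ 2 + f 2 ^ 2 + f 3 ^ 2) := by
    rw [h1]
    nlinarith [sq_nonneg (a 1 * f 2 - a 2 * f 1), sq_nonneg (a 1 * f 3 - a 3 * f 1),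
      sq_nonneg (a 2 * f 3 - a 3 * f 2)]
  have hf0 : f 1 ^ 2 + f 2 ^ 2 + f 3 ^ 2 = f 0 ^ 2 - 1 := by linarith
  rw [hf0] at hC
  have hf2 : 1 ≤ f 0 ^ 2 := by nlinarith [sq_nonneg (f 1), sq_nonneg (f 2), sq_nonneg (f 3)]
  have hA : 0 < a 1 ^ 2 + a 2 ^ 2 + a 3 ^ 2 := by
    by_contra hcon
    have e1 : a 1 = 0 := by nlinarith [sq_nonneg (a 1), sq_nonneg (a 2), sq_nonneg (a 3)]
    have e2 : a 2 = 0 := by nlinarith [sq_nonneg (a 1), sq_nonneg (a 2), sq_nonneg (a 3)]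
    have e3 : a 3 = 0 := by nlinarith [sq_nonneg (a 1), sq_nonneg (a 2), sq_nonneg (a 3)]
    have e0 : a 0 = 0 := by
      have : a 0 * f 0 = 0 := by rw [h1, e1, e2, e3]; ring
      rcases mul_eq_zero.1 this with h | h
      · exact h
      · rw [h] at hf2; norm_num at hf2
    apply ha
    funext i
    fin_cases i <;> simp [e0, e1, e2, e3]
  have h3 : 0 < f 0 ^ 2 * (a 1 ^ 2 + a 2 ^ 2 + a 3 ^ 2 - a 0 ^ 2) := by nlinarith
  have h4 := pos_of_mul_pos_right h3 (by positivity)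
  linarith

lemma eq_zero_of_lor_self {f a : R41} (hf : lor f f = -1) (h : lor a f = 0)
    (ha : lor a a = 0) : a = 0 := by
  by_contra h0
  exact absurd ha (lor_self_pos hf h h0).ne'

/-- The determinant of four vectors of Lorentz-Minkowski space. For a point `f` with unit normal
`n` it restricts to the area form of the orthogonal complement of `f` and `n`. -/
def wed (f n a b : R41) : ℝ := (Matrix.of ![f, n, a, b]).det

lemma wed_eq (f n a b : R41) : wed f n a b =
    (f 0 * n 1 - f 1 * n 0) * (a 2 * b 3 - a 3 * b 2)
    - (f 0 * n 2 - f 2 * n 0) * (a 1 * b 3 - a 3 * b 1)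
    + (f 0 * n 3 - f 3 * n 0) * (a 1 * b 2 - a 2 * b 1)
    + (f 1 * n 2 - f 2 * n 1) * (a 0 * b 3 - a 3 * b 0)
    - (f 1 * n 3 - f 3 * n 1) * (a 0 * b 2 - a 2 * b 0)
    + (f 2 * n 3 - f 3 * n 2) * (a 0 * b 1 - a 1 * b 0) := by
  simp only [wed, Matrix.det_succ_row_zero, Fin.sum_univ_succ]
  simp [Fin.succAbove, Matrix.of_apply]
  ring

lemma wed_add_left (f n a b c : R41) : wed f n (a + b) c = wed f n a c + wed f n b c := by
  simp only [wed_eq, Pi.add_apply]; ring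

lemma wed_add_right (f n a b c : R41) : wed f n a (b + c) = wed f n a b + wed f n a c := by
  simp only [wed_eq, Pi.add_apply]; ring

lemma wed_smul_left (f n : R41) (r : ℝ) (a b : R41) : wed f n (r • a) b = r * wed f n a b := by
  simp only [wed_eq, Pi.smul_apply, smul_eq_mul]; ring

lemma wed_smul_right (f n : R41) (r : ℝ) (a b : R41) : wed f n a (r • b) = r * wed f n a b := by
  simp only [wed_eq, Pi.smul_apply, smul_eq_mul]; ring

lemma wed_swap (f n a b : R41) : wed f n a b = -wed f n b a := by
  simp only [wed_eq]; ring

@[simp] lemma wed_self (f n a : R41) : wed f n a a = 0 := by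
  simp only [wed_eq]; ring

@[simp] lemma wed_zero_left (f n a : R41) : wed f n 0 a = 0 := by
  simp [wed_eq]

@[simp] lemma wed_zero_right (f n a : R41) : wed f n a 0 = 0 := by
  simp [wed_eq]

lemma wed_neg_normal (f n a b : R41) : wed f (-n) a b = -wed f n a b := by
  simp only [wed_eq, Pi.neg_apply]; ring

lemma wed_neg_left (f n a b : R41) : wed f n (-a) b = -wed f n a b := by
  simp only [wed_eq, Pi.neg_apply]; ring

lemma wed_neg_right (f n a b : R41) : wed f n a (-b) = -wed f n a b := by
  simp only [wed_eq, Pi.neg_apply]; ring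

/-- The normal plane of a point `f` with unit normal `n`, oriented and up to a hyperbolic
rotation, determines the area form. -/
lemma wed_rotate (c s : ℝ) (f n a b : R41) :
    wed (c • f + s • n) (c • n + s • f) a b = (c ^ 2 - s ^ 2) * wed f n a b := by
  simp only [wed_eq, Pi.add_apply, Pi.smul_apply, smul_eq_mul]; ring

/-- `f` is a point of the hyperboloid and `n` a unit vector orthogonal to it. -/
structure Frame (f n : R41) : Prop where
  ff : lor f f = -1
  nn : lor n n = 1
  fn : lor f n = 0

/-- `a` is orthogonal to `f` and `n`. -/
def Perp (f n a : R41) : Prop := lor a f = 0 ∧ lor a n = 0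

lemma Perp.add {f n a b : R41} (ha : Perp f n a) (hb : Perp f n b) : Perp f n (a + b) := by
  constructor
  · rw [lor_add_left, ha.1, hb.1, add_zero]
  · rw [lor_add_left, ha.2, hb.2, add_zero]

lemma Perp.sub {f n a b : R41} (ha : Perp f n a) (hb : Perp f n b) : Perp f n (a - b) := by
  constructor
  · rw [lor_sub_left, ha.1, hb.1, sub_zero]
  · rw [lor_sub_left, ha.2, hb.2, sub_zero]

lemma Perp.smul {f n a : R41} (r : ℝ) (ha : Perp f n a) : Perp f n (r • a) := by
  constructor
  · rw [lor_smul_left, ha.1, mul_zero]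
  · rw [lor_smul_left, ha.2, mul_zero]

/-- The Lagrange identity on the tangent plane. -/
lemma wed_mul_wed {f n a b c d : R41} (h : Frame f n) (ha : Perp f n a) (hb : Perp f n b)
    (hc : Perp f n c) (hd : Perp f n d) :
    wed f n a b * wed f n c d = lor a c * lor b d - lor a d * lor b c := by
  let J : Matrix (Fin 4) (Fin 4) ℝ := Matrix.diagonal ![-1, 1, 1, 1]
  let A : Matrix (Fin 4) (Fin 4) ℝ := Matrix.of ![f, n, a, b]
  let C : Matrix (Fin 4) (Fin 4) ℝ := Matrix.of ![f, n, c, d]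
  have hnf : lor n f = 0 := by rw [lor_comm]; exact h.fn
  -- This is the matrix of Lorentz products of the rows. Its upper block has determinant `-1`, which
  -- cancels the determinant of `J`.
  have key : A * J * C.transpose =
      !![-1, 0, 0, 0; 0, 1, 0, 0; 0, 0, lor a c, lor a d; 0, 0, lor b c, lor b d] := by
    have gen : ∀ (F G : Fin 4 → R41) (i j : Fin 4),
        (Matrix.of F * J * (Matrix.of G).transpose) i j = lor (F i) (G j) := by
      intro F G i j
      simp [Matrix.mul_apply, J, Matrix.diagonal, Fin.sum_univ_four, lor]
    have e1 := h.ff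
    have e2 := h.nn
    have e3 := h.fn
    have a1 := ha.1; have a2 := ha.2; have b1 := hb.1; have b2 := hb.2
    have c1 := hc.1; have c2 := hc.2; have d1 := hd.1; have d2 := hd.2
    rw [lor_comm] at c1 c2 d1 d2
    ext i j
    rw [show A * J * C.transpose = _ from rfl, gen]
    fin_cases i <;> fin_cases j <;> simp [e1, e2, e3, hnf, a1, a2, b1, b2, c1, c2, d1, d2]
  have hdet := congrArg Matrix.det key
  rw [Matrix.det_mul, Matrix.det_mul, Matrix.det_transpose] at hdet
  have hJ : J.det = -1 := by simp [J, Fin.prod_univ_four]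
  have hR : (!![-1, 0, 0, 0; 0, 1, 0, 0; 0, 0, lor a c, lor a d; 0, 0, lor b c, lor b d] :
      Matrix (Fin 4) (Fin 4) ℝ).det = -(lor a c * lor b d - lor a d * lor b c) := by
    simp only [Matrix.det_succ_row_zero, Fin.sum_univ_succ]
    simp [Fin.succAbove]
    ring
  rw [hJ, hR] at hdet
  change A.det * C.det = _
  linarith

attribute [irreducible] wed

section tangent

variable {f n a b c d : R41}

/-- On the Euclidean plane orthogonal to `f` and `n`, the Lagrange identity gives `|a|²|b|² = wed² +
⟨a,b⟩²`; a nonzero `a` with both terms zero leaves `b = 0`. -/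
lemma eq_zero_of_wed_of_lor (h : Frame f n) (ha : Perp f n a) (hb : Perp f n b) (h0 : a ≠ 0)
    (hw : wed f n a b = 0) (hl : lor a b = 0) : b = 0 := by
  have := wed_mul_wed h ha hb ha hb
  rw [hw, hl] at this
  have hp := lor_self_pos h.ff ha.1 h0
  have : lor a a * lor b b = 0 := by linarith
  rcases mul_eq_zero.1 this with h1 | h1
  · exact absurd h1 hp.ne'
  · exact eq_zero_of_lor_self h.ff hb.1 h1

lemma wed_ne_zero_of_lor (h : Frame f n) (ha : Perp f n a) (hb : Perp f n b) (h0 : a ≠ 0)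
    (h1 : b ≠ 0) (hl : lor a b = 0) : wed f n a b ≠ 0 := fun hw =>
  h1 (eq_zero_of_wed_of_lor h ha hb h0 hw hl)

/-- In the tangent plane, the zero vector is the only one orthogonal to a basis. -/
lemma eq_zero_of_perp_basis (h : Frame f n) (ha : Perp f n a) (hb : Perp f n b)
    (hc : Perp f n c) (hw : wed f n a b ≠ 0) (h1 : lor a c = 0) (h2 : lor b c = 0) : c = 0 := by
  by_cases h0 : a = 0
  · simp [h0] at hw
  have e := wed_mul_wed h ha hb ha hc
  rw [h1, h2, mul_zero, zero_mul, sub_zero] at e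
  exact eq_zero_of_wed_of_lor h ha hc h0 ((mul_eq_zero.1 e).resolve_left hw) h1

/-- Two vectors of the tangent plane that are orthogonal to the two vectors of an orthogonal
basis, respectively, are orthogonal. -/
lemma lor_eq_zero_of_perp (h : Frame f n) (ha : Perp f n a) (hb : Perp f n b) (hc : Perp f n c)
    (hd : Perp f n d) (ha0 : a ≠ 0) (hb0 : b ≠ 0) (hab : lor a b = 0) (hbc : lor b c = 0)
    (had : lor a d = 0) : lor c d = 0 := by
  have hw : wed f n b a ≠ 0 :=
    wed_ne_zero_of_lor h hb ha hb0 ha0 (by rw [lor_comm]; exact hab)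
  -- In the tangent plane both `a` and `c` are orthogonal to `b`, so `c` is parallel to `a`, and `a`
  -- is orthogonal to `d`.
  have e := wed_mul_wed h hb ha ha hc
  rw [hbc, lor_comm b a, hab] at e
  have e1 : wed f n a c = 0 := by
    have : wed f n b a * wed f n a c = 0 := by rw [e]; ring
    exact (mul_eq_zero.1 this).resolve_left hw
  have e2 := wed_mul_wed h ha hc ha hd
  rw [e1, had] at e2
  have : lor a a * lor c d = 0 := by linarith
  exact (mul_eq_zero.1 this).resolve_left (lor_self_pos h.ff ha.1 ha0).ne'

end tangent

/-- The pointwise data of a Legendrian map: the point, its unit normal, and the two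
differentials, on an arbitrary tangent space. -/
structure LegPt {V : Type*} [AddCommGroup V] [Module ℝ V] (f n : R41) (X Y : V →ₗ[ℝ] R41) :
    Prop extends Frame f n where
  Xp : ∀ v, Perp f n (X v)
  Yp : ∀ v, Perp f n (Y v)
  sym : ∀ v w, lor (X v) (Y w) = lor (X w) (Y v)

section pointwise

variable {V : Type*} [AddCommGroup V] [Module ℝ V] {f n : R41} {A B : V →ₗ[ℝ] R41}

/-- If `B v = 0`, the mixed condition gives `wed (A v) (B w) = 0` and symmetry gives `⟨A v, B w⟩ =
⟨A w, B v⟩ = 0`. Joint injectivity makes `A v` nonzero, so every `B w` vanishes. This turns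
degeneracy of a differential into its complete vanishing, and is the reason singular points behave
like zeros of a holomorphic object. -/
lemma eq_zero_of_mixed (h : Frame f n) (hA : ∀ v, Perp f n (A v)) (hB : ∀ v, Perp f n (B v))
    (sym : ∀ v w, lor (A v) (B w) = lor (A w) (B v))
    (hm : ∀ v w, wed f n (A v) (B w) + wed f n (B v) (A w) = 0)
    (hinj : ∀ v, A v = 0 → B v = 0 → v = 0) {v : V} (hv : v ≠ 0) (hBv : B v = 0) : B = 0 := by
  have hAv : A v ≠ 0 := fun h => hv (hinj v h hBv)
  ext1 w
  refine eq_zero_of_wed_of_lor h (hA v) (hB w) hAv ?_ ?_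
  · have := hm v w
    rwa [hBv, wed_zero_left, add_zero] at this
  · rw [sym, hBv, lor_zero_right]

/-- A family of alternating forms obtained from the area form. -/
lemma alternating_eq_zero (r0 r1 r2 : ℝ) {v0 v1 : V}
    (hb : ∀ u : V, ∃ a b : ℝ, u = a • v0 + b • v1)
    (h0 : r0 * wed f n (A v0) (A v1) + r1 * (wed f n (A v0) (B v1) + wed f n (B v0) (A v1))
      + r2 * wed f n (B v0) (B v1) = 0) (v w : V) :
    r0 * wed f n (A v) (A w) + r1 * (wed f n (A v) (B w) + wed f n (B v) (A w))
      + r2 * wed f n (B v) (B w) = 0 := by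
  obtain ⟨a, b, rfl⟩ := hb v
  obtain ⟨c, d, rfl⟩ := hb w
  simp only [map_add, map_smul, wed_add_left, wed_add_right, wed_smul_left, wed_smul_right,
    wed_self]
  rw [wed_swap f n (A v1) (A v0), wed_swap f n (B v1) (B v0), wed_swap f n (A v1) (B v0),
    wed_swap f n (B v1) (A v0), wed_swap f n (B v0) (A v0), wed_swap f n (B v1) (A v1)]
  -- Alternating forms on a plane change by the determinant of the coefficients, so one basis value
  -- decides.
  linear_combination (a * d - b * c) * h0

end pointwise

end HypFront

namespace HypFront

/-! ### Local parametrizations of a surface by open subsets of the complex plane -/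

noncomputable section

section param

variable {M : Type*} [TopologicalSpace M] [ChartedSpace (EuclideanSpace ℝ (Fin 2)) M]

/-- A diffeomorphism between an open subset of `M` and an open subset of `ℂ`. -/
structure IsParam (e : OpenPartialHomeomorph M ℂ) : Prop where
  smooth : ContMDiffOn (𝓡 2) 𝓘(ℝ, ℂ) ∞ e e.source
  smooth_symm : ContMDiffOn 𝓘(ℝ, ℂ) (𝓡 2) ∞ e.symm e.target

/-- The differential of the inverse of `e`, at the image of `q`. -/
def frame (e : OpenPartialHomeomorph M ℂ) (q : M) : ℂ →L[ℝ] EuclideanSpace ℝ (Fin 2) :=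
  mfderiv 𝓘(ℝ, ℂ) (𝓡 2) e.symm (e q)

/-- The differential of a complex-valued function. -/
def cdiff (z : M → ℂ) (q : M) : EuclideanSpace ℝ (Fin 2) →L[ℝ] ℂ :=
  mfderiv (𝓡 2) 𝓘(ℝ, ℂ) z q

variable {e : OpenPartialHomeomorph M ℂ} {q : M} {U : Set M}

lemma IsParam.mdiff (he : IsParam e) (hq : q ∈ e.source) :
    MDifferentiableAt (𝓡 2) 𝓘(ℝ, ℂ) e q :=
  ((he.smooth q hq).contMDiffAt (e.open_source.mem_nhds hq)).mdifferentiableAt (by simp)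

lemma IsParam.mdiff_symm (he : IsParam e) (hq : q ∈ e.source) :
    MDifferentiableAt 𝓘(ℝ, ℂ) (𝓡 2) e.symm (e q) :=
  ((he.smooth_symm (e q) (e.map_source hq)).contMDiffAt
    (e.open_target.mem_nhds (e.map_source hq))).mdifferentiableAt (by simp)

lemma mdiff_of_contMDiffOn {F : Type*} [NormedAddCommGroup F] [NormedSpace ℝ F] {g : M → F}
    (hU : IsOpen U) (hg : ContMDiffOn (𝓡 2) 𝓘(ℝ, F) ∞ g U) (hq : q ∈ U) :
    MDifferentiableAt (𝓡 2) 𝓘(ℝ, F) g q :=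
  ((hg q hq).contMDiffAt (hU.mem_nhds hq)).mdifferentiableAt (by simp)

lemma IsParam.fderiv_comp (he : IsParam e) (hq : q ∈ e.source) {g : M → R41}
    (hg : MDifferentiableAt (𝓡 2) 𝓘(ℝ, R41) g q) (c : ℂ) :
    fderiv ℝ (g ∘ e.symm) (e q) c = diff g q (frame e q c) := by
  have hg' : MDifferentiableAt (𝓡 2) 𝓘(ℝ, R41) g (e.symm (e q)) := by rwa [e.left_inv hq]
  have h := mfderiv_comp (e q) hg' (he.mdiff_symm hq)
  rw [mfderiv_eq_fderiv] at h
  rw [h]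
  -- The chain rule yields the differential at `e.symm (e q)`; the base point has to be transported
  -- to `q`.
  have key : ∀ q', q' = q → mfderiv (𝓡 2) 𝓘(ℝ, R41) g q' (frame e q c) =
      mfderiv (𝓡 2) 𝓘(ℝ, R41) g q (frame e q c) := by
    rintro _ rfl; rfl
  exact key _ (e.left_inv hq)

lemma IsParam.fderiv_comp_complex (he : IsParam e) (hq : q ∈ e.source) {z : M → ℂ}
    (hz : MDifferentiableAt (𝓡 2) 𝓘(ℝ, ℂ) z q) (c : ℂ) :
    fderiv ℝ (z ∘ e.symm) (e q) c = cdiff z q (frame e q c) := by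
  have hz' : MDifferentiableAt (𝓡 2) 𝓘(ℝ, ℂ) z (e.symm (e q)) := by rwa [e.left_inv hq]
  have h := mfderiv_comp (e q) hz' (he.mdiff_symm hq)
  rw [mfderiv_eq_fderiv] at h
  rw [h]
  have key : ∀ q', q' = q → mfderiv (𝓡 2) 𝓘(ℝ, ℂ) z q' (frame e q c) =
      mfderiv (𝓡 2) 𝓘(ℝ, ℂ) z q (frame e q c) := by
    rintro _ rfl; rfl
  exact key _ (e.left_inv hq)

lemma IsParam.cdiff_frame (he : IsParam e) (hq : q ∈ e.source) (c : ℂ) :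
    cdiff e q (frame e q c) = c := by
  rw [← he.fderiv_comp_complex hq (he.mdiff hq)]
  have : (e ∘ e.symm) =ᶠ[𝓝 (e q)] id := by
    filter_upwards [e.open_target.mem_nhds (e.map_source hq)] with w hw using e.right_inv hw
  rw [this.fderiv_eq, fderiv_id]
  rfl

lemma IsParam.frame_injective (he : IsParam e) (hq : q ∈ e.source) :
    Function.Injective (frame e q) :=
  Function.LeftInverse.injective (g := cdiff e q) (he.cdiff_frame hq)

lemma IsParam.frame_surjective (he : IsParam e) (hq : q ∈ e.source) :
    Function.Surjective (frame e q) := by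
  have h := (LinearMap.injective_iff_surjective_of_finrank_eq_finrank
    (f := (frame e q).toLinearMap) (by simp [Complex.finrank_real_complex])).1
    (he.frame_injective hq)
  exact h

lemma IsParam.frame_basis (he : IsParam e) (hq : q ∈ e.source)
    (u : EuclideanSpace ℝ (Fin 2)) :
    ∃ a b : ℝ, u = a • frame e q 1 + b • frame e q Complex.I := by
  obtain ⟨c, rfl⟩ := he.frame_surjective hq u
  refine ⟨c.re, c.im, ?_⟩
  rw [← map_smul, ← map_smul, ← map_add]
  congr 1
  apply Complex.ext <;> simp

lemma IsParam.contDiffOn_comp (he : IsParam e) {F : Type*} [NormedAddCommGroup F]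
    [NormedSpace ℝ F] {g : M → F}
    (hg : ContMDiffOn (𝓡 2) 𝓘(ℝ, F) ∞ g U) (hU : e.source ⊆ U) :
    ContDiffOn ℝ ∞ (g ∘ e.symm) e.target := by
  rw [← contMDiffOn_iff_contDiffOn]
  exact hg.comp he.smooth_symm fun w hw => hU (e.map_target hw)

lemma IsParam.continuousOn_diff_frame (he : IsParam e) {g : M → R41}
    (hg : ContMDiffOn (𝓡 2) 𝓘(ℝ, R41) ∞ g e.source) (c : ℂ) :
    ContinuousOn (fun q => diff g q (frame e q c)) e.source := by
  have h1 : ContinuousOn (fun w => fderiv ℝ (g ∘ e.symm) w c) e.target :=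
    ((he.contDiffOn_comp hg subset_rfl).continuousOn_fderiv_of_isOpen e.open_target
      (by simp)).clm_apply continuousOn_const
  refine (h1.comp e.continuousOn e.mapsTo).congr fun q hq => ?_
  exact (he.fderiv_comp hq (mdiff_of_contMDiffOn e.open_source hg hq) c).symm

lemma IsParam.restr (he : IsParam e) (hU : IsOpen U) : IsParam (e.restrOpen U hU) where
  smooth := by
    refine he.smooth.mono ?_
    rw [OpenPartialHomeomorph.restrOpen_source]
    exact Set.inter_subset_left
  smooth_symm := by
    refine he.smooth_symm.mono ?_
    intro w hw
    exact hw.1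

lemma IsParam.trans (he : IsParam e) {φ : OpenPartialHomeomorph ℂ ℂ}
    (h1 : ContDiffOn ℝ ∞ φ φ.source) (h2 : ContDiffOn ℝ ∞ φ.symm φ.target) :
    IsParam (e.trans φ) where
  smooth := by
    rw [OpenPartialHomeomorph.coe_trans]
    refine (contMDiffOn_iff_contDiffOn.2 h1).comp (he.smooth.mono ?_) ?_
    · rw [OpenPartialHomeomorph.trans_source]; exact Set.inter_subset_left
    · intro w hw
      rw [OpenPartialHomeomorph.trans_source] at hw
      exact hw.2
  smooth_symm := by
    rw [OpenPartialHomeomorph.coe_trans_symm]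
    refine he.smooth_symm.comp ((contMDiffOn_iff_contDiffOn.2 h2).mono ?_) ?_
    · rw [OpenPartialHomeomorph.trans_target]; exact Set.inter_subset_left
    · intro w hw
      rw [OpenPartialHomeomorph.trans_target] at hw
      exact hw.2

variable [IsManifold (𝓡 2) ∞ M]

lemma exists_param (p : M) {U : Set M} (hU : IsOpen U) (hp : p ∈ U) :
    ∃ e : OpenPartialHomeomorph M ℂ, IsParam e ∧ p ∈ e.source ∧ e.source ⊆ U := by
  let L : EuclideanSpace ℝ (Fin 2) ≃L[ℝ] ℂ :=
    Complex.orthonormalBasisOneI.repr.symm.toContinuousLinearEquiv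
  let e : OpenPartialHomeomorph M ℂ :=
    (chartAt (EuclideanSpace ℝ (Fin 2)) p).trans L.toHomeomorph.toOpenPartialHomeomorph
  have he : IsParam e := by
    constructor
    · refine (L.contDiff.contMDiff (n := ∞)).contMDiffOn.comp (t := Set.univ)
        ((contMDiffOn_chart (I := 𝓡 2) (n := ∞) (x := p)).mono ?_) (fun _ _ => Set.mem_univ _)
      intro q hq
      exact hq.1
    · refine (contMDiffOn_chart_symm (I := 𝓡 2) (n := ∞) (x := p)).comp
        (L.symm.contDiff.contMDiff (n := ∞)).contMDiffOn ?_
      intro q hq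
      exact hq.2
  refine ⟨e.restrOpen U hU, he.restr hU, ?_, ?_⟩
  · rw [OpenPartialHomeomorph.restrOpen_source]
    exact ⟨⟨mem_chart_source _ p, trivial⟩, hp⟩
  · rw [OpenPartialHomeomorph.restrOpen_source]
    exact Set.inter_subset_right

/-- A smooth complex-valued function whose differential is injective at a point is a local
coordinate. -/
lemma exists_param_of_injective {z : M → ℂ} {p : M} {U : Set M} (hU : IsOpen U) (hp : p ∈ U)
    (hz : ContMDiffOn (𝓡 2) 𝓘(ℝ, ℂ) ∞ z U) (hinj : Function.Injective (cdiff z p)) :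
    ∃ e : OpenPartialHomeomorph M ℂ, IsParam e ∧ p ∈ e.source ∧ e.source ⊆ U ∧
      ∀ q ∈ e.source, e q = z q := by
  obtain ⟨e, he, hpe, heU⟩ := exists_param p hU hp
  have hh : ContDiffOn ℝ ∞ (z ∘ e.symm) e.target := he.contDiffOn_comp hz heU
  have hat : ContDiffAt ℝ ∞ (z ∘ e.symm) (e p) :=
    hh.contDiffAt (e.open_target.mem_nhds (e.map_source hpe))
  have hchain : ∀ c, fderiv ℝ (z ∘ e.symm) (e p) c = cdiff z p (frame e p c) := fun c =>
    he.fderiv_comp_complex hpe (mdiff_of_contMDiffOn hU hz hp) c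
  have hinj' : Function.Injective (fderiv ℝ (z ∘ e.symm) (e p)).toLinearMap := by
    intro c d hcd
    have : fderiv ℝ (z ∘ e.symm) (e p) c = fderiv ℝ (z ∘ e.symm) (e p) d := hcd
    rw [hchain, hchain] at this
    exact he.frame_injective hpe (hinj this)
  let L : ℂ ≃L[ℝ] ℂ := (LinearEquiv.ofInjectiveEndo _ hinj').toContinuousLinearEquiv
  have hL : (L : ℂ →L[ℝ] ℂ) = fderiv ℝ (z ∘ e.symm) (e p) := by
    ext1; rfl
  have hderiv : HasFDerivAt (z ∘ e.symm) (L : ℂ →L[ℝ] ℂ) (e p) := by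
    rw [hL]; exact (hat.differentiableAt (by simp)).hasFDerivAt
  let φ := hat.toOpenPartialHomeomorph (z ∘ e.symm) hderiv (by simp)
  have hφ : (φ : ℂ → ℂ) = z ∘ e.symm := rfl
  have hpφ : e p ∈ φ.source := hat.mem_toOpenPartialHomeomorph_source hderiv (by simp)
  have hcont : ContinuousAt (fderiv ℝ (z ∘ e.symm)) (e p) :=
    (hh.continuousOn_fderiv_of_isOpen e.open_target (by simp)).continuousAt
      (e.open_target.mem_nhds (e.map_source hpe))
  -- Invertibility of the derivative is an open condition. Shrinking to such points makes the
  -- inverse smooth on its whole domain, not only at the image of `p`.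
  have hev : ∀ᶠ w in 𝓝 (e p), w ∈ e.target ∧ ∃ L' : ℂ ≃L[ℝ] ℂ,
      (L' : ℂ →L[ℝ] ℂ) = fderiv ℝ (z ∘ e.symm) w := by
    filter_upwards [e.open_target.mem_nhds (e.map_source hpe),
      hcont.preimage_mem_nhds (by rw [← hL]; exact ContinuousLinearEquiv.nhds L)] with w h1 h2
    exact ⟨h1, h2⟩
  obtain ⟨S, hS, hSo, hpS⟩ := mem_nhds_iff.1 hev
  let φ' := φ.restrOpen S hSo
  have hsrc : φ'.source = φ.source ∩ S := φ.restrOpen_source S hSo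
  have htr : IsParam (e.trans φ') := by
    refine he.trans ?_ ?_
    · refine hh.mono fun w hw => ?_
      rw [hsrc] at hw
      exact (hS hw.2).1
    · intro w hw
      have hw' : φ'.symm w ∈ φ.source ∩ S := by
        rw [← hsrc]; exact φ'.map_target hw
      obtain ⟨h1, L', hL'⟩ := hS hw'.2
      have h3 : ContDiffAt ℝ ∞ (z ∘ e.symm) (φ'.symm w) :=
        hh.contDiffAt (e.open_target.mem_nhds h1)
      refine (φ'.contDiffAt_symm (f₀' := L') hw ?_ h3).contDiffWithinAt
      rw [hL']
      exact (h3.differentiableAt (by simp)).hasFDerivAt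
  refine ⟨e.trans φ', htr, ?_, ?_, ?_⟩
  · rw [OpenPartialHomeomorph.trans_source, hsrc]
    exact ⟨hpe, hpφ, hpS⟩
  · rw [OpenPartialHomeomorph.trans_source]
    exact Set.inter_subset_left.trans heU
  · intro q hq
    rw [OpenPartialHomeomorph.trans_source] at hq
    change z (e.symm (e q)) = z q
    rw [e.left_inv hq.1]

end param

end

end HypFront

namespace HypFront

noncomputable section

/-! ### Calculus of maps from the complex plane to Lorentz-Minkowski space -/

lemma contDiff_lor {n : WithTop ℕ∞} : ContDiff ℝ n fun x : R41 × R41 => lor x.1 x.2 := by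
  unfold lor; fun_prop

lemma continuous_lor : Continuous fun x : R41 × R41 => lor x.1 x.2 :=
  (contDiff_lor (n := 0)).continuous

lemma continuous_wed : Continuous fun x : R41 × R41 × R41 × R41 => wed x.1 x.2.1 x.2.2.1 x.2.2.2 := by
  simp only [wed_eq]; fun_prop

/-- The derivative of `g` in the constant direction `c`. -/
def pd {F : Type*} [NormedAddCommGroup F] [NormedSpace ℝ F] (g : ℂ → F) (c w : ℂ) : F :=
  fderiv ℝ g w c

lemma hasDerivAt_lor_line {g h : ℝ → R41} {g' h' : R41} {t : ℝ} (hg : HasDerivAt g g' t)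
    (hh : HasDerivAt h h' t) :
    HasDerivAt (fun x => lor (g x) (h x)) (lor g' (h t) + lor (g t) h') t := by
  have a := fun i => (hasDerivAt_pi.1 hg i)
  have b := fun i => (hasDerivAt_pi.1 hh i)
  have := ((((a 0).mul (b 0)).neg.add ((a 1).mul (b 1))).add ((a 2).mul (b 2))).add
    ((a 3).mul (b 3))
  refine this.congr_deriv ?_
  simp only [lor]; ring

section

variable {F : Type*} [NormedAddCommGroup F] [NormedSpace ℝ F] {T : Set ℂ} {g h : ℂ → R41} {w : ℂ}

lemma pd_congr {g h : ℂ → F} (hT : IsOpen T) (hw : w ∈ T) (hgh : ∀ x ∈ T, g x = h x) (c : ℂ) :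
    pd g c w = pd h c w := by
  have : g =ᶠ[𝓝 w] h := by
    filter_upwards [hT.mem_nhds hw] with x hx using hgh x hx
  simp only [pd, this.fderiv_eq]

lemma pd_eq_zero {g : ℂ → F} (hT : IsOpen T) (hw : w ∈ T) (k : F) (hg : ∀ x ∈ T, g x = k) (c : ℂ) :
    pd g c w = 0 := by
  rw [pd_congr hT hw hg]; simp [pd]

lemma differentiableAt_of_contDiffOn {g : ℂ → F} (hT : IsOpen T) (hg : ContDiffOn ℝ ∞ g T)
    (hw : w ∈ T) :
    DifferentiableAt ℝ g w :=
  (hg.contDiffAt (hT.mem_nhds hw)).differentiableAt (by simp)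

lemma contDiffOn_pd {g : ℂ → F} (hT : IsOpen T) (hg : ContDiffOn ℝ ∞ g T) (c : ℂ) :
    ContDiffOn ℝ ∞ (pd g c) T :=
  (hg.fderiv_of_isOpen hT (by simp)).clm_apply contDiffOn_const

lemma contDiffOn_lor (hg : ContDiffOn ℝ ∞ g T) (hh : ContDiffOn ℝ ∞ h T) :
    ContDiffOn ℝ ∞ (fun x => lor (g x) (h x)) T :=
  contDiff_lor.comp_contDiffOn (hg.prodMk hh)

lemma hasDerivAt_line {g : ℂ → F} (hg : DifferentiableAt ℝ g w) (c : ℂ) :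
    HasDerivAt (fun t : ℝ => g (w + t • c)) (pd g c w) 0 := by
  have h1 : HasDerivAt (fun t : ℝ => w + t • c) c 0 := by
    simpa using ((hasDerivAt_id (0 : ℝ)).smul_const c).const_add w
  have h2 : HasFDerivAt g (fderiv ℝ g w) (w + (0 : ℝ) • c) := by
    simpa using hg.hasFDerivAt
  exact h2.comp_hasDerivAt (0 : ℝ) h1

lemma pd_lor (hg : DifferentiableAt ℝ g w) (hh : DifferentiableAt ℝ h w) (c : ℂ) :
    pd (fun x => lor (g x) (h x)) c w = lor (pd g c w) (h w) + lor (g w) (pd h c w) := by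
  have hd : DifferentiableAt ℝ (fun x => lor (g x) (h x)) w :=
    ((contDiff_lor (n := 1)).differentiable (by simp) _).comp w (hg.prodMk hh)
  have h1 := hasDerivAt_line hd c
  have h2 := hasDerivAt_lor_line (hasDerivAt_line hg c) (hasDerivAt_line hh c)
  simpa using h1.unique h2

lemma pd_comm (hT : IsOpen T) (hg : ContDiffOn ℝ ∞ g T) (hw : w ∈ T) (c d : ℂ) :
    pd (pd g c) d w = pd (pd g d) c w := by
  have hat : ContDiffAt ℝ ∞ g w := hg.contDiffAt (hT.mem_nhds hw)
  have hs : IsSymmSndFDerivAt ℝ g w := hat.isSymmSndFDerivAt (by simpa using WithTop.coe_le_coe.2 (le_top (a := (2 : ℕ∞))))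
  have hdd : DifferentiableAt ℝ (fderiv ℝ g) w :=
    ((hg.fderiv_of_isOpen (m := ∞) hT (by simp)).contDiffAt (hT.mem_nhds hw)).differentiableAt
      (by simp)
  have key : ∀ c d, pd (pd g c) d w = fderiv ℝ (fderiv ℝ g) w d c := by
    intro c d
    change fderiv ℝ (fun x => fderiv ℝ g x c) w d = _
    rw [fderiv_clm_apply hdd (by fun_prop)]
    simp
  rw [key, key]
  exact hs d c

end

/-- The Codazzi equation in conformal coordinates: a trace-free symmetric tensor `⟨dΔ, dΓ⟩`
is the real part of a holomorphic quadratic differential. -/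
lemma differentiableOn_hopf {T : Set ℂ} (hT : IsOpen T) {Γ Δ : ℂ → R41} {lam : ℂ → ℝ}
    (hΓ : ContDiffOn ℝ ∞ Γ T) (hΔ : ContDiffOn ℝ ∞ Δ T) (h0 : ∀ w ∈ T, lam w ≠ 0)
    (h11 : ∀ w ∈ T, lor (pd Γ 1 w) (pd Γ 1 w) = lam w)
    (hII : ∀ w ∈ T, lor (pd Γ Complex.I w) (pd Γ Complex.I w) = lam w)
    (h1I : ∀ w ∈ T, lor (pd Γ 1 w) (pd Γ Complex.I w) = 0)
    (hs : ∀ w ∈ T, lor (pd Δ Complex.I w) (pd Γ 1 w) = lor (pd Δ 1 w) (pd Γ Complex.I w))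
    (ht : ∀ w ∈ T, lor (pd Δ Complex.I w) (pd Γ Complex.I w) = -lor (pd Δ 1 w) (pd Γ 1 w))
    (he1 : ∀ w ∈ T, lam w • pd Δ 1 w = lor (pd Δ 1 w) (pd Γ 1 w) • pd Γ 1 w
      + lor (pd Δ 1 w) (pd Γ Complex.I w) • pd Γ Complex.I w)
    (heI : ∀ w ∈ T, lam w • pd Δ Complex.I w = lor (pd Δ 1 w) (pd Γ Complex.I w) • pd Γ 1 w
      - lor (pd Δ 1 w) (pd Γ 1 w) • pd Γ Complex.I w) :
    DifferentiableOn ℂ (fun w => (lor (pd Δ 1 w) (pd Γ 1 w) : ℂ)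
      - (lor (pd Δ 1 w) (pd Γ Complex.I w) : ℂ) * Complex.I) T := by
  intro w hw
  have hG1 := contDiffOn_pd hT hΓ 1
  have hGI := contDiffOn_pd hT hΓ Complex.I
  have hD1 := contDiffOn_pd hT hΔ 1
  have hDI := contDiffOn_pd hT hΔ Complex.I
  have dG1 := differentiableAt_of_contDiffOn hT hG1 hw
  have dGI := differentiableAt_of_contDiffOn hT hGI hw
  have dD1 := differentiableAt_of_contDiffOn hT hD1 hw
  have dDI := differentiableAt_of_contDiffOn hT hDI hw
  set a : ℂ → ℝ := fun w => lor (pd Δ 1 w) (pd Γ 1 w) with ha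
  set b : ℂ → ℝ := fun w => lor (pd Δ 1 w) (pd Γ Complex.I w) with hb
  have da : DifferentiableAt ℝ a w :=
    differentiableAt_of_contDiffOn hT (contDiffOn_lor hD1 hG1) hw
  have db : DifferentiableAt ℝ b w :=
    differentiableAt_of_contDiffOn hT (contDiffOn_lor hD1 hGI) hw
  have cG := pd_comm hT hΓ hw 1 Complex.I
  have cD := pd_comm hT hΔ hw 1 Complex.I
  -- second order identities of the conformal metric
  have e1 : ∀ c, 2 * lor (pd (pd Γ 1) c w) (pd Γ 1 w) =
      2 * lor (pd (pd Γ Complex.I) c w) (pd Γ Complex.I w) := by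
    intro c
    have := pd_congr hT hw (fun x hx => (h11 x hx).trans (hII x hx).symm) c
    rw [pd_lor dG1 dG1, pd_lor dGI dGI] at this
    rw [lor_comm (pd Γ 1 w), lor_comm (pd Γ Complex.I w)] at this
    linarith
  have e2 : ∀ c, lor (pd (pd Γ 1) c w) (pd Γ Complex.I w)
      + lor (pd Γ 1 w) (pd (pd Γ Complex.I) c w) = 0 := by
    intro c
    rw [← pd_lor dG1 dGI]
    exact pd_eq_zero hT hw 0 h1I c
  have i1 := e1 1; have i2 := e1 Complex.I; have i3 := e2 1; have i4 := e2 Complex.I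
  rw [← cG] at i1 i3
  rw [lor_comm (pd Γ 1 w)] at i3 i4
  -- the derivatives of `a` and `b`
  have a1 : pd a 1 w = -(lor (pd (pd Δ 1) Complex.I w) (pd Γ Complex.I w)
      + lor (pd Δ Complex.I w) (pd (pd Γ 1) Complex.I w)) := by
    have : pd a 1 w = pd (fun x => -lor (pd Δ Complex.I x) (pd Γ Complex.I x)) 1 w :=
      pd_congr hT hw (fun x hx => by rw [ht x hx, neg_neg]) 1
    rw [this, cD, cG, ← pd_lor dDI dGI]
    simp [pd, fderiv_fun_neg]
  have aI : pd a Complex.I w = lor (pd (pd Δ 1) Complex.I w) (pd Γ 1 w)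
      + lor (pd Δ 1 w) (pd (pd Γ 1) Complex.I w) := pd_lor dD1 dG1 _
  have b1 : pd b 1 w = lor (pd (pd Δ 1) Complex.I w) (pd Γ 1 w)
      + lor (pd Δ Complex.I w) (pd (pd Γ 1) 1 w) := by
    have : pd b 1 w = pd (fun x => lor (pd Δ Complex.I x) (pd Γ 1 x)) 1 w :=
      pd_congr hT hw (fun x hx => (hs x hx).symm) 1
    rw [this, cD, ← pd_lor dDI dG1]
  have bI : pd b Complex.I w = lor (pd (pd Δ 1) Complex.I w) (pd Γ Complex.I w)
      + lor (pd Δ 1 w) (pd (pd Γ Complex.I) Complex.I w) := pd_lor dD1 dGI _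
  have x1 : ∀ y, lam w * lor (pd Δ 1 w) y = a w * lor (pd Γ 1 w) y
      + b w * lor (pd Γ Complex.I w) y := by
    intro y
    have := congrArg (fun x => lor x y) (he1 w hw)
    simpa only [lor_add_left, lor_smul_left] using this
  have xI : ∀ y, lam w * lor (pd Δ Complex.I w) y = b w * lor (pd Γ 1 w) y
      - a w * lor (pd Γ Complex.I w) y := by
    intro y
    have := congrArg (fun x => lor x y) (heI w hw)
    simpa only [lor_sub_left, lor_smul_left] using this
  have y1 := x1 (pd (pd Γ 1) Complex.I w)
  have y2 := xI (pd (pd Γ 1) 1 w)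
  have y3 := xI (pd (pd Γ 1) Complex.I w)
  have y4 := x1 (pd (pd Γ Complex.I) Complex.I w)
  simp only [lor_comm (pd Γ 1 w), lor_comm (pd Γ Complex.I w)] at y1 y2 y3 y4
  -- In `a_y - b_x` the mixed second derivatives of `Δ` cancel. What remains pairs `dΔ` with second
  -- derivatives of `Γ`; expanding `dΔ` in `dΓ` and using the differentiated conformality relations
  -- makes it zero. The companion equation `b_y = -a_x` is obtained in the same way, so `a - ib`
  -- satisfies the Cauchy-Riemann equations.
  have CR1 : pd a Complex.I w = pd b 1 w := by
    rw [aI, b1]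
    apply mul_left_cancel₀ (h0 w hw)
    linear_combination y1 - y2 - b w / 2 * i1 + a w * i3
  have CR2 : pd b Complex.I w = -pd a 1 w := by
    rw [bI, a1]
    apply mul_left_cancel₀ (h0 w hw)
    linear_combination y4 - y3 + a w * i4 - b w / 2 * i2
  have hreal : DifferentiableAt ℝ (fun w => (a w : ℂ) - (b w : ℂ) * Complex.I) w :=
    (Complex.ofRealCLM.differentiableAt.comp w da).sub
      ((Complex.ofRealCLM.differentiableAt.comp w db).mul_const _)
  have hval : ∀ c, fderiv ℝ (fun w => (a w : ℂ) - (b w : ℂ) * Complex.I) w c =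
      ((pd a c w : ℝ) : ℂ) - ((pd b c w : ℝ) : ℂ) * Complex.I := by
    intro c
    have h1 := (Complex.ofRealCLM.hasFDerivAt.comp w da.hasFDerivAt).sub
      ((Complex.ofRealCLM.hasFDerivAt.comp w db.hasFDerivAt).mul_const Complex.I)
    have h2 := h1.fderiv
    have h3 : (fun w => (a w : ℂ) - (b w : ℂ) * Complex.I) =
      ((⇑Complex.ofRealCLM ∘ a) - fun y => (⇑Complex.ofRealCLM ∘ b) y * Complex.I) := rfl
    rw [h3, h2]
    simp [pd, mul_comm]
  refine (differentiableAt_complex_iff_differentiableAt_real.2 ⟨hreal, ?_⟩).differentiableWithinAt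
  rw [hval, hval, CR1, CR2, smul_eq_mul]
  push_cast
  linear_combination ((pd b 1 w : ℝ) : ℂ) * Complex.I_sq

end

end HypFront

namespace HypFront

noncomputable section

/-! ### Legendrian maps -/

section legendrian

variable {M : Type*} [TopologicalSpace M] [ChartedSpace (EuclideanSpace ℝ (Fin 2)) M]

/-- On the open set `U`, `f` is a smooth map to the hyperboloid with smooth unit normal `ν`. -/
structure Normal (f ν : M → R41) (U : Set M) : Prop where
  isOpen : IsOpen U
  smooth : ContMDiffOn (𝓡 2) 𝓘(ℝ, R41) ∞ f U
  smooth_normal : ContMDiffOn (𝓡 2) 𝓘(ℝ, R41) ∞ ν U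
  isFrame : ∀ p ∈ U, Frame (f p) (ν p)
  perp : ∀ p ∈ U, ∀ v, lor (diff f p v) (ν p) = 0

/-- Linear combination of a map and its normal with constant coefficients. -/
def comb (a b : ℝ) (f ν : M → R41) : M → R41 := fun p => a • f p + b • ν p

variable {f ν : M → R41} {U V : Set M} {p : M}

lemma Normal.mono (h : Normal f ν U) (hV : IsOpen V) (hVU : V ⊆ U) : Normal f ν V where
  isOpen := hV
  smooth := h.smooth.mono hVU
  smooth_normal := h.smooth_normal.mono hVU
  isFrame p hp := h.isFrame p (hVU hp)
  perp p hp := h.perp p (hVU hp)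

lemma Normal.mdiff (h : Normal f ν U) (hp : p ∈ U) : MDifferentiableAt (𝓡 2) 𝓘(ℝ, R41) f p :=
  mdiff_of_contMDiffOn h.isOpen h.smooth hp

lemma Normal.mdiff_normal (h : Normal f ν U) (hp : p ∈ U) :
    MDifferentiableAt (𝓡 2) 𝓘(ℝ, R41) ν p :=
  mdiff_of_contMDiffOn h.isOpen h.smooth_normal hp

lemma diff_comb (hf : MDifferentiableAt (𝓡 2) 𝓘(ℝ, R41) f p)
    (hν : MDifferentiableAt (𝓡 2) 𝓘(ℝ, R41) ν p) (a b : ℝ) :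
    diff (comb a b f ν) p = a • diff f p + b • diff ν p := by
  have h1 := (hf.hasMFDerivAt.const_smul a).add (hν.hasMFDerivAt.const_smul b)
  exact h1.mfderiv

lemma Normal.diff_comb (h : Normal f ν U) (hp : p ∈ U) (a b : ℝ)
    (v : EuclideanSpace ℝ (Fin 2)) :
    diff (comb a b f ν) p v = a • diff f p v + b • diff ν p v := by
  rw [HypFront.diff_comb (h.mdiff hp) (h.mdiff_normal hp)]; rfl

lemma Normal.smooth_comb (h : Normal f ν U) (a b : ℝ) :
    ContMDiffOn (𝓡 2) 𝓘(ℝ, R41) ∞ (comb a b f ν) U :=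
  have hc : ContDiff ℝ ∞ fun x : R41 × R41 => a • x.1 + b • x.2 := by fun_prop
  hc.contMDiff.comp_contMDiffOn (h.smooth.prodMk_space h.smooth_normal)

lemma diff_congr {g h : M → R41} (hgh : g =ᶠ[𝓝 p] h) : diff g p = diff h p :=
  hgh.mfderiv_eq

lemma diff_eq_zero_of_eventuallyEq_const {g : M → R41} {c : R41} (h : ∀ᶠ q in 𝓝 p, g q = c) :
    diff g p = 0 := by
  have : g =ᶠ[𝓝 p] fun _ => c := h
  rw [diff_congr this]
  exact mfderiv_const

variable [IsManifold (𝓡 2) ∞ M]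

lemma Normal.legPt (h : Normal f ν U) (hp : p ∈ U) :
    LegPt (f p) (ν p) (diff f p).toLinearMap (diff ν p).toLinearMap := by
  obtain ⟨e, he, hpe, heU⟩ := exists_param p h.isOpen hp
  set F := f ∘ e.symm with hF
  set N := ν ∘ e.symm with hN
  have hT := e.open_target
  have sF : ContDiffOn ℝ ∞ F e.target := he.contDiffOn_comp h.smooth heU
  have sN : ContDiffOn ℝ ∞ N e.target := he.contDiffOn_comp h.smooth_normal heU
  have dF : ∀ w ∈ e.target, DifferentiableAt ℝ F w := fun w hw =>
    differentiableAt_of_contDiffOn hT sF hw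
  have dN : ∀ w ∈ e.target, DifferentiableAt ℝ N w := fun w hw =>
    differentiableAt_of_contDiffOn hT sN hw
  have mem : ∀ w ∈ e.target, e.symm w ∈ U := fun w hw => heU (e.map_target hw)
  have ff : ∀ w ∈ e.target, lor (F w) (F w) = -1 := fun w hw => (h.isFrame _ (mem w hw)).ff
  have nn : ∀ w ∈ e.target, lor (N w) (N w) = 1 := fun w hw => (h.isFrame _ (mem w hw)).nn
  have fn : ∀ w ∈ e.target, lor (F w) (N w) = 0 := fun w hw => (h.isFrame _ (mem w hw)).fn
  have gF : ∀ q ∈ e.source, ∀ c, pd F c (e q) = diff f q (frame e q c) := fun q hq c =>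
    he.fderiv_comp hq (h.mdiff (heU hq)) c
  have gN : ∀ q ∈ e.source, ∀ c, pd N c (e q) = diff ν q (frame e q c) := fun q hq c =>
    he.fderiv_comp hq (h.mdiff_normal (heU hq)) c
  have fcn : ∀ c, ∀ w ∈ e.target, lor (pd F c w) (N w) = 0 := by
    intro c w hw
    have h1 := gF (e.symm w) (e.map_target hw) c
    rw [e.right_inv hw] at h1
    rw [h1]
    exact h.perp _ (mem w hw) _
  have hw := e.map_source hpe
  have sf : F (e p) = f p := by rw [hF, Function.comp, e.left_inv hpe]
  have sn : N (e p) = ν p := by rw [hN, Function.comp, e.left_inv hpe]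
  have dfsurj := he.frame_surjective hpe
  refine ⟨h.isFrame p hp, ?_, ?_, ?_⟩
  · intro v
    refine ⟨?_, h.perp p hp v⟩
    obtain ⟨c, rfl⟩ := dfsurj v
    have h1 := pd_eq_zero hT hw (-1) ff c
    rw [pd_lor (dF _ hw) (dF _ hw), gF p hpe, sf, lor_comm (f p)] at h1
    change lor (diff f p (frame e p c)) (f p) = 0
    linarith
  · intro v
    obtain ⟨c, rfl⟩ := dfsurj v
    constructor
    · have h1 := pd_eq_zero hT hw 0 fn c
      rw [pd_lor (dF _ hw) (dN _ hw), gF p hpe, gN p hpe, sn, sf, h.perp p hp, zero_add,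
        lor_comm] at h1
      exact h1
    · have h1 := pd_eq_zero hT hw 1 nn c
      rw [pd_lor (dN _ hw) (dN _ hw), gN p hpe, sn, lor_comm (ν p)] at h1
      change lor (diff ν p (frame e p c)) (ν p) = 0
      linarith
  · intro v w'
    obtain ⟨c, rfl⟩ := dfsurj v
    obtain ⟨d, rfl⟩ := dfsurj w'
    have key : ∀ c d, lor (pd (pd F c) d (e p)) (N (e p)) +
        lor (pd F c (e p)) (pd N d (e p)) = 0 := by
      intro c d
      rw [← pd_lor (differentiableAt_of_contDiffOn hT (contDiffOn_pd hT sF c) hw) (dN _ hw)]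
      exact pd_eq_zero hT hw 0 (fcn c) d
    have k1 := key c d
    have k2 := key d c
    rw [pd_comm hT sF hw c d] at k1
    change lor (diff f p (frame e p c)) (diff ν p (frame e p d)) =
      lor (diff f p (frame e p d)) (diff ν p (frame e p c))
    rw [← gF p hpe, ← gF p hpe, ← gN p hpe, ← gN p hpe]
    linarith

end legendrian

/-! ### Conformal coordinates from a map into the light cone -/

/-- Stereographic parametrization of a section of the light cone. -/
def sig (s : ℝ) (z : ℂ) : R41 :=
  ![(1 + (z.re * z.re + z.im * z.im)) / 2, z.re, z.im, s * ((z.re * z.re + z.im * z.im) - 1) / 2]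

/-- The derivative of `sig`. -/
def dsig (s : ℝ) (z c : ℂ) : R41 :=
  ![z.re * c.re + z.im * c.im, c.re, c.im, s * (z.re * c.re + z.im * c.im)]

lemma lor_sig {s : ℝ} (hs : s * s = 1) (z : ℂ) : lor (sig s z) (sig s z) = 0 := by
  simp [lor, sig]
  linear_combination ((z.re * z.re + z.im * z.im) - 1) ^ 2 / 4 * hs

lemma lor_sig_dsig {s : ℝ} (hs : s * s = 1) (z c : ℂ) : lor (sig s z) (dsig s z c) = 0 := by
  simp [lor, sig, dsig]
  linear_combination ((z.re * z.re + z.im * z.im) - 1) / 2 * (z.re * c.re + z.im * c.im) * hs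

lemma lor_dsig {s : ℝ} (hs : s * s = 1) (z c d : ℂ) :
    lor (dsig s z c) (dsig s z d) = c.re * d.re + c.im * d.im := by
  simp [lor, dsig]
  linear_combination (z.re * c.re + z.im * c.im) * (z.re * d.re + z.im * d.im) * hs

lemma hasDerivAt_smul_sig (s : ℝ) {L : ℝ → ℝ} {z : ℝ → ℂ} {L' : ℝ} {z' : ℂ} {t : ℝ}
    (hL : HasDerivAt L L' t) (hz : HasDerivAt z z' t) :
    HasDerivAt (fun x => L x • sig s (z x)) (L' • sig s (z t) + L t • dsig s (z t) z') t := by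
  have hr : HasDerivAt (fun x => (z x).re) z'.re t :=
    (Complex.reCLM.hasFDerivAt (x := z t)).comp_hasDerivAt t hz
  have hi : HasDerivAt (fun x => (z x).im) z'.im t :=
    (Complex.imCLM.hasFDerivAt (x := z t)).comp_hasDerivAt t hz
  have hn := (hr.mul hr).add (hi.mul hi)
  refine hL.smul (hasDerivAt_pi.2 ?_) |>.congr_deriv (add_comm _ _)
  intro i
  fin_cases i
  · exact ((hn.const_add 1).div_const 2).congr_deriv (by simp [dsig]; ring)
  · exact hr
  · exact hi
  · exact (((hn.sub_const 1).const_mul s).div_const 2).congr_deriv (by simp [dsig]; ring)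

/-- A nonzero vector of the light cone has a stereographic coordinate. -/
lemma eq_smul_sig {s : ℝ} (hs : s * s = 1) {G : R41} (h0 : lor G G = 0)
    (hL : G 0 - s * G 3 ≠ 0) :
    G = (G 0 - s * G 3) •
      sig s ⟨G 1 / (G 0 - s * G 3), G 2 / (G 0 - s * G 3)⟩ := by
  simp only [lor] at h0
  obtain ⟨L, hLG⟩ : ∃ L, L = G 0 - s * G 3 := ⟨_, rfl⟩
  rw [← hLG] at hL ⊢
  have hq : G 1 / L * (G 1 / L) + G 2 / L * (G 2 / L) = (G 0 + s * G 3) / L := by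
    field_simp
    rw [hLG]
    linear_combination h0 + G 3 ^ 2 * hs
  funext i
  fin_cases i
  · simp only [sig, hq]
    simp
    field_simp
    rw [hLG]; ring
  · simp [sig]; field_simp
  · simp [sig]; field_simp
  · simp only [sig, hq]
    simp
    field_simp
    rw [hLG]; linear_combination (-2 * G 3) * hs

/-- If `G 0 - G 3` and `G 0 + G 3` both vanished, nullity would force `G = 0`. The sign selects a
pole of stereographic projection that the point avoids. -/
lemma exists_sign_ne_zero {G f : R41} (h0 : lor G G = 0) (hf : lor G f ≠ 0) :
    ∃ s : ℝ, s * s = 1 ∧ G 0 - s * G 3 ≠ 0 := by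
  by_contra! hcon
  have h1 := hcon 1 (by norm_num)
  have h2 := hcon (-1) (by norm_num)
  have e0 : G 0 = 0 := by linarith
  have e3 : G 3 = 0 := by linarith
  simp only [lor, e0, e3] at h0
  have e1 : G 1 = 0 := by nlinarith [sq_nonneg (G 1), sq_nonneg (G 2)]
  have e2 : G 2 = 0 := by nlinarith [sq_nonneg (G 1), sq_nonneg (G 2)]
  exact hf (by simp [lor, e0, e1, e2, e3])

end

end HypFront

namespace HypFront

noncomputable section

/-! ### The conformal coordinate of the hyperbolic Gauss map and isolated zeros. -/

section conformal

lemma pd_smul_sig {T : Set ℂ} (hT : IsOpen T) {Γ : ℂ → R41} {L : ℂ → ℝ} {z : ℂ → ℂ} {w : ℂ}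
    (s : ℝ) (hw : w ∈ T) (hΓ : DifferentiableAt ℝ Γ w) (hL : DifferentiableAt ℝ L w)
    (hz : DifferentiableAt ℝ z w) (h : ∀ x ∈ T, Γ x = L x • sig s (z x)) (c : ℂ) :
    pd Γ c w = pd L c w • sig s (z w) + L w • dsig s (z w) (pd z c w) := by
  have h1 := hasDerivAt_line hΓ c
  have h2 := hasDerivAt_smul_sig s (hasDerivAt_line hL c) (hasDerivAt_line hz c)
  have h3 : (fun t : ℝ => Γ (w + t • c)) =ᶠ[𝓝 0]
      fun t => L (w + t • c) • sig s (z (w + t • c)) := by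
    have hc : ContinuousAt (fun t : ℝ => w + t • c) 0 := by fun_prop
    have : ∀ᶠ t in 𝓝 (0 : ℝ), w + t • c ∈ T :=
      hc.eventually (hT.mem_nhds (by simpa using hw))
    filter_upwards [this] with t ht using h _ ht
  simpa using h1.unique (h2.congr_of_eventuallyEq h3)

variable {f n a b c d : R41}

/-- A trace-free symmetric operator in an orthogonal basis of vectors of equal length. -/
lemma trace_free_expansion (h : Frame f n) (ha : Perp f n a) (hb : Perp f n b)
    (hc : Perp f n c) (hd : Perp f n d) {lam : ℝ} (h0 : lam ≠ 0) (haa : lor a a = lam)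
    (hcc : lor c c = lam) (hac : lor a c = 0) (hsym : lor d a = lor b c)
    (hw : wed f n a d + wed f n b c = 0) :
    lor d c = -lor b a ∧ lam • b = lor b a • a + lor b c • c ∧
      lam • d = lor b c • a - lor b a • c := by
  have hca : lor c a = 0 := by rw [lor_comm, hac]
  have e1 := wed_mul_wed h ha hc ha hd
  have e2 := wed_mul_wed h ha hc hb hc
  have e3 := wed_mul_wed h ha hc ha hc
  rw [haa, hcc, hac, hca] at e3
  have hwac : wed f n a c ≠ 0 := by
    intro h1
    rw [h1] at e3
    have : lam * lam = 0 := by linarith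
    exact h0 (mul_self_eq_zero.1 this)
  -- Multiplying the mixed condition by `wed f n a c` and applying the Lagrange identity to each
  -- term turns it into vanishing of the trace.
  have ht : lor d c = -lor b a := by
    rw [haa, hca] at e1
    rw [hcc, hac] at e2
    apply mul_left_cancel₀ h0
    rw [lor_comm d c, lor_comm b a]
    linear_combination wed f n a c * hw - e1 - e2
  have expand : ∀ u, Perp f n u → lam • u = lor u a • a + lor u c • c := by
    intro u hu
    rw [← sub_eq_zero]
    refine eq_zero_of_perp_basis h ha hc ((hu.smul lam).sub ((ha.smul _).add (hc.smul _)))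
      hwac ?_ ?_
    · rw [lor_sub_right, lor_add_right, lor_smul_right, lor_smul_right, lor_smul_right, haa, hac,
        lor_comm a u]; ring
    · rw [lor_sub_right, lor_add_right, lor_smul_right, lor_smul_right, lor_smul_right, hcc, hca,
        lor_comm c u]; ring
  refine ⟨ht, expand b hb, ?_⟩
  rw [expand d hd, hsym, ht, neg_smul, sub_eq_add_neg]

end conformal

section legendrian

variable {M : Type*} [TopologicalSpace M] [ChartedSpace (EuclideanSpace ℝ (Fin 2)) M]
  [IsManifold (𝓡 2) ∞ M] {f ν : M → R41} {U V : Set M} {p : M}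

lemma Normal.perp_comb (h : Normal f ν U) (hp : p ∈ U) (a b : ℝ)
    (v : EuclideanSpace ℝ (Fin 2)) : Perp (f p) (ν p) (diff (comb a b f ν) p v) := by
  rw [h.diff_comb hp]
  exact ((h.legPt hp).Xp v |>.smul a).add ((h.legPt hp).Yp v |>.smul b)

lemma Normal.sym (h : Normal f ν U) (hp : p ∈ U) (v w : EuclideanSpace ℝ (Fin 2)) :
    lor (diff f p v) (diff ν p w) = lor (diff f p w) (diff ν p v) :=
  (h.legPt hp).sym v w

lemma Normal.sym_comb (h : Normal f ν U) (hp : p ∈ U) (a b c d : ℝ)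
    (v w : EuclideanSpace ℝ (Fin 2)) :
    lor (diff (comb a b f ν) p v) (diff (comb c d f ν) p w) =
      lor (diff (comb a b f ν) p w) (diff (comb c d f ν) p v) := by
  have e := h.sym hp
  simp only [h.diff_comb hp, lor_add_left, lor_add_right, lor_smul_left, lor_smul_right]
  rw [lor_comm (diff f p w) (diff f p v), lor_comm (diff ν p w) (diff ν p v),
    lor_comm (diff ν p v) (diff f p w), lor_comm (diff ν p w) (diff f p v), e v w]

/-- The stereographic coordinate on an open subset of Lorentz-Minkowski space. -/
def stereo (s : ℝ) (x : R41) : ℂ :=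
  Complex.equivRealProdCLM.symm (x 1 / (x 0 - s * x 3), x 2 / (x 0 - s * x 3))

lemma contDiffOn_stereo (s : ℝ) : ContDiffOn ℝ ∞ (stereo s) {x | x 0 - s * x 3 ≠ 0} := by
  refine Complex.equivRealProdCLM.symm.contDiff.comp_contDiffOn ?_
  refine ContDiffOn.prodMk ?_ ?_
  · exact ContDiffOn.div (by fun_prop) (by fun_prop) fun x hx => hx
  · exact ContDiffOn.div (by fun_prop) (by fun_prop) fun x hx => hx

/-- If the mixed area form of `f + ν` and of a parallel map `D` vanishes, then near a regular
point of `f + ν` the differential of `D` vanishes either identically or at most at one point. -/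
theorem Normal.isolated_or_zero (h : Normal f ν U) (hp : p ∈ U) (a b : ℝ)
    (hm : ∀ q ∈ U, ∀ v w, wed (f q) (ν q) (diff (comb 1 1 f ν) q v) (diff (comb a b f ν) q w) +
      wed (f q) (ν q) (diff (comb a b f ν) q v) (diff (comb 1 1 f ν) q w) = 0)
    (hG : ∀ v, diff (comb 1 1 f ν) p v = 0 → v = 0) :
    (∀ᶠ q in 𝓝 p, diff (comb a b f ν) q = 0) ∨
      ∀ᶠ q in 𝓝[≠] p, diff (comb a b f ν) q ≠ 0 := by
  set G := comb 1 1 f ν with hGdef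
  set D := comb a b f ν with hDdef
  have sG : ContMDiffOn (𝓡 2) 𝓘(ℝ, R41) ∞ G U := h.smooth_comb 1 1
  have sD : ContMDiffOn (𝓡 2) 𝓘(ℝ, R41) ∞ D U := h.smooth_comb a b
  have hnull : ∀ q ∈ U, lor (G q) (G q) = 0 := by
    intro q hq
    have F := h.isFrame q hq
    simp only [hGdef, comb, one_smul, lor_add_left, lor_add_right, lor_comm (ν q) (f q), F.ff,
      F.nn, F.fn]
    norm_num
  have hGf : lor (G p) (f p) ≠ 0 := by
    have F := h.isFrame p hp
    simp only [hGdef, comb, one_smul, lor_add_left, lor_comm (ν p) (f p), F.ff, F.fn]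
    norm_num
  obtain ⟨s, hs, hLp⟩ := exists_sign_ne_zero (hnull p hp) hGf
  have hS : IsOpen {x : R41 | x 0 - s * x 3 ≠ 0} :=
    isOpen_ne_fun (by fun_prop) continuous_const
  set U₁ : Set M := U ∩ G ⁻¹' {x | x 0 - s * x 3 ≠ 0} with hU₁
  have hU₁o : IsOpen U₁ := sG.continuousOn.isOpen_inter_preimage h.isOpen hS
  have hp₁ : p ∈ U₁ := ⟨hp, hLp⟩
  have sub₁ : U₁ ⊆ U := Set.inter_subset_left
  set z : M → ℂ := fun q => stereo s (G q) with hz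
  have sz : ContMDiffOn (𝓡 2) 𝓘(ℝ, ℂ) ∞ z U₁ :=
    (contMDiffOn_iff_contDiffOn.2 (contDiffOn_stereo s)).comp (sG.mono sub₁) fun q hq => hq.2
  set L : M → ℝ := fun q => G q 0 - s * G q 3 with hL
  have sL : ContMDiffOn (𝓡 2) 𝓘(ℝ, ℝ) ∞ L U₁ := by
    have hc : ContDiff ℝ ∞ fun x : R41 => x 0 - s * x 3 := by fun_prop
    exact hc.contMDiff.comp_contMDiffOn (sG.mono sub₁)
  have hGz : ∀ q ∈ U₁, G q = L q • sig s (z q) := fun q hq =>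
    eq_smul_sig hs (hnull q hq.1) hq.2
  -- On the kernel of `dz`, `dG` is a multiple of the null vector `sig`. It is also spacelike or
  -- zero, hence zero, and `G` is immersed at `p`.
  have hinj : Function.Injective (cdiff z p) := by
    rw [injective_iff_map_eq_zero]
    intro v hv
    obtain ⟨e, he, hpe, heU⟩ := exists_param p hU₁o hp₁
    obtain ⟨c, rfl⟩ := he.frame_surjective hpe v
    apply hG
    have hw := e.map_source hpe
    have key := pd_smul_sig e.open_target s hw (L := L ∘ e.symm) (z := z ∘ e.symm)
      (Γ := G ∘ e.symm)
      (differentiableAt_of_contDiffOn e.open_target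
        (he.contDiffOn_comp (sG.mono sub₁) heU) hw)
      (differentiableAt_of_contDiffOn e.open_target (he.contDiffOn_comp sL heU) hw)
      (differentiableAt_of_contDiffOn e.open_target (he.contDiffOn_comp sz heU) hw)
      (fun x hx => hGz _ (heU (e.map_target hx))) c
    have k1 : pd (G ∘ e.symm) c (e p) = diff G p (frame e p c) :=
      he.fderiv_comp hpe (mdiff_of_contMDiffOn h.isOpen sG hp) c
    have k2 : pd (z ∘ e.symm) c (e p) = 0 :=
      (he.fderiv_comp_complex hpe (mdiff_of_contMDiffOn hU₁o sz hp₁) c).trans hv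
    rw [k1, k2] at key
    have k3 : dsig s ((z ∘ e.symm) (e p)) 0 = 0 := by
      funext i; fin_cases i <;> simp [dsig]
    rw [k3, smul_zero, add_zero] at key
    refine eq_zero_of_lor_self (h.isFrame p hp).ff (h.perp_comb hp 1 1 _).1 ?_
    rw [key, lor_smul_left, lor_smul_right, lor_sig hs, mul_zero, mul_zero]
  obtain ⟨e, he, hpe, heU₁, hez⟩ := exists_param_of_injective hU₁o hp₁ sz hinj
  have heU := heU₁.trans sub₁
  have hT := e.open_target
  have sΓ : ContDiffOn ℝ ∞ (G ∘ e.symm) e.target := he.contDiffOn_comp sG heU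
  have sΔ : ContDiffOn ℝ ∞ (D ∘ e.symm) e.target := he.contDiffOn_comp sD heU
  have sΛ : ContDiffOn ℝ ∞ (L ∘ e.symm) e.target := he.contDiffOn_comp sL heU₁
  have hpdG : ∀ w ∈ e.target, ∀ c, pd (G ∘ e.symm) c w =
      diff G (e.symm w) (frame e (e.symm w) c) := by
    intro w hw c
    have := he.fderiv_comp (e.map_target hw)
      (mdiff_of_contMDiffOn h.isOpen sG (heU (e.map_target hw))) c
    rwa [e.right_inv hw] at this
  have hpdD : ∀ w ∈ e.target, ∀ c, pd (D ∘ e.symm) c w =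
      diff D (e.symm w) (frame e (e.symm w) c) := by
    intro w hw c
    have := he.fderiv_comp (e.map_target hw)
      (mdiff_of_contMDiffOn h.isOpen sD (heU (e.map_target hw))) c
    rwa [e.right_inv hw] at this
  have hform : ∀ w ∈ e.target, ∀ c, pd (G ∘ e.symm) c w =
      pd (L ∘ e.symm) c w • sig s w + L (e.symm w) • dsig s w c := by
    intro w hw c
    have := pd_smul_sig hT s hw (L := L ∘ e.symm) (z := id) (Γ := G ∘ e.symm)
      (differentiableAt_of_contDiffOn hT sΓ hw) (differentiableAt_of_contDiffOn hT sΛ hw)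
      differentiableAt_id
      (fun x hx => by
        have h1 := hGz _ (heU₁ (e.map_target hx))
        rw [← hez _ (e.map_target hx), e.right_inv hx] at h1
        exact h1) c
    rw [this]
    simp [pd]
  -- The section `sig` is null, orthogonal to its derivative, and induces the flat metric. Hence
  -- rescaling it by `L` gives the conformal metric `L² |dz|²`, with no term in `dL`.
  have hmet : ∀ w ∈ e.target, ∀ c d, lor (pd (G ∘ e.symm) c w) (pd (G ∘ e.symm) d w) =
      L (e.symm w) ^ 2 * (c.re * d.re + c.im * d.im) := by
    intro w hw c d
    rw [hform w hw, hform w hw]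
    simp only [lor_add_left, lor_add_right, lor_smul_left, lor_smul_right, lor_sig hs,
      lor_sig_dsig hs, lor_dsig hs, lor_comm (dsig s w c) (sig s w)]
    ring
  set lam : ℂ → ℝ := fun w => L (e.symm w) ^ 2 with hlam
  have hlam0 : ∀ w ∈ e.target, lam w ≠ 0 := fun w hw =>
    pow_ne_zero 2 (heU₁ (e.map_target hw)).2
  have h11 : ∀ w ∈ e.target, lor (pd (G ∘ e.symm) 1 w) (pd (G ∘ e.symm) 1 w) = lam w := by
    intro w hw; rw [hmet w hw]; simp [hlam]
  have hII : ∀ w ∈ e.target,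
      lor (pd (G ∘ e.symm) Complex.I w) (pd (G ∘ e.symm) Complex.I w) = lam w := by
    intro w hw; rw [hmet w hw]; simp [hlam]
  have h1I : ∀ w ∈ e.target,
      lor (pd (G ∘ e.symm) 1 w) (pd (G ∘ e.symm) Complex.I w) = 0 := by
    intro w hw; rw [hmet w hw]; simp
  have hsy : ∀ w ∈ e.target, lor (pd (D ∘ e.symm) Complex.I w) (pd (G ∘ e.symm) 1 w) =
      lor (pd (D ∘ e.symm) 1 w) (pd (G ∘ e.symm) Complex.I w) := by
    intro w hw
    rw [hpdG w hw, hpdG w hw, hpdD w hw, hpdD w hw]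
    exact h.sym_comb (heU (e.map_target hw)) a b 1 1 _ _
  have hexp : ∀ w ∈ e.target, _ := fun w hw =>
    trace_free_expansion (h.isFrame _ (heU (e.map_target hw)))
      (a := pd (G ∘ e.symm) 1 w) (b := pd (D ∘ e.symm) 1 w) (c := pd (G ∘ e.symm) Complex.I w)
      (d := pd (D ∘ e.symm) Complex.I w)
      (by rw [hpdG w hw]; exact h.perp_comb (heU (e.map_target hw)) _ _ _)
      (by rw [hpdD w hw]; exact h.perp_comb (heU (e.map_target hw)) _ _ _)
      (by rw [hpdG w hw]; exact h.perp_comb (heU (e.map_target hw)) _ _ _)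
      (by rw [hpdD w hw]; exact h.perp_comb (heU (e.map_target hw)) _ _ _)
      (hlam0 w hw) (h11 w hw) (hII w hw) (h1I w hw) (hsy w hw)
      (by
        rw [hpdG w hw, hpdG w hw, hpdD w hw, hpdD w hw]
        exact hm _ (heU (e.map_target hw)) _ _)
  have hol := differentiableOn_hopf hT sΓ sΔ hlam0 h11 hII h1I hsy
    (fun w hw => (hexp w hw).1) (fun w hw => (hexp w hw).2.1) (fun w hw => (hexp w hw).2.2)
  have han := hol.analyticAt (hT.mem_nhds (e.map_source hpe))
  set Q : ℂ → ℂ := fun w => (lor (pd (D ∘ e.symm) 1 w) (pd (G ∘ e.symm) 1 w) : ℂ)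
      - (lor (pd (D ∘ e.symm) 1 w) (pd (G ∘ e.symm) Complex.I w) : ℂ) * Complex.I with hQ
  -- `Q` records both components of `dD` in the basis `dG`, so the zeros of the holomorphic function
  -- are exactly those of `dD`.
  have hiff : ∀ q ∈ e.source, Q (e q) = 0 ↔ diff D q = 0 := by
    intro q hq
    have hw := e.map_source hq
    have hD1 := hpdD _ hw 1
    have hDI := hpdD _ hw Complex.I
    rw [e.left_inv hq] at hD1 hDI
    constructor
    · intro h0
      have hre := congrArg Complex.re h0
      have him := congrArg Complex.im h0
      simp [hQ] at hre him
      obtain ⟨-, x1, x2⟩ := hexp _ hw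
      rw [hre, him, zero_smul, zero_smul, add_zero] at x1
      rw [hre, him, zero_smul, zero_smul, sub_zero] at x2
      have y1 := (smul_eq_zero.1 x1).resolve_left (hlam0 _ hw)
      have y2 := (smul_eq_zero.1 x2).resolve_left (hlam0 _ hw)
      ext1 v
      obtain ⟨α, β, rfl⟩ := he.frame_basis hq v
      rw [map_add, map_smul, map_smul, ← hD1, ← hDI, y1, y2]
      simp
    · intro h0
      simp [hQ, hD1, h0]
  have hsrc : ∀ᶠ q in 𝓝 p, q ∈ e.source := e.open_source.mem_nhds hpe
  rcases han.eventually_eq_zero_or_eventually_ne_zero with h0 | h0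
  · left
    filter_upwards [(e.continuousAt hpe).eventually h0, hsrc] with q hq hqs
    exact (hiff q hqs).1 hq
  · right
    rw [eventually_nhdsWithin_iff] at h0 ⊢
    filter_upwards [(e.continuousAt hpe).eventually h0, hsrc] with q hq hqs hne
    refine fun hD => hq ?_ ((hiff q hqs).2 hD)
    exact fun heq => hne (e.injOn hqs hpe heq)

end legendrian

end

end HypFront

namespace HypFront

noncomputable section

/-! ### Two constant principal curvatures: orthogonality of the focal maps. -/

section focal

/-- The pairing with a fixed vector. -/
def lorL (w : R41) : R41 →L[ℝ] ℝ :=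
  LinearMap.toContinuousLinearMap
    { toFun := fun x => lor x w
      map_add' := fun x y => lor_add_left x y w
      map_smul' := fun c x => lor_smul_left c x w }

@[simp] lemma lorL_apply (w x : R41) : lorL w x = lor x w := rfl

variable {M : Type*} [TopologicalSpace M] [ChartedSpace (EuclideanSpace ℝ (Fin 2)) M]
  {f ν : M → R41} {U V : Set M} {p : M}

/-- A pair of height functions, as a complex-valued function. -/
def heights (g h : M → R41) (a b : R41) : M → ℂ := fun q =>
  Complex.equivRealProdCLM.symm (lor (g q) a, lor (h q) b)

lemma cdiff_heights {g h : M → R41} (hg : MDifferentiableAt (𝓡 2) 𝓘(ℝ, R41) g p)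
    (hh : MDifferentiableAt (𝓡 2) 𝓘(ℝ, R41) h p) (a b : R41) (v : EuclideanSpace ℝ (Fin 2)) :
    cdiff (heights g h a b) p v =
      Complex.equivRealProdCLM.symm (lor (diff g p v) a, lor (diff h p v) b) := by
  let ℓ₁ : R41 →L[ℝ] ℂ := (Complex.equivRealProdCLM.symm : ℝ × ℝ →L[ℝ] ℂ).comp
    ((ContinuousLinearMap.inl ℝ ℝ ℝ).comp (lorL a))
  let ℓ₂ : R41 →L[ℝ] ℂ := (Complex.equivRealProdCLM.symm : ℝ × ℝ →L[ℝ] ℂ).comp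
    ((ContinuousLinearMap.inr ℝ ℝ ℝ).comp (lorL b))
  have hsum : ∀ x y, ℓ₁ x + ℓ₂ y = Complex.equivRealProdCLM.symm (lor x a, lor y b) := by
    intro x y
    simp only [ℓ₁, ℓ₂, ContinuousLinearMap.comp_apply, ContinuousLinearMap.inl_apply,
      ContinuousLinearMap.inr_apply, ContinuousLinearEquiv.coe_coe, lorL_apply]
    rw [← map_add]
    simp
  have h1 := (ℓ₁.hasMFDerivAt (x := g p)).comp p hg.hasMFDerivAt
  have h2 := (ℓ₂.hasMFDerivAt (x := h p)).comp p hh.hasMFDerivAt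
  have h3 := (h1.add h2).mfderiv
  have h4 : heights g h a b = (⇑ℓ₁ ∘ g) + (⇑ℓ₂ ∘ h) := by
    funext q
    exact (hsum _ _).symm
  have h5 := DFunLike.congr_fun h3 v
  rw [← h4] at h5
  exact h5.trans (hsum _ _)

lemma contMDiffOn_heights {g h : M → R41} (hg : ContMDiffOn (𝓡 2) 𝓘(ℝ, R41) ∞ g U)
    (hh : ContMDiffOn (𝓡 2) 𝓘(ℝ, R41) ∞ h U) (a b : R41) :
    ContMDiffOn (𝓡 2) 𝓘(ℝ, ℂ) ∞ (heights g h a b) U := by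
  let ℓ : R41 × R41 →L[ℝ] ℂ := (Complex.equivRealProdCLM.symm : ℝ × ℝ →L[ℝ] ℂ).comp
    (((lorL a).comp (ContinuousLinearMap.fst ℝ R41 R41)).prod
      ((lorL b).comp (ContinuousLinearMap.snd ℝ R41 R41)))
  exact ℓ.contDiff.contMDiff.comp_contMDiffOn (hg.prodMk_space hh)

lemma exists_combination {v₁ v₂ : EuclideanSpace ℝ (Fin 2)}
    (h : ∀ a b : ℝ, a • v₁ + b • v₂ = 0 → a = 0 ∧ b = 0) (v : EuclideanSpace ℝ (Fin 2)) :
    ∃ a b : ℝ, v = a • v₁ + b • v₂ := by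
  let φ : (ℝ × ℝ) →ₗ[ℝ] EuclideanSpace ℝ (Fin 2) :=
    (LinearMap.toSpanSingleton ℝ _ v₁).coprod (LinearMap.toSpanSingleton ℝ _ v₂)
  have hφ : Function.Injective φ := by
    rw [injective_iff_map_eq_zero]
    rintro ⟨a, b⟩ hab
    obtain ⟨h1, h2⟩ := h a b (by simpa [φ] using hab)
    simp [h1, h2]
  have hs := (LinearMap.injective_iff_surjective_of_finrank_eq_finrank (f := φ) (by simp)).1 hφ
  obtain ⟨⟨a, b⟩, hab⟩ := hs v
  exact ⟨a, b, by simpa [φ] using hab.symm⟩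

/-- Linear independence of two combinations of `f` and `ν` transfers to the differentials. -/
lemma Normal.eq_zero_of_comb (h : Normal f ν U) (hp : p ∈ U) {a₁ b₁ a₂ b₂ : ℝ}
    (hdet : a₁ * b₂ - a₂ * b₁ ≠ 0)
    (himm : ∀ v, diff f p v = 0 → diff ν p v = 0 → v = 0) {v : EuclideanSpace ℝ (Fin 2)}
    (h1 : diff (comb a₁ b₁ f ν) p v = 0) (h2 : diff (comb a₂ b₂ f ν) p v = 0) : v = 0 := by
  rw [h.diff_comb hp] at h1 h2
  refine himm v ?_ ?_
  · have : (a₁ * b₂ - a₂ * b₁) • diff f p v =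
        b₂ • (a₁ • diff f p v + b₁ • diff ν p v) - b₁ • (a₂ • diff f p v + b₂ • diff ν p v) := by
      module
    rw [h1, h2, smul_zero, smul_zero, sub_zero] at this
    exact (smul_eq_zero.1 this).resolve_left hdet
  · have : (a₁ * b₂ - a₂ * b₁) • diff ν p v =
        a₁ • (a₂ • diff f p v + b₂ • diff ν p v) - a₂ • (a₁ • diff f p v + b₁ • diff ν p v) := by
      module
    rw [h1, h2, smul_zero, smul_zero, sub_zero] at this
    exact (smul_eq_zero.1 this).resolve_left hdet

variable [IsManifold (𝓡 2) ∞ M]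

/-- The focal combinations of a Legendrian immersion with two distinct constant principal
curvatures are orthogonal. -/
theorem Normal.lor_focal_eq_zero (h : Normal f ν U) (hp : p ∈ U) {a₁ b₁ a₂ b₂ : ℝ}
    (hdet : a₁ * b₂ - a₂ * b₁ ≠ 0)
    (himm : ∀ q ∈ U, ∀ v, diff f q v = 0 → diff ν q v = 0 → v = 0)
    (h₁ : ∀ q ∈ U, ∃ v, v ≠ 0 ∧ diff (comb a₁ b₁ f ν) q v = 0)
    (h₂ : ∀ q ∈ U, ∃ v, v ≠ 0 ∧ diff (comb a₂ b₂ f ν) q v = 0) : a₁ * a₂ - b₁ * b₂ = 0 := by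
  set L₁ := comb a₁ b₁ f ν with hL₁
  set L₂ := comb a₂ b₂ f ν with hL₂
  have s₁ : ContMDiffOn (𝓡 2) 𝓘(ℝ, R41) ∞ L₁ U := h.smooth_comb _ _
  have s₂ : ContMDiffOn (𝓡 2) 𝓘(ℝ, R41) ∞ L₂ U := h.smooth_comb _ _
  have joint : ∀ q ∈ U, ∀ v, diff L₁ q v = 0 → diff L₂ q v = 0 → v = 0 := fun q hq v k1 k2 =>
    h.eq_zero_of_comb hq hdet (himm q hq) k1 k2
  have m₁ : ∀ q ∈ U, MDifferentiableAt (𝓡 2) 𝓘(ℝ, R41) L₁ q := fun q hq =>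
    mdiff_of_contMDiffOn h.isOpen s₁ hq
  have m₂ : ∀ q ∈ U, MDifferentiableAt (𝓡 2) 𝓘(ℝ, R41) L₂ q := fun q hq =>
    mdiff_of_contMDiffOn h.isOpen s₂ hq
  have perp₁ : ∀ q ∈ U, ∀ v, Perp (f q) (ν q) (diff L₁ q v) := fun q hq v => h.perp_comb hq _ _ v
  have perp₂ : ∀ q ∈ U, ∀ v, Perp (f q) (ν q) (diff L₂ q v) := fun q hq v => h.perp_comb hq _ _ v
  obtain ⟨v₁, hv₁, k₁⟩ := h₁ p hp
  obtain ⟨v₂, hv₂, k₂⟩ := h₂ p hp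
  set w₁ := diff L₁ p v₂ with hw₁
  set w₂ := diff L₂ p v₁ with hw₂
  have w₁0 : w₁ ≠ 0 := fun h0 => hv₂ (joint p hp v₂ h0 k₂)
  have w₂0 : w₂ ≠ 0 := fun h0 => hv₁ (joint p hp v₁ k₁ h0)
  have pos₁ := lor_self_pos (h.isFrame p hp).ff (perp₁ p hp v₂).1 w₁0
  have pos₂ := lor_self_pos (h.isFrame p hp).ff (perp₂ p hp v₁).1 w₂0
  -- Adapted coordinates: `Re z` is a height of `L₂` and `Im z` a height of `L₁`. A kernel vector of
  -- `dL₁` has no imaginary component and one of `dL₂` no real component, so the two kernel fields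
  -- become the coordinate directions.
  set z := heights L₂ L₁ w₂ w₁ with hz
  have sz : ContMDiffOn (𝓡 2) 𝓘(ℝ, ℂ) ∞ z U := contMDiffOn_heights s₂ s₁ _ _
  have dz : ∀ q ∈ U, ∀ v, cdiff z q v =
      Complex.equivRealProdCLM.symm (lor (diff L₂ q v) w₂, lor (diff L₁ q v) w₁) :=
    fun q hq v => cdiff_heights (m₂ q hq) (m₁ q hq) _ _ v
  have hre : ∀ q ∈ U, ∀ v, (cdiff z q v).re = lor (diff L₂ q v) w₂ := fun q hq v => by
    rw [dz q hq]; rfl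
  have him : ∀ q ∈ U, ∀ v, (cdiff z q v).im = lor (diff L₁ q v) w₁ := fun q hq v => by
    rw [dz q hq]; rfl
  have hspan := exists_combination (v₁ := v₁) (v₂ := v₂) (by
    intro a b hab
    have e1 := congrArg (diff L₁ p) hab
    have e2 := congrArg (diff L₂ p) hab
    rw [map_add, map_smul, map_smul, k₁, smul_zero, zero_add, map_zero] at e1
    rw [map_add, map_smul, map_smul, k₂, smul_zero, add_zero, map_zero] at e2
    exact ⟨(smul_eq_zero.1 e2).resolve_right w₂0, (smul_eq_zero.1 e1).resolve_right w₁0⟩)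
  have hinj : Function.Injective (cdiff z p) := by
    rw [injective_iff_map_eq_zero]
    intro v hv
    obtain ⟨a, b, rfl⟩ := hspan v
    have e1 := him p hp (a • v₁ + b • v₂)
    have e2 := hre p hp (a • v₁ + b • v₂)
    rw [hv, map_add, map_smul, map_smul, k₁, smul_zero, zero_add, lor_smul_left] at e1
    rw [hv, map_add, map_smul, map_smul, k₂, smul_zero, add_zero, lor_smul_left] at e2
    have b0 : b = 0 := (mul_eq_zero.1 e1.symm).resolve_right pos₁.ne'
    have a0 : a = 0 := (mul_eq_zero.1 e2.symm).resolve_right pos₂.ne'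
    simp [a0, b0]
  obtain ⟨e, he, hpe, heU, hez⟩ := exists_param_of_injective h.isOpen hp sz hinj
  have hT := e.open_target
  have hcd : ∀ q ∈ e.source, ∀ c, cdiff z q (frame e q c) = c := by
    intro q hq c
    have : z =ᶠ[𝓝 q] e := by
      filter_upwards [e.open_source.mem_nhds hq] with x hx using (hez x hx).symm
    have h1 : cdiff z q = cdiff e q := this.mfderiv_eq
    rw [h1]
    exact he.cdiff_frame hq c
  have ker₁ : ∀ q ∈ e.source, diff L₁ q (frame e q 1) = 0 := by
    intro q hq
    obtain ⟨v, hv, hk⟩ := h₁ q (heU hq)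
    obtain ⟨c, rfl⟩ := he.frame_surjective hq v
    have e1 := him q (heU hq) (frame e q c)
    rw [hk, lor_zero_left, hcd q hq] at e1
    have hc : c = c.re • (1 : ℂ) := by apply Complex.ext <;> simp [e1]
    have hc0 : c.re ≠ 0 := by
      intro h0
      rw [h0, zero_smul] at hc
      exact hv (by rw [hc, map_zero])
    rw [hc, map_smul, map_smul] at hk
    exact (smul_eq_zero.1 hk).resolve_left hc0
  have ker₂ : ∀ q ∈ e.source, diff L₂ q (frame e q Complex.I) = 0 := by
    intro q hq
    obtain ⟨v, hv, hk⟩ := h₂ q (heU hq)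
    obtain ⟨c, rfl⟩ := he.frame_surjective hq v
    have e1 := hre q (heU hq) (frame e q c)
    rw [hk, lor_zero_left, hcd q hq] at e1
    have hc : c = c.im • Complex.I := by apply Complex.ext <;> simp [e1]
    have hc0 : c.im ≠ 0 := by
      intro h0
      rw [h0, zero_smul] at hc
      exact hv (by rw [hc, map_zero])
    rw [hc, map_smul, map_smul] at hk
    exact (smul_eq_zero.1 hk).resolve_left hc0
  set A := L₁ ∘ e.symm with hA
  set B := L₂ ∘ e.symm with hB
  have sA : ContDiffOn ℝ ∞ A e.target := he.contDiffOn_comp s₁ heU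
  have sB : ContDiffOn ℝ ∞ B e.target := he.contDiffOn_comp s₂ heU
  have pdA : ∀ w ∈ e.target, ∀ c, pd A c w = diff L₁ (e.symm w) (frame e (e.symm w) c) := by
    intro w hw c
    have := he.fderiv_comp (e.map_target hw) (m₁ _ (heU (e.map_target hw))) c
    rwa [e.right_inv hw] at this
  have pdB : ∀ w ∈ e.target, ∀ c, pd B c w = diff L₂ (e.symm w) (frame e (e.symm w) c) := by
    intro w hw c
    have := he.fderiv_comp (e.map_target hw) (m₂ _ (heU (e.map_target hw))) c
    rwa [e.right_inv hw] at this
  have A1 : ∀ w ∈ e.target, pd A 1 w = 0 := fun w hw => by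
    rw [pdA w hw, ker₁ _ (e.map_target hw)]
  have BI : ∀ w ∈ e.target, pd B Complex.I w = 0 := fun w hw => by
    rw [pdB w hw, ker₂ _ (e.map_target hw)]
  have sAI := contDiffOn_pd hT sA Complex.I
  have sB1 := contDiffOn_pd hT sB 1
  have sAII := contDiffOn_pd hT sAI Complex.I
  have sB11 := contDiffOn_pd hT sB1 1
  -- Since `A` varies only in the imaginary direction and `B` only in the real one, all mixed
  -- derivatives vanish. Differentiating orthogonality relations thus moves derivatives onto one
  -- factor at a time.
  have AI1 : ∀ w ∈ e.target, pd (pd A Complex.I) 1 w = 0 := fun w hw => by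
    rw [pd_comm hT sA hw]; exact pd_eq_zero hT hw 0 A1 _
  have B1I : ∀ w ∈ e.target, pd (pd B 1) Complex.I w = 0 := fun w hw => by
    rw [pd_comm hT sB hw]; exact pd_eq_zero hT hw 0 BI _
  have AII1 : ∀ w ∈ e.target, pd (pd (pd A Complex.I) Complex.I) 1 w = 0 := fun w hw => by
    rw [pd_comm hT sAI hw]; exact pd_eq_zero hT hw 0 AI1 _
  have B11I : ∀ w ∈ e.target, pd (pd (pd B 1) 1) Complex.I w = 0 := fun w hw => by
    rw [pd_comm hT sB1 hw]; exact pd_eq_zero hT hw 0 B1I _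
  have df : ∀ {g : ℂ → R41}, ContDiffOn ℝ ∞ g e.target → ∀ w ∈ e.target,
      DifferentiableAt ℝ g w := fun hg w hw => differentiableAt_of_contDiffOn hT hg hw
  have perp_comb' : ∀ q, ∀ x, Perp (f q) (ν q) x → ∀ a b, lor x (comb a b f ν q) = 0 := by
    intro q x hx a b
    simp only [comb, lor_add_right, lor_smul_right, hx.1, hx.2, mul_zero, add_zero]
  have dAA : ∀ w ∈ e.target, lor (pd A Complex.I w) (A w) = 0 := fun w hw => by
    rw [pdA w hw]
    exact perp_comb' _ _ (perp₁ _ (heU (e.map_target hw)) _) _ _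
  have dAB : ∀ w ∈ e.target, lor (pd A Complex.I w) (B w) = 0 := fun w hw => by
    rw [pdA w hw]
    exact perp_comb' _ _ (perp₁ _ (heU (e.map_target hw)) _) _ _
  have dBA : ∀ w ∈ e.target, lor (pd B 1 w) (A w) = 0 := fun w hw => by
    rw [pdB w hw]
    exact perp_comb' _ _ (perp₂ _ (heU (e.map_target hw)) _) _ _
  have dBB : ∀ w ∈ e.target, lor (pd B 1 w) (B w) = 0 := fun w hw => by
    rw [pdB w hw]
    exact perp_comb' _ _ (perp₂ _ (heU (e.map_target hw)) _) _ _
  have ddAA : ∀ w ∈ e.target, lor (pd (pd A Complex.I) Complex.I w) (A w) +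
      lor (pd A Complex.I w) (pd A Complex.I w) = 0 := fun w hw => by
    rw [← pd_lor (df sAI w hw) (df sA w hw)]; exact pd_eq_zero hT hw 0 dAA _
  have ddBB : ∀ w ∈ e.target, lor (pd (pd B 1) 1 w) (B w) +
      lor (pd B 1 w) (pd B 1 w) = 0 := fun w hw => by
    rw [← pd_lor (df sB1 w hw) (df sB w hw)]; exact pd_eq_zero hT hw 0 dBB _
  have ddAB : ∀ w ∈ e.target, lor (pd (pd A Complex.I) Complex.I w) (B w) = 0 := fun w hw => by
    have := pd_eq_zero hT hw 0 dAB Complex.I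
    rwa [pd_lor (df sAI w hw) (df sB w hw), BI w hw, lor_zero_right, add_zero] at this
  have ddBA : ∀ w ∈ e.target, lor (pd (pd B 1) 1 w) (A w) = 0 := fun w hw => by
    have := pd_eq_zero hT hw 0 dBA 1
    rwa [pd_lor (df sB1 w hw) (df sA w hw), A1 w hw, lor_zero_right, add_zero] at this
  have dAdB : ∀ w ∈ e.target, lor (pd A Complex.I w) (pd B 1 w) = 0 := fun w hw => by
    have := pd_eq_zero hT hw 0 dAB 1
    rwa [pd_lor (df sAI w hw) (df sB w hw), AI1 w hw, lor_zero_left, zero_add] at this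
  have ddAdB : ∀ w ∈ e.target, lor (pd (pd A Complex.I) Complex.I w) (pd B 1 w) = 0 :=
    fun w hw => by
    have := pd_eq_zero hT hw 0 ddAB 1
    rwa [pd_lor (df sAII w hw) (df sB w hw), AII1 w hw, lor_zero_left, zero_add] at this
  have ddBdA : ∀ w ∈ e.target, lor (pd (pd B 1) 1 w) (pd A Complex.I w) = 0 := fun w hw => by
    have := pd_eq_zero hT hw 0 ddBA Complex.I
    rwa [pd_lor (df sB11 w hw) (df sA w hw), B11I w hw, lor_zero_left, zero_add] at this
  have ddAddB : ∀ w ∈ e.target,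
      lor (pd (pd A Complex.I) Complex.I w) (pd (pd B 1) 1 w) = 0 := fun w hw => by
    have := pd_eq_zero hT hw 0 ddAdB 1
    rwa [pd_lor (df sAII w hw) (df sB1 w hw), AII1 w hw, lor_zero_left, zero_add] at this
  have hw := e.map_source hpe
  have eA : A (e p) = a₁ • f p + b₁ • ν p := by rw [hA, Function.comp, e.left_inv hpe]; rfl
  have eB : B (e p) = a₂ • f p + b₂ • ν p := by rw [hB, Function.comp, e.left_inv hpe]; rfl
  have F := h.isFrame p hp
  have Fnf : lor (ν p) (f p) = 0 := by rw [lor_comm]; exact F.fn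
  have pA : Perp (f p) (ν p) (pd A Complex.I (e p)) := by
    have := perp₁ p hp (frame e p Complex.I)
    rw [pdA _ hw, e.left_inv hpe]; exact this
  have pB : Perp (f p) (ν p) (pd B 1 (e p)) := by
    have := perp₂ p hp (frame e p 1)
    rw [pdB _ hw, e.left_inv hpe]; exact this
  have A0 : pd A Complex.I (e p) ≠ 0 := by
    intro h0
    rw [pdA _ hw, e.left_inv hpe] at h0
    refine w₁0 ?_
    obtain ⟨a, b, hab⟩ := he.frame_basis hpe v₂
    rw [hw₁, hab, map_add, map_smul, map_smul, ker₁ p hpe, h0, smul_zero, smul_zero, add_zero]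
  have B0 : pd B 1 (e p) ≠ 0 := by
    intro h0
    rw [pdB _ hw, e.left_inv hpe] at h0
    refine w₂0 ?_
    obtain ⟨a, b, hab⟩ := he.frame_basis hpe v₁
    rw [hw₂, hab, map_add, map_smul, map_smul, ker₂ p hpe, h0, smul_zero, smul_zero, add_zero]
  have posA := lor_self_pos F.ff pA.1 A0
  have posB := lor_self_pos F.ff pB.1 B0
  have i1 := ddAA _ hw
  have i2 := ddAB _ hw
  have i3 := ddBA _ hw
  have i4 := ddBB _ hw
  have i5 := ddAddB _ hw
  have i6 := ddAdB _ hw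
  have i7 := ddBdA _ hw
  have i8 := dAdB _ hw
  rw [eA, lor_add_right, lor_smul_right, lor_smul_right] at i1 i3
  rw [eB, lor_add_right, lor_smul_right, lor_smul_right] at i2 i4
  set u := pd A Complex.I (e p)
  set u' := pd (pd A Complex.I) Complex.I (e p)
  set x := pd B 1 (e p)
  set x' := pd (pd B 1) 1 (e p)
  have proj : ∀ y, Perp (f p) (ν p) (y + lor y (f p) • f p - lor y (ν p) • ν p) := by
    intro y
    constructor
    · simp only [lor_sub_left, lor_add_left, lor_smul_left, F.ff, Fnf]; ring
    · simp only [lor_sub_left, lor_add_left, lor_smul_left, F.nn, F.fn]; ring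
  -- The tangential part of `A''` is orthogonal to `B'`, that of `B''` to `A'`, and `A'` to `B'`. So
  -- the tangential parts are mutually orthogonal, and `⟨A'', B''⟩ = 0` reduces to an equation
  -- between normal components.
  have hc := lor_eq_zero_of_perp F pA pB (proj u') (proj x') A0 B0 i8
    (by
      rw [lor_comm]
      simp only [lor_sub_left, lor_add_left, lor_smul_left, i6, lor_comm (f p) x,
        lor_comm (ν p) x, pB.1, pB.2]; ring)
    (by
      rw [lor_comm]
      simp only [lor_sub_left, lor_add_left, lor_smul_left, i7, lor_comm (f p) u,
        lor_comm (ν p) u, pA.1, pA.2]; ring)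
  simp only [lor_sub_left, lor_add_left, lor_smul_left, lor_sub_right, lor_add_right,
    lor_smul_right, F.ff, F.nn, F.fn, Fnf, i5, lor_comm (f p) x', lor_comm (ν p) x'] at hc
  set P := lor u' (f p)
  set R := lor u' (ν p)
  set P' := lor x' (f p)
  set R' := lor x' (ν p)
  -- The normal components of `A''` and `B''` follow by Cramer's rule from their products with `A`
  -- and `B`, which span the normal plane. Substitution leaves `|A'|²|B'|² (a₁a₂ - b₁b₂) = 0`.
  have hP : (a₁ * b₂ - a₂ * b₁) * P = -(lor u u * b₂) := by
    linear_combination b₂ * i1 - b₁ * i2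
  have hR : (a₁ * b₂ - a₂ * b₁) * R = lor u u * a₂ := by
    linear_combination a₁ * i2 - a₂ * i1
  have hP' : (a₁ * b₂ - a₂ * b₁) * P' = lor x x * b₁ := by
    linear_combination b₂ * i3 - b₁ * i4
  have hR' : (a₁ * b₂ - a₂ * b₁) * R' = -(lor x x * a₁) := by
    linear_combination a₁ * i4 - a₂ * i3
  have hfin : lor u u * lor x x * (a₁ * a₂ - b₁ * b₂) = 0 := by
    have e1 : ((a₁ * b₂ - a₂ * b₁) * P) * ((a₁ * b₂ - a₂ * b₁) * P') -
        ((a₁ * b₂ - a₂ * b₁) * R) * ((a₁ * b₂ - a₂ * b₁) * R') = 0 := by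
      linear_combination (a₁ * b₂ - a₂ * b₁) ^ 2 * hc
    rw [hP, hR, hP', hR'] at e1
    linear_combination e1
  exact (mul_eq_zero.1 hfin).resolve_left (mul_pos posA posB).ne'

end focal

end

end HypFront

namespace HypFront

noncomputable section

/-! ### Pointwise area computations: kernels and the sign of the determinant. -/

section pointwise

variable {V : Type*} [AddCommGroup V] [Module ℝ V] {f n : R41} {A B : V →ₗ[ℝ] R41}

/-- A linear map into the tangent plane is injective if and only if it has nonzero area. -/
lemma exists_kernel_iff (h : Frame f n) (hA : ∀ v, Perp f n (A v)) {v0 v1 : V}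
    (hi : ∀ a b : ℝ, a • v0 + b • v1 = 0 → a = 0 ∧ b = 0)
    (hb : ∀ u : V, ∃ a b : ℝ, u = a • v0 + b • v1) :
    (∃ v, v ≠ 0 ∧ A v = 0) ↔ wed f n (A v0) (A v1) = 0 := by
  constructor
  · rintro ⟨v, hv, hAv⟩
    obtain ⟨a, b, rfl⟩ := hb v
    rw [map_add, map_smul, map_smul] at hAv
    have e1 := congrArg (fun x => wed f n x (A v1)) hAv
    have e2 := congrArg (fun x => wed f n (A v0) x) hAv
    simp only [wed_add_left, wed_add_right, wed_smul_left, wed_smul_right, wed_self, mul_zero,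
      add_zero, zero_add, wed_zero_left, wed_zero_right] at e1 e2
    by_contra h0
    have ha := (mul_eq_zero.1 e1).resolve_right h0
    have hb := (mul_eq_zero.1 e2).resolve_right h0
    simp [ha, hb] at hv
  · intro hw
    by_cases h1 : A v1 = 0
    · refine ⟨v1, fun h0 => ?_, h1⟩
      have := (hi 0 1 (by simp [h0])).2
      norm_num at this
    · have hp := lor_self_pos h.ff (hA v1).1 h1
      -- The Gram-Schmidt vector: its image has squared length `|A v1|²` times the square of the
      -- area, which is zero.
      refine ⟨lor (A v1) (A v1) • v0 + (-lor (A v0) (A v1)) • v1, fun h0 => ?_, ?_⟩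
      · exact hp.ne' (hi _ _ h0).1
      · refine eq_zero_of_lor_self h.ff (hA _).1 ?_
        have e := wed_mul_wed h (hA v0) (hA v1) (hA v0) (hA v1)
        rw [hw, lor_comm (A v1) (A v0)] at e
        simp only [map_add, map_smul, lor_add_left, lor_add_right, lor_smul_left, lor_smul_right,
          lor_comm (A v1) (A v0)]
        linear_combination (-lor (A v1) (A v1)) * e

/-- A trace-free symmetric operator has nonpositive determinant. -/
lemma wed_mul_wed_nonpos (h : Frame f n) (hA : ∀ v, Perp f n (A v)) (hB : ∀ v, Perp f n (B v))
    (sym : ∀ v w, lor (A v) (B w) = lor (A w) (B v))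
    (hm : ∀ v w, wed f n (A v) (B w) + wed f n (B v) (A w) = 0) (v w : V) :
    wed f n (A v) (A w) * wed f n (B v) (B w) ≤ 0 := by
  by_cases h0 : A v = 0
  · simp [h0]
  have hl := lor_self_pos h.ff (hA v).1 h0
  -- Replacing `w` by `w - k • v` changes neither area and makes the images under `A` orthogonal.
  set k := lor (A v) (A w) / lor (A v) (A v) with hk
  have hkl : k * lor (A v) (A v) = lor (A v) (A w) := by rw [hk]; field_simp
  set w' := w - k • v with hw'
  have e1 : wed f n (A v) (A w) = wed f n (A v) (A w') := by
    rw [hw', map_sub, map_smul, sub_eq_add_neg, wed_add_right, wed_neg_right, wed_smul_right,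
      wed_self]; ring
  have e2 : wed f n (B v) (B w) = wed f n (B v) (B w') := by
    rw [hw', map_sub, map_smul, sub_eq_add_neg, wed_add_right, wed_neg_right, wed_smul_right,
      wed_self]; ring
  have horth : lor (A v) (A w') = 0 := by
    rw [hw', map_sub, map_smul, lor_sub_right, lor_smul_right, hkl, sub_self]
  have horth' : lor (A w') (A v) = 0 := by rw [lor_comm, horth]
  have x1 := wed_mul_wed h (hA v) (hA w') (hA v) (hB w')
  have x2 := wed_mul_wed h (hA v) (hA w') (hB v) (hA w')
  have x3 := wed_mul_wed h (hA v) (hA w') (hB v) (hB w')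
  have x4 := hm v w'
  have x5 := sym v w'
  rw [horth'] at x1
  rw [horth] at x2
  rw [e1, e2, x3, ← x5]
  have hmu : 0 ≤ lor (A w') (A w') := by
    by_cases h1 : A w' = 0
    · simp [h1]
    · exact (lor_self_pos h.ff (hA w').1 h1).le
  -- The trace-free condition in the orthogonal basis: the diagonal entries have opposite signs
  -- after weighting by lengths, so the determinant is minus a sum of squares with nonnegative
  -- weights.
  have x6 : lor (A v) (A v) * lor (A w') (B w') = -(lor (A w') (A w') * lor (A v) (B v)) := by
    linear_combination wed f n (A v) (A w') * x4 - x1 - x2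
  by_contra hcon
  have x7 : 0 < lor (A v) (A v) * (lor (A v) (B v) * lor (A w') (B w') -
      lor (A v) (B w') * lor (A v) (B w')) := mul_pos hl (not_le.1 hcon)
  have x8 : lor (A v) (A v) * (lor (A v) (B v) * lor (A w') (B w') -
      lor (A v) (B w') * lor (A v) (B w')) = -(lor (A w') (A w') * lor (A v) (B v) ^ 2) -
      lor (A v) (A v) * lor (A v) (B w') ^ 2 := by
    linear_combination lor (A v) (B v) * x6
  nlinarith [mul_nonneg hmu (sq_nonneg (lor (A v) (B v))),
    mul_nonneg hl.le (sq_nonneg (lor (A v) (B w')))]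

end pointwise

lemma tbasis_indep (a b : ℝ) (h : a • tbasis 0 + b • tbasis 1 = 0) : a = 0 ∧ b = 0 := by
  have h0 := congrArg (fun u : EuclideanSpace ℝ (Fin 2) => u 0) h
  have h1 := congrArg (fun u : EuclideanSpace ℝ (Fin 2) => u 1) h
  simp [tbasis] at h0 h1
  exact ⟨h0, h1⟩

lemma tbasis_span (u : EuclideanSpace ℝ (Fin 2)) :
    ∃ a b : ℝ, u = a • tbasis 0 + b • tbasis 1 := by
  refine ⟨u 0, u 1, ?_⟩
  ext i
  fin_cases i <;> simp [tbasis]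

lemma par_eq_comb {α : Type*} (δ : ℝ) (f ν : α → R41) : par δ f ν = comb (Real.cosh δ) (Real.sinh δ) f ν := rfl

lemma par_normal_eq_comb {α : Type*} (δ : ℝ) (f ν : α → R41) : par δ ν f = comb (Real.sinh δ) (Real.cosh δ) f ν := by
  funext q; exact add_comm _ _

/-! ### Curvatures and the Weingarten relation in terms of area forms. -/

section legendrian

variable {M : Type*} [TopologicalSpace M] [ChartedSpace (EuclideanSpace ℝ (Fin 2)) M]
  {f ν g n : M → R41} {U V : Set M} {p : M} {x y : R41}

lemma isRegularPt_iff : IsRegularPt g p ↔ ∀ v, diff g p v = 0 → v = 0 :=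
  injective_iff_map_eq_zero (diff g p)

lemma not_isRegularPt_iff : ¬ IsRegularPt g p ↔ ∃ v, v ≠ 0 ∧ diff g p v = 0 := by
  rw [isRegularPt_iff]; push Not
  exact exists_congr fun v => and_comm

lemma IsRegularPt.diff_ne_zero (h : IsRegularPt g p) : diff g p ≠ 0 := by
  intro h0
  have h1 := isRegularPt_iff.1 h (tbasis 0) (by rw [h0]; rfl)
  have := (tbasis_indep 1 0 (by simp [h1])).1
  norm_num at this

lemma not_isRegularPt_iff_wed (F : Frame x y) (hg : ∀ v, Perp x y (diff g p v)) :
    ¬ IsRegularPt g p ↔ wed x y (diff g p (tbasis 0)) (diff g p (tbasis 1)) = 0 :=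
  not_isRegularPt_iff.trans
    (exists_kernel_iff (A := (diff g p).toLinearMap) F hg tbasis_indep tbasis_span)

lemma firstForm_det (F : Frame x y) (hg : ∀ v, Perp x y (diff g p v)) :
    (firstForm g p).det = wed x y (diff g p (tbasis 0)) (diff g p (tbasis 1)) ^ 2 := by
  rw [sq, wed_mul_wed F (hg _) (hg _) (hg _) (hg _), Matrix.det_fin_two]
  rfl

/-- By the Lagrange identity, the trace of `adj(I) II` is a product of the area form with the mixed
area form, while `det I` is the square of the area form; one factor cancels. `gaussCurv_eq` rests on
the same cancellation for `det II`. -/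
lemma meanCurv_eq (F : Frame x y) (hg : ∀ v, Perp x y (diff g p v))
    (hn : ∀ v, Perp x y (diff n p v)) (hp : IsRegularPt g p) :
    meanCurv g n p = -(wed x y (diff g p (tbasis 0)) (diff n p (tbasis 1)) +
      wed x y (diff n p (tbasis 0)) (diff g p (tbasis 1))) /
      (2 * wed x y (diff g p (tbasis 0)) (diff g p (tbasis 1))) := by
  have hω : wed x y (diff g p (tbasis 0)) (diff g p (tbasis 1)) ≠ 0 := fun h0 =>
    (not_isRegularPt_iff_wed F hg).2 h0 hp
  have e1 := wed_mul_wed F (hg (tbasis 0)) (hg (tbasis 1)) (hg (tbasis 0)) (hn (tbasis 1))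
  have e2 := wed_mul_wed F (hg (tbasis 0)) (hg (tbasis 1)) (hn (tbasis 0)) (hg (tbasis 1))
  have hdet := firstForm_det F hg
  rw [meanCurv, Matrix.inv_def, hdet, Matrix.adjugate_fin_two, Ring.inverse_eq_inv',
    Matrix.smul_mul, Matrix.trace_smul, Matrix.trace_fin_two, smul_eq_mul]
  simp only [Matrix.mul_apply, Fin.sum_univ_two, firstForm, secondForm, Matrix.of_apply,
    Matrix.cons_val', Matrix.cons_val_zero, Matrix.cons_val_one, Matrix.empty_val',
    Matrix.cons_val_fin_one]
  field_simp
  linear_combination e1 + e2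

lemma gaussCurv_eq (F : Frame x y) (hg : ∀ v, Perp x y (diff g p v))
    (hn : ∀ v, Perp x y (diff n p v)) (hp : IsRegularPt g p) :
    gaussCurv g n p = -1 + wed x y (diff n p (tbasis 0)) (diff n p (tbasis 1)) /
      wed x y (diff g p (tbasis 0)) (diff g p (tbasis 1)) := by
  have hω : wed x y (diff g p (tbasis 0)) (diff g p (tbasis 1)) ≠ 0 := fun h0 =>
    (not_isRegularPt_iff_wed F hg).2 h0 hp
  have e1 := wed_mul_wed F (hg (tbasis 0)) (hg (tbasis 1)) (hn (tbasis 0)) (hn (tbasis 1))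
  have e2 : (secondForm g n p).det = wed x y (diff g p (tbasis 0)) (diff g p (tbasis 1)) *
      wed x y (diff n p (tbasis 0)) (diff n p (tbasis 1)) := by
    rw [e1, Matrix.det_fin_two]
    simp only [secondForm, Matrix.of_apply]
    ring
  rw [gaussCurv, Matrix.det_mul, Matrix.det_nonsing_inv, firstForm_det F hg, e2,
    Ring.inverse_eq_inv']
  field_simp

/-- The area form of `f`. -/
def areaForm (f ν : M → R41) (p : M) (v w : EuclideanSpace ℝ (Fin 2)) : ℝ :=
  wed (f p) (ν p) (diff f p v) (diff f p w)

/-- The mixed area form of `f` and `ν`. -/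
def mixForm (f ν : M → R41) (p : M) (v w : EuclideanSpace ℝ (Fin 2)) : ℝ :=
  wed (f p) (ν p) (diff f p v) (diff ν p w) + wed (f p) (ν p) (diff ν p v) (diff f p w)

/-- The area form of `ν`. -/
def normalForm (f ν : M → R41) (p : M) (v w : EuclideanSpace ℝ (Fin 2)) : ℝ :=
  wed (f p) (ν p) (diff ν p v) (diff ν p w)

/-- The horospherical linear Weingarten relation `2 a (H - 1) + b K = 0`, multiplied by the area
form so that it makes sense at singular points. -/
def WRel (a b : ℝ) (f ν : M → R41) (p : M) : Prop :=
  ∀ v w, b * (normalForm f ν p v w - areaForm f ν p v w) =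
    a * (mixForm f ν p v w + 2 * areaForm f ν p v w)

lemma forms_eq_zero_of_basis (r0 r1 r2 : ℝ) {v0 v1 : EuclideanSpace ℝ (Fin 2)}
    (hb : ∀ u : EuclideanSpace ℝ (Fin 2), ∃ a b : ℝ, u = a • v0 + b • v1)
    (h0 : r0 * areaForm f ν p v0 v1 + r1 * mixForm f ν p v0 v1 + r2 * normalForm f ν p v0 v1 = 0)
    (v w : EuclideanSpace ℝ (Fin 2)) :
    r0 * areaForm f ν p v w + r1 * mixForm f ν p v w + r2 * normalForm f ν p v w = 0 :=
  alternating_eq_zero (A := (diff f p).toLinearMap) (B := (diff ν p).toLinearMap) r0 r1 r2 hb h0 v w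

lemma wRel_of_basis {a b : ℝ} {v0 v1 : EuclideanSpace ℝ (Fin 2)}
    (hb : ∀ u : EuclideanSpace ℝ (Fin 2), ∃ a b : ℝ, u = a • v0 + b • v1)
    (h0 : b * (normalForm f ν p v0 v1 - areaForm f ν p v0 v1) =
      a * (mixForm f ν p v0 v1 + 2 * areaForm f ν p v0 v1)) : WRel a b f ν p := by
  intro v w
  have := forms_eq_zero_of_basis (f := f) (ν := ν) (p := p) (-2 * a - b) (-a) b hb
    (by linear_combination h0) v w
  linear_combination this

/-- Passing to the parallel pair leaves `C - A` unchanged, because `cosh² - sinh² = 1`. On the other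
hand `B + 2A` is the mixed area of `f` and `f + ν`, and `f_δ + ν_δ = e^δ (f + ν)`, so it becomes
`e^{2δ}(B + 2A) + 2 sinh δ e^δ (C - A)`. This gives the new coefficients. -/
lemma Normal.wRel_of_par (h : Normal f ν U) (hp : p ∈ U) (δ : ℝ) {a b : ℝ}
    (hr : WRel a b (HypFront.par δ f ν) (HypFront.par δ ν f) p) :
    WRel (a * Real.exp δ ^ 2) (b - 2 * a * Real.sinh δ * Real.exp δ) f ν p := by
  intro v w
  have h1 := hr v w
  have hw : ∀ x y, wed (HypFront.par δ f ν p) (HypFront.par δ ν f p) x y =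
      wed (f p) (ν p) x y := by
    intro x y
    simp only [HypFront.par]
    rw [wed_rotate, Real.cosh_sq]; ring
  have hc : Real.cosh δ ^ 2 - Real.sinh δ ^ 2 = 1 := Real.cosh_sq_sub_sinh_sq δ
  have he : Real.exp δ = Real.cosh δ + Real.sinh δ := (Real.cosh_add_sinh δ).symm
  simp only [normalForm, areaForm, mixForm, hw] at h1 ⊢
  rw [par_eq_comb δ f ν, par_normal_eq_comb δ f ν] at h1
  simp only [h.diff_comb hp, wed_add_left, wed_add_right, wed_smul_left, wed_smul_right] at h1
  rw [he]
  set C := Real.cosh δ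
  set S := Real.sinh δ
  linear_combination h1 - (b * (wed (f p) (ν p) (diff ν p v) (diff ν p w) -
    wed (f p) (ν p) (diff f p v) (diff f p w))) * hc

variable [IsManifold (𝓡 2) ∞ M]

lemma Normal.perp_diff (h : Normal f ν U) (hp : p ∈ U) (v : EuclideanSpace ℝ (Fin 2)) :
    Perp (f p) (ν p) (diff f p v) := (h.legPt hp).Xp v

lemma Normal.perp_diff_normal (h : Normal f ν U) (hp : p ∈ U) (v : EuclideanSpace ℝ (Fin 2)) :
    Perp (f p) (ν p) (diff ν p v) := (h.legPt hp).Yp v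

/-- Clearing the denominator, which is nonzero at a regular point, turns the curvature relation into
one between smooth two-forms that can be continued to singular points. -/
lemma Normal.weingarten_iff (h : Normal f ν U) (hp : p ∈ U) (hr : IsRegularPt f p) (a b : ℝ) :
    2 * a * (meanCurv f ν p - 1) + b * gaussCurv f ν p = 0 ↔ WRel a b f ν p := by
  have F := h.isFrame p hp
  have hX := h.perp_diff hp
  have hY := h.perp_diff_normal hp
  have hω : wed (f p) (ν p) (diff f p (tbasis 0)) (diff f p (tbasis 1)) ≠ 0 := fun h0 =>
    (not_isRegularPt_iff_wed F hX).2 h0 hr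
  rw [meanCurv_eq F hX hY hr, gaussCurv_eq F hX hY hr]
  have key : 2 * a * (-(wed (f p) (ν p) (diff f p (tbasis 0)) (diff ν p (tbasis 1)) +
      wed (f p) (ν p) (diff ν p (tbasis 0)) (diff f p (tbasis 1))) /
      (2 * wed (f p) (ν p) (diff f p (tbasis 0)) (diff f p (tbasis 1))) - 1) +
      b * (-1 + wed (f p) (ν p) (diff ν p (tbasis 0)) (diff ν p (tbasis 1)) /
      wed (f p) (ν p) (diff f p (tbasis 0)) (diff f p (tbasis 1))) =
      (b * (normalForm f ν p (tbasis 0) (tbasis 1) - areaForm f ν p (tbasis 0) (tbasis 1)) -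
      a * (mixForm f ν p (tbasis 0) (tbasis 1) + 2 * areaForm f ν p (tbasis 0) (tbasis 1))) /
      wed (f p) (ν p) (diff f p (tbasis 0)) (diff f p (tbasis 1)) := by
    unfold normalForm areaForm mixForm
    field_simp
    ring
  rw [key, div_eq_zero_iff]
  constructor
  · intro h1
    exact wRel_of_basis tbasis_span (sub_eq_zero.1 (h1.resolve_right hω))
  · intro h1
    exact Or.inl (sub_eq_zero.2 (h1 _ _))

lemma Normal.par (h : Normal f ν U) (δ : ℝ) : Normal (par δ f ν) (par δ ν f) U where
  isOpen := h.isOpen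
  smooth := h.smooth_comb _ _
  smooth_normal := by rw [par_normal_eq_comb]; exact h.smooth_comb _ _
  isFrame p hp := by
    have F := h.isFrame p hp
    have Fnf : lor (ν p) (f p) = 0 := by rw [lor_comm]; exact F.fn
    have hc := Real.cosh_sq δ
    refine ⟨?_, ?_, ?_⟩ <;>
    · simp only [HypFront.par, lor_add_left, lor_add_right, lor_smul_left, lor_smul_right, F.ff,
        F.nn, F.fn, Fnf]
      linarith
  perp p hp v := by
    have := h.perp_comb hp (Real.cosh δ) (Real.sinh δ) v
    rw [par_eq_comb]
    simp only [HypFront.par, lor_add_right, lor_smul_right, this.1, this.2, mul_zero, add_zero]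

end legendrian

end

end HypFront

namespace HypFront

noncomputable section

lemma eq_of_frequently_eq {X F : Type*} [TopologicalSpace X] [TopologicalSpace F] [T1Space F]
    {g : X → F} {p : X} {c : F} (hg : ContinuousAt g p) (h : ∃ᶠ q in 𝓝 p, g q = c) : g p = c := by
  by_contra h0
  exact h (hg.eventually_ne h0)

lemma comb_one_zero {α : Type*} (f ν : α → R41) : comb 1 0 f ν = f := by
  funext q; simp [comb]

lemma comb_zero_one {α : Type*} (f ν : α → R41) : comb 0 1 f ν = ν := by
  funext q; simp [comb]

lemma continuousAt_wed {X : Type*} [TopologicalSpace X] {p : X} {a b c d : X → R41}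
    (ha : ContinuousAt a p) (hb : ContinuousAt b p) (hc : ContinuousAt c p)
    (hd : ContinuousAt d p) : ContinuousAt (fun q => wed (a q) (b q) (c q) (d q)) p := by
  have h := ha.prodMk (hb.prodMk (hc.prodMk hd))
  exact (continuous_wed.tendsto _).comp h

lemma continuousAt_lor {X : Type*} [TopologicalSpace X] {p : X} {a b : X → R41}
    (ha : ContinuousAt a p) (hb : ContinuousAt b p) :
    ContinuousAt (fun q => lor (a q) (b q)) p :=
  ContinuousAt.comp (g := fun x : R41 × R41 => lor x.1 x.2)
    continuous_lor.continuousAt (ha.prodMk hb)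

/-! ### Continuity of the area forms, regular points, and uniqueness of the normal up to sign. -/

section legendrian

variable {M : Type*} [TopologicalSpace M] [ChartedSpace (EuclideanSpace ℝ (Fin 2)) M]
  {f ν ν' : M → R41} {U U' V : Set M} {p : M} {e : OpenPartialHomeomorph M ℂ}

/-- The pair `(f, ν)` is an immersion at `p`. -/
def PairInj (f ν : M → R41) (p : M) : Prop :=
  ∀ v, diff f p v = 0 → diff ν p v = 0 → v = 0

lemma IsParam.frame_indep (he : IsParam e) (hp : p ∈ e.source) (a b : ℝ)
    (h : a • frame e p 1 + b • frame e p Complex.I = 0) : a = 0 ∧ b = 0 := by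
  rw [← map_smul, ← map_smul, ← map_add] at h
  have h1 := he.frame_injective hp (h.trans (map_zero _).symm)
  have hr := congrArg Complex.re h1
  have hi := congrArg Complex.im h1
  simp at hr hi
  exact ⟨hr, hi⟩

/-- A neighborhood of `p` in which `-ν` replaces the normal `ν`. -/
lemma diff_neg_normal (hν : ∀ᶠ q in 𝓝 p, ν' q = -ν q) : diff ν' p = -diff ν p := by
  have h1 : ν' =ᶠ[𝓝 p] -ν := hν
  rw [diff_congr h1]
  exact mfderiv_neg

lemma WRel.congr {a b : ℝ} (h : WRel a b f ν' p) (hν : ∀ᶠ q in 𝓝 p, ν' q = ν q) :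
    WRel a b f ν p := by
  intro v w
  have h1 := h v w
  simp only [normalForm, areaForm, mixForm, diff_congr (g := ν') (h := ν) hν,
    hν.self_of_nhds] at h1 ⊢
  exact h1

/-- Reversing the normal reverses the orientation of `wed` as well as `dν`. So the area forms of `f`
and `ν` change sign, while the mixed form changes twice and is preserved. -/
lemma WRel.of_neg {a b : ℝ} (h : WRel a b f ν' p) (hν : ∀ᶠ q in 𝓝 p, ν' q = -ν q)
    (v w : EuclideanSpace ℝ (Fin 2)) : b * (normalForm f ν p v w - areaForm f ν p v w) =
      -(a * (mixForm f ν p v w - 2 * areaForm f ν p v w)) := by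
  have h1 := h v w
  simp only [normalForm, areaForm, mixForm, diff_neg_normal hν, hν.self_of_nhds,
    neg_apply, wed_neg_normal, wed_neg_left, wed_neg_right,
    neg_neg] at h1 ⊢
  linear_combination -h1

lemma Normal.continuousAt_diff_frame (h : Normal f ν U) (he : IsParam e) (heU : e.source ⊆ U)
    (hp : p ∈ e.source) (c : ℂ) : ContinuousAt (fun q => diff f q (frame e q c)) p :=
  (he.continuousOn_diff_frame (h.smooth.mono heU) c).continuousAt (e.open_source.mem_nhds hp)

lemma Normal.continuousAt_diff_normal_frame (h : Normal f ν U) (he : IsParam e)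
    (heU : e.source ⊆ U) (hp : p ∈ e.source) (c : ℂ) :
    ContinuousAt (fun q => diff ν q (frame e q c)) p :=
  (he.continuousOn_diff_frame (h.smooth_normal.mono heU) c).continuousAt
    (e.open_source.mem_nhds hp)

lemma Normal.continuousAt (h : Normal f ν U) (hp : p ∈ U) : ContinuousAt f p :=
  h.smooth.continuousOn.continuousAt (h.isOpen.mem_nhds hp)

lemma Normal.continuousAt_normal (h : Normal f ν U) (hp : p ∈ U) : ContinuousAt ν p :=
  h.smooth_normal.continuousOn.continuousAt (h.isOpen.mem_nhds hp)

lemma Normal.continuousAt_areaForm (h : Normal f ν U) (he : IsParam e) (heU : e.source ⊆ U)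
    (hp : p ∈ e.source) :
    ContinuousAt (fun q => areaForm f ν q (frame e q 1) (frame e q Complex.I)) p :=
  continuousAt_wed (h.continuousAt (heU hp)) (h.continuousAt_normal (heU hp))
    (h.continuousAt_diff_frame he heU hp _) (h.continuousAt_diff_frame he heU hp _)

lemma Normal.continuousAt_normalForm (h : Normal f ν U) (he : IsParam e) (heU : e.source ⊆ U)
    (hp : p ∈ e.source) :
    ContinuousAt (fun q => normalForm f ν q (frame e q 1) (frame e q Complex.I)) p :=
  continuousAt_wed (h.continuousAt (heU hp)) (h.continuousAt_normal (heU hp))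
    (h.continuousAt_diff_normal_frame he heU hp _) (h.continuousAt_diff_normal_frame he heU hp _)

lemma Normal.continuousAt_mixForm (h : Normal f ν U) (he : IsParam e) (heU : e.source ⊆ U)
    (hp : p ∈ e.source) :
    ContinuousAt (fun q => mixForm f ν q (frame e q 1) (frame e q Complex.I)) p :=
  (continuousAt_wed (h.continuousAt (heU hp)) (h.continuousAt_normal (heU hp))
    (h.continuousAt_diff_frame he heU hp _) (h.continuousAt_diff_normal_frame he heU hp _)).add
  (continuousAt_wed (h.continuousAt (heU hp)) (h.continuousAt_normal (heU hp))
    (h.continuousAt_diff_normal_frame he heU hp _) (h.continuousAt_diff_frame he heU hp _))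

lemma wRel_frame_iff (he : IsParam e) (hp : p ∈ e.source) (a b : ℝ) :
    WRel a b f ν p ↔ b * (normalForm f ν p (frame e p 1) (frame e p Complex.I) -
      areaForm f ν p (frame e p 1) (frame e p Complex.I)) =
      a * (mixForm f ν p (frame e p 1) (frame e p Complex.I) +
        2 * areaForm f ν p (frame e p 1) (frame e p Complex.I)) :=
  ⟨fun h => h _ _, fun h => wRel_of_basis (he.frame_basis hp) h⟩

variable [IsManifold (𝓡 2) ∞ M]

/-- A combination of `f` and `ν` is singular if and only if its area form vanishes. -/
lemma Normal.exists_kernel_comb_iff (h : Normal f ν U) (he : IsParam e) (hp : p ∈ e.source)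
    (hpU : p ∈ U) (a b : ℝ) : (∃ v, v ≠ 0 ∧ diff (comb a b f ν) p v = 0) ↔
      a ^ 2 * areaForm f ν p (frame e p 1) (frame e p Complex.I) +
      a * b * mixForm f ν p (frame e p 1) (frame e p Complex.I) +
      b ^ 2 * normalForm f ν p (frame e p 1) (frame e p Complex.I) = 0 := by
  refine (exists_kernel_iff (A := (diff (comb a b f ν) p).toLinearMap) (h.isFrame p hpU)
    (h.perp_comb hpU a b) (he.frame_indep hp) (he.frame_basis hp)).trans ?_
  simp only [ContinuousLinearMap.coe_coe, h.diff_comb hpU, wed_add_left, wed_add_right,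
    wed_smul_left, wed_smul_right, areaForm, mixForm, normalForm]
  ring_nf

lemma Normal.not_isRegularPt_iff (h : Normal f ν U) (he : IsParam e) (hp : p ∈ e.source)
    (hpU : p ∈ U) : ¬ IsRegularPt f p ↔
      areaForm f ν p (frame e p 1) (frame e p Complex.I) = 0 := by
  have := h.exists_kernel_comb_iff he hp hpU 1 0
  rw [comb_one_zero] at this
  rw [HypFront.not_isRegularPt_iff, this]
  norm_num

lemma Normal.eventually_isRegularPt (h : Normal f ν U) (hp : p ∈ U) (hr : IsRegularPt f p) :
    ∀ᶠ q in 𝓝 p, IsRegularPt f q := by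
  obtain ⟨e, he, hpe, heU⟩ := exists_param p h.isOpen hp
  have h1 := h.continuousAt_areaForm he heU hpe
  have h2 : areaForm f ν p (frame e p 1) (frame e p Complex.I) ≠ 0 := fun h0 =>
    (h.not_isRegularPt_iff he hpe hp).2 h0 hr
  filter_upwards [h1.eventually_ne h2, e.open_source.mem_nhds hpe] with q hq hqe
  by_contra h3
  exact hq ((h.not_isRegularPt_iff he hqe (heU hqe)).1 h3)

/-- If the mixed area form vanishes, then a singular point of `f` is a branch point. -/
lemma Normal.diff_eq_zero_of_mixForm (h : Normal f ν U) (hp : p ∈ U) (hi : PairInj f ν p)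
    (hm : ∀ v w, mixForm f ν p v w = 0) (hr : ¬ IsRegularPt f p) : diff f p = 0 := by
  obtain ⟨v, hv, hk⟩ := HypFront.not_isRegularPt_iff.1 hr
  have := eq_zero_of_mixed (A := (diff ν p).toLinearMap) (B := (diff f p).toLinearMap)
    (h.isFrame p hp) (h.perp_diff_normal hp) (h.perp_diff hp)
    (fun v w => by
      have := h.sym hp w v
      rw [lor_comm (diff f p w), lor_comm (diff f p v)] at this
      exact this)
    (fun v w => by
      have := hm v w
      rw [mixForm, add_comm] at this
      exact this)
    (fun v h1 h2 => hi v h2 h1) hv hk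
  ext1 w
  exact DFunLike.congr_fun this w

lemma Normal.diff_normal_eq_zero_of_mixForm (h : Normal f ν U) (hp : p ∈ U) (hi : PairInj f ν p)
    (hm : ∀ v w, mixForm f ν p v w = 0) (hr : ∃ v, v ≠ 0 ∧ diff ν p v = 0) : diff ν p = 0 := by
  obtain ⟨v, hv, hk⟩ := hr
  have := eq_zero_of_mixed (A := (diff f p).toLinearMap) (B := (diff ν p).toLinearMap)
    (h.isFrame p hp) (h.perp_diff hp) (h.perp_diff_normal hp) (h.sym hp) hm hi hv hk
  ext1 w
  exact DFunLike.congr_fun this w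

/-- At a regular point, the unit normal is unique up to sign. -/
lemma Normal.normal_unique (h : Normal f ν U) (h' : Normal f ν' U') (hp : p ∈ U) (hp' : p ∈ U')
    (hr : IsRegularPt f p) :
    ν' p = lor (ν' p) (ν p) • ν p ∧ lor (ν' p) (ν p) ^ 2 = 1 := by
  have F := h.isFrame p hp
  have F' := h'.isFrame p hp'
  have hX := h.perp_diff hp
  have hX' := h'.perp_diff hp'
  have hω : wed (f p) (ν p) (diff f p (tbasis 0)) (diff f p (tbasis 1)) ≠ 0 := fun h0 =>
    (not_isRegularPt_iff_wed F hX).2 h0 hr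
  have hu : Perp (f p) (ν p) (ν' p - lor (ν' p) (ν p) • ν p) := by
    constructor
    · rw [lor_sub_left, lor_smul_left, lor_comm (ν' p), lor_comm (ν p) (f p), F.fn, F'.fn]; ring
    · rw [lor_sub_left, lor_smul_left, F.nn]; ring
  have hz : ∀ v, lor (diff f p v) (ν' p - lor (ν' p) (ν p) • ν p) = 0 := by
    intro v
    rw [lor_sub_right, lor_smul_right, (hX v).2, (hX' v).2]; ring
  have h0 := sub_eq_zero.1 (eq_zero_of_perp_basis F (hX _) (hX _) hu hω (hz _) (hz _))
  refine ⟨h0, ?_⟩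
  have h1 := F'.nn
  rw [h0, lor_smul_left, lor_smul_right, F.nn] at h1
  linarith

/-- Near a point in the interior of the closure of the regular set, the unit normal is unique up
to sign. -/
lemma Normal.eventually_eq_or_neg (h : Normal f ν U) (h' : Normal f ν' U') (hp : p ∈ U)
    (hp' : p ∈ U') (hr : ∀ᶠ q in 𝓝 p, q ∈ closure {x | IsRegularPt f x}) :
    (∀ᶠ q in 𝓝 p, ν' q = ν q) ∨ (∀ᶠ q in 𝓝 p, ν' q = -ν q) := by
  have hW : ∀ᶠ q in 𝓝 p, q ∈ U ∩ U' := (h.isOpen.inter h'.isOpen).mem_nhds ⟨hp, hp'⟩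
  -- The closed condition `ν' = ⟨ν', ν⟩ν`, `⟨ν', ν⟩² = 1` passes from regular points to their
  -- limits. Continuity then fixes the sign near `p`.
  have key : ∀ q ∈ U ∩ U', q ∈ closure {x | IsRegularPt f x} →
      ν' q = lor (ν' q) (ν q) • ν q ∧ lor (ν' q) (ν q) ^ 2 = 1 := by
    intro q hq hcl
    have c1 := h.continuousAt_normal hq.1
    have c2 := h'.continuousAt_normal hq.2
    have c3 := continuousAt_lor c2 c1
    have hfr : ∃ᶠ x in 𝓝 q, IsRegularPt f x ∧ x ∈ U ∩ U' :=
      (mem_closure_iff_frequently.1 hcl).and_eventually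
        ((h.isOpen.inter h'.isOpen).mem_nhds hq)
    constructor
    · have := eq_of_frequently_eq (g := fun q => ν' q - lor (ν' q) (ν q) • ν q) (c := 0)
        (c2.sub (c3.smul c1)) (hfr.mono fun x hx =>
          sub_eq_zero.2 (h.normal_unique h' hx.2.1 hx.2.2 hx.1).1)
      exact sub_eq_zero.1 this
    · exact eq_of_frequently_eq (g := fun q => lor (ν' q) (ν q) ^ 2) (c := 1) (c3.pow 2)
        (hfr.mono fun x hx => (h.normal_unique h' hx.2.1 hx.2.2 hx.1).2)
  have c3 := continuousAt_lor (h'.continuousAt_normal hp') (h.continuousAt_normal hp)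
  obtain ⟨-, hsq⟩ := key p ⟨hp, hp'⟩ hr.self_of_nhds
  rcases mul_self_eq_one_iff.1 ((sq _).symm.trans hsq) with h1 | h1
  · left
    have hgt : ∀ᶠ q in 𝓝 p, (0 : ℝ) < lor (ν' q) (ν q) :=
      c3.eventually (lt_mem_nhds (by simp only [h1]; norm_num))
    filter_upwards [hW, hr, hgt] with q hq hcl hpos
    obtain ⟨e1, e2⟩ := key q hq hcl
    have : lor (ν' q) (ν q) = 1 := by nlinarith
    rw [this, one_smul] at e1
    exact e1
  · right
    have hgt : ∀ᶠ q in 𝓝 p, lor (ν' q) (ν q) < 0 :=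
      c3.eventually (gt_mem_nhds (by simp only [h1]; norm_num))
    filter_upwards [hW, hr, hgt] with q hq hcl hneg
    obtain ⟨e1, e2⟩ := key q hq hcl
    have : lor (ν' q) (ν q) = -1 := by nlinarith
    rw [this, neg_smul, one_smul] at e1
    exact e1

end legendrian

end

end HypFront

namespace HypFront

noncomputable section

/-! ### Density of the regular points and continuation of the relation. -/

section global

variable {M : Type*} [TopologicalSpace M] [ChartedSpace (EuclideanSpace ℝ (Fin 2)) M]
  [IsManifold (𝓡 2) ∞ M] {f ν ν' : M → R41} {U U' V : Set M} {p : M} {ε : ℝ}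

/-- Near each point, `f` has a unit normal with which it is an immersive pair that satisfies a
nontrivial horospherical linear Weingarten relation. -/
def LocallyHLW (f : M → R41) : Prop :=
  ∀ p, ∃ (U : Set M) (ν : M → R41) (a b : ℝ), p ∈ U ∧ Normal f ν U ∧ (∀ q ∈ U, PairInj f ν q) ∧
    (a ≠ 0 ∨ b ≠ 0) ∧ ∀ q ∈ U, WRel a b f ν q

/-- Near each point, `f` satisfies the relation with parameter `ε` at regular points. -/
def LocallyW (ε : ℝ) (f : M → R41) : Prop :=
  ∀ p, ∃ (U : Set M) (ν : M → R41), p ∈ U ∧ Normal f ν U ∧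
    ∀ q ∈ U, IsRegularPt f q → WRel ε (1 - ε) f ν q

lemma isOpen_regular (hH : LocallyHLW f) : IsOpen {q | IsRegularPt f q} := by
  rw [isOpen_iff_mem_nhds]
  intro p hp
  obtain ⟨U, ν, -, -, hpU, h, -⟩ := hH p
  exact h.eventually_isRegularPt hpU hp

/-- The regular points of a horospherical linear Weingarten front with `ε ≠ 0` are dense. -/
theorem dense_regular [ConnectedSpace M] (hε : ε ≠ 0) (hH : LocallyHLW f) (hW : LocallyW ε f)
    (hr : ∃ p, IsRegularPt f p) : Dense {q | IsRegularPt f q} := by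
  set R := {q | IsRegularPt f q} with hR
  have hRo : IsOpen R := isOpen_regular hH
  -- By connectedness it suffices to exclude a point `p` at which both regular points and open sets
  -- of singular points accumulate.
  suffices hopen : IsOpen (closure R) by
    have := IsClopen.eq_univ ⟨isClosed_closure, hopen⟩ (hr.imp fun p hp => subset_closure hp)
    exact dense_iff_closure_eq.2 this
  rw [isOpen_iff_mem_nhds]
  intro p hpR
  by_contra hcon
  have hV : IsOpen (closure R)ᶜ := isClosed_closure.isOpen_compl
  have hpV : ∃ᶠ q in 𝓝 p, q ∈ (closure R)ᶜ := fun h0 => hcon (by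
    filter_upwards [h0] with q hq using not_not.1 hq)
  have hpR' : ∃ᶠ q in 𝓝 p, q ∈ R := mem_closure_iff_frequently.1 hpR
  obtain ⟨U, ν, a, b, hpU, h, hi, hab, hrel⟩ := hH p
  obtain ⟨e, he, hpe, heU⟩ := exists_param p h.isOpen hpU
  have hsrc : ∀ᶠ q in 𝓝 p, q ∈ e.source := e.open_source.mem_nhds hpe
  have notreg : ∀ q ∈ (closure R)ᶜ, ¬ IsRegularPt f q := fun q hq hq' => hq (subset_closure hq')
  have cA := h.continuousAt_areaForm he heU hpe
  have cM := h.continuousAt_mixForm he heU hpe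
  have cN := h.continuousAt_normalForm he heU hpe
  have area0 : ∀ q ∈ (closure R)ᶜ, q ∈ e.source →
      areaForm f ν q (frame e q 1) (frame e q Complex.I) = 0 := fun q hq hqe =>
    (h.not_isRegularPt_iff he hqe (heU hqe)).1 (notreg q hq)
  have area0p : areaForm f ν p (frame e p 1) (frame e p Complex.I) = 0 :=
    eq_of_frequently_eq (g := fun q => areaForm f ν q (frame e q 1) (frame e q Complex.I)) cA
      ((hpV.and_eventually hsrc).mono fun q hq => area0 q hq.1 hq.2)
  -- Here `H = 1`, so the mixed area of `f` and `f + ν` vanishes, and singular points, including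
  -- `p`, are zeros of `df`. These zeros would be isolated or fill a neighborhood of `p`;
  -- accumulation of singular points and of regular points contradicts the two alternatives.
  by_cases hb : b = 0
  · have ha : a ≠ 0 := hab.resolve_right (by simp [hb])
    have hh : ∀ q ∈ U, ∀ v w, mixForm f ν q v w + 2 * areaForm f ν q v w = 0 := by
      intro q hq v w
      have := hrel q hq v w
      rw [hb, zero_mul] at this
      exact (mul_eq_zero.1 this.symm).resolve_left ha
    have deg : ∀ q ∈ U, ¬ IsRegularPt f q → diff f q = 0 := by
      intro q hq hnr
      refine h.diff_eq_zero_of_mixForm hq (hi q hq) ?_ hnr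
      obtain ⟨e', he', hqe', heU'⟩ := exists_param q h.isOpen hq
      have ha0 := (h.not_isRegularPt_iff he' hqe' hq).1 hnr
      intro v w
      have h1 := forms_eq_zero_of_basis (f := f) (ν := ν) (p := q) 1 0 0 (he'.frame_basis hqe')
        (by linear_combination ha0) v w
      linear_combination hh q hq v w - 2 * h1
    have hp0 : diff f p = 0 := deg p hpU ((h.not_isRegularPt_iff he hpe hpU).2 area0p)
    have hiso := h.isolated_or_zero hpU 1 0 (by
        intro q hq v w
        rw [comb_one_zero]
        simp only [h.diff_comb hq, one_smul, wed_add_left, wed_add_right]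
        have := hh q hq v w
        simp only [mixForm, areaForm] at this
        linear_combination this) (by
        intro v hv
        rw [h.diff_comb hpU, one_smul, one_smul, hp0] at hv
        refine hi p hpU v (by rw [hp0]; rfl) (by simpa using hv))
    rw [comb_one_zero] at hiso
    rcases hiso with h0 | h0
    · obtain ⟨q, hq, hq'⟩ := (hpR'.and_eventually h0).exists
      exact IsRegularPt.diff_ne_zero hq hq'
    · rw [eventually_nhdsWithin_iff] at h0
      obtain ⟨q, hq, hq', hqs⟩ := (hpV.and_eventually (h0.and hsrc)).exists
      refine hq' ?_ (deg q (heU hqs) (notreg q hq))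
      rintro rfl
      exact hq hpR
  -- Here `C = A`. The relation with parameter `ε ≠ 0`, for either sign of the normal, gives `B² =
  -- 4A²` at regular points. In the limit all three forms vanish at `p`, so `df = 0` and `dν` has a
  -- kernel, against immersivity of the pair.
  by_cases ha : a = 0
  · have hk : ∀ q ∈ U, ∀ v w, normalForm f ν q v w = areaForm f ν q v w := by
      intro q hq v w
      have := hrel q hq v w
      rw [ha, zero_mul] at this
      exact sub_eq_zero.1 ((mul_eq_zero.1 this).resolve_left hb)
    have hsq : ∀ q ∈ R, q ∈ e.source → mixForm f ν q (frame e q 1) (frame e q Complex.I) ^ 2 =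
        4 * areaForm f ν q (frame e q 1) (frame e q Complex.I) ^ 2 := by
      intro q hq hqe
      obtain ⟨U', ν', hqU', h', hrel'⟩ := hW q
      have hcl : ∀ᶠ x in 𝓝 q, x ∈ closure {x | IsRegularPt f x} := by
        filter_upwards [hRo.mem_nhds hq] with x hx using subset_closure hx
      have hk' := hk q (heU hqe) (frame e q 1) (frame e q Complex.I)
      rcases h.eventually_eq_or_neg h' (heU hqe) hqU' hcl with hs | hs
      · have h1 := (hrel' q hqU' hq).congr hs (frame e q 1) (frame e q Complex.I)
        rw [hk', sub_self, mul_zero] at h1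
        have h2 := (mul_eq_zero.1 h1.symm).resolve_left hε
        linear_combination (mixForm f ν q (frame e q 1) (frame e q Complex.I) -
          2 * areaForm f ν q (frame e q 1) (frame e q Complex.I)) * h2
      · have h1 := (hrel' q hqU' hq).of_neg hs (frame e q 1) (frame e q Complex.I)
        rw [hk', sub_self, mul_zero] at h1
        have h2 := (mul_eq_zero.1 (neg_eq_zero.1 h1.symm)).resolve_left hε
        linear_combination (mixForm f ν q (frame e q 1) (frame e q Complex.I) +
          2 * areaForm f ν q (frame e q 1) (frame e q Complex.I)) * h2
    have hsqp := eq_of_frequently_eq (g := fun q =>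
        mixForm f ν q (frame e q 1) (frame e q Complex.I) ^ 2 -
        4 * areaForm f ν q (frame e q 1) (frame e q Complex.I) ^ 2) (c := 0)
      ((cM.pow 2).sub (continuousAt_const.mul (cA.pow 2)))
      ((hpR'.and_eventually hsrc).mono fun q hq => sub_eq_zero.2 (hsq q hq.1 hq.2))
    simp only [area0p] at hsqp
    have mix0p : mixForm f ν p (frame e p 1) (frame e p Complex.I) = 0 := by
      have : mixForm f ν p (frame e p 1) (frame e p Complex.I) ^ 2 = 0 := by linarith
      exact pow_eq_zero_iff two_ne_zero |>.1 this
    have norm0p : normalForm f ν p (frame e p 1) (frame e p Complex.I) = 0 := by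
      rw [hk p hpU, area0p]
    have df0 := h.diff_eq_zero_of_mixForm hpU (hi p hpU) (fun v w => by
        have := forms_eq_zero_of_basis (f := f) (ν := ν) (p := p) 0 1 0 (he.frame_basis hpe)
          (by linear_combination mix0p) v w
        linear_combination this) ((h.not_isRegularPt_iff he hpe hpU).2 area0p)
    have hker := (h.exists_kernel_comb_iff he hpe hpU 0 1).2 (by
      linear_combination norm0p)
    rw [comb_zero_one] at hker
    obtain ⟨v, hv, hk0⟩ := hker
    exact hv (hi p hpU v (by rw [df0]; rfl) hk0)
  -- On an open set of singular points both `f` and `-a f + b ν` are degenerate: substituting `A =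
  -- 0` in the relation annihilates the area form of the second. Focal orthogonality of the two
  -- would give `a = 0`.
  · obtain ⟨q₀, hq₀, hq₀e⟩ := (hpV.and_eventually hsrc).exists
    have hW' := h.mono (hV.inter e.open_source) (Set.inter_subset_right.trans heU)
    have := hW'.lor_focal_eq_zero (p := q₀) ⟨hq₀, hq₀e⟩ (a₁ := 1) (b₁ := 0) (a₂ := -a) (b₂ := b)
      (by simpa using hb) (fun q hq => hi q (heU hq.2))
      (fun q hq => by
        rw [comb_one_zero]
        exact HypFront.not_isRegularPt_iff.1 (notreg q hq.1))
      (fun q hq => by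
        rw [h.exists_kernel_comb_iff he hq.2 (heU hq.2)]
        have e1 := hrel q (heU hq.2) (frame e q 1) (frame e q Complex.I)
        have e2 := area0 q hq.1 hq.2
        linear_combination b * e1 + (a ^ 2 + b ^ 2 + 2 * a * b) * e2)
    apply ha
    linarith

/-- At points in the closure of the regular set the relation persists. -/
lemma Normal.wRel_of_dense (hd : Dense {q | IsRegularPt f q}) (h : Normal f ν U) (hp : p ∈ U)
    {a b : ℝ} (hr : ∀ q ∈ U, IsRegularPt f q → WRel a b f ν q) : WRel a b f ν p := by
  obtain ⟨e, he, hpe, heU⟩ := exists_param p h.isOpen hp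
  have hfr : ∃ᶠ q in 𝓝 p, IsRegularPt f q ∧ q ∈ e.source :=
    (mem_closure_iff_frequently.1 (hd p)).and_eventually (e.open_source.mem_nhds hpe)
  have cA := h.continuousAt_areaForm he heU hpe
  have cM := h.continuousAt_mixForm he heU hpe
  have cN := h.continuousAt_normalForm he heU hpe
  rw [wRel_frame_iff he hpe, ← sub_eq_zero]
  refine eq_of_frequently_eq (g := fun q =>
    b * (normalForm f ν q (frame e q 1) (frame e q Complex.I) -
      areaForm f ν q (frame e q 1) (frame e q Complex.I)) -
      a * (mixForm f ν q (frame e q 1) (frame e q Complex.I) +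
        2 * areaForm f ν q (frame e q 1) (frame e q Complex.I)))
    ((continuousAt_const.mul (cN.sub cA)).sub
      (continuousAt_const.mul (cM.add (continuousAt_const.mul cA)))) ?_
  refine hfr.mono fun q hq => sub_eq_zero.2 ?_
  exact hr q (heU hq.2) hq.1 _ _

/-- Immersivity is known only for some local normal. By density any other one differs from it by a
locally constant sign, which does not affect the joint kernel. -/
lemma Normal.pairInj_of_dense (hd : Dense {q | IsRegularPt f q}) (hH : LocallyHLW f)
    (h : Normal f ν U) (hp : p ∈ U) : PairInj f ν p := by
  obtain ⟨U', ν', -, -, hp', h', hi, -⟩ := hH p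
  have hcl : ∀ᶠ q in 𝓝 p, q ∈ closure {x | IsRegularPt f x} := Filter.Eventually.of_forall hd
  intro v h1 h2
  refine hi p hp' v h1 ?_
  rcases h.eventually_eq_or_neg h' hp hp' hcl with hs | hs
  · rw [diff_congr (g := ν') (h := ν) hs]; exact h2
  · rw [diff_neg_normal hs, neg_apply, h2, neg_zero]

/-- A map whose differential vanishes near a point is constant near it. -/
lemma eventually_eq_of_diff_eq_zero {g : M → R41} (hU : IsOpen U) (hp : p ∈ U)
    (hg : ContMDiffOn (𝓡 2) 𝓘(ℝ, R41) ∞ g U) (h0 : ∀ᶠ q in 𝓝 p, diff g q = 0) :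
    ∀ᶠ q in 𝓝 p, g q = g p := by
  obtain ⟨T, hT, hTo, hpT⟩ := mem_nhds_iff.1 h0
  obtain ⟨e, he, hpe, heU⟩ := exists_param p (hU.inter hTo) ⟨hp, hpT⟩
  have heU' : e.source ⊆ U := heU.trans Set.inter_subset_left
  have sg := he.contDiffOn_comp hg heU'
  obtain ⟨r, hr, hball⟩ := Metric.isOpen_iff.1 e.open_target (e p) (e.map_source hpe)
  have hz : Set.EqOn (fderiv ℝ (g ∘ e.symm)) 0 (Metric.ball (e p) r) := by
    intro w hw
    have hw' := hball hw
    have hq := e.map_target hw'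
    ext1 c
    have := he.fderiv_comp hq (mdiff_of_contMDiffOn hU hg (heU' hq)) c
    rw [e.right_inv hw', hT (heU hq).2] at this
    simpa using this
  have hdiff : DifferentiableOn ℝ (g ∘ e.symm) (Metric.ball (e p) r) :=
    (sg.differentiableOn (by simp)).mono hball
  have hconst : ∀ w ∈ Metric.ball (e p) r, (g ∘ e.symm) w = (g ∘ e.symm) (e p) := by
    intro w hw
    exact Metric.isOpen_ball.is_const_of_fderiv_eq_zero (convex_ball _ _).isPreconnected hdiff hz
      hw (Metric.mem_ball_self hr)
  filter_upwards [e.open_source.mem_nhds hpe,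
    (e.continuousAt hpe).eventually (Metric.ball_mem_nhds _ hr)] with q hq hqb
  have := hconst _ hqb
  simpa [e.left_inv hq, e.left_inv hpe] using this

end global

end

end HypFront

namespace HypFront

noncomputable section

/-! ### Degeneracy and unique continuation for combinations of `f` and `ν`. -/

section local_comb

variable {M : Type*} [TopologicalSpace M] [ChartedSpace (EuclideanSpace ℝ (Fin 2)) M]
  {f ν ν' : M → R41} {U U' V : Set M} {p : M} {ε : ℝ}

/-- The mixed area form of `f + ν` and a combination of `f` and `ν`. -/
lemma Normal.mixed_comb (h : Normal f ν U) (hp : p ∈ U) (a b : ℝ)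
    (v w : EuclideanSpace ℝ (Fin 2)) :
    wed (f p) (ν p) (diff (comb 1 1 f ν) p v) (diff (comb a b f ν) p w) +
      wed (f p) (ν p) (diff (comb a b f ν) p v) (diff (comb 1 1 f ν) p w) =
    2 * a * areaForm f ν p v w + (a + b) * mixForm f ν p v w + 2 * b * normalForm f ν p v w := by
  simp only [h.diff_comb hp, one_smul, wed_add_left, wed_add_right, wed_smul_left, wed_smul_right,
    areaForm, mixForm, normalForm]
  ring

/-- A constant vector that is orthogonal to `f` is a unit normal. -/
lemma normal_const {v : R41} (hU : IsOpen U) (hf : ContMDiffOn (𝓡 2) 𝓘(ℝ, R41) ∞ f U)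
    (hff : ∀ q ∈ U, lor (f q) (f q) = -1) (hv : lor v v = 1) (hfv : ∀ q ∈ U, lor (f q) v = 0) :
    Normal f (fun _ => v) U where
  isOpen := hU
  smooth := hf
  smooth_normal := contMDiffOn_const
  isFrame q hq := ⟨hff q hq, hv, hfv q hq⟩
  perp q hq w := by
    have h1 := ((lorL v).hasMFDerivAt (x := f q)).comp q
      (mdiff_of_contMDiffOn hU hf hq).hasMFDerivAt
    have h2 : (⇑(lorL v) ∘ f) =ᶠ[𝓝 q] fun _ => (0 : ℝ) := by
      filter_upwards [hU.mem_nhds hq] with x hx using hfv x hx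
    have h3 := h1.mfderiv
    rw [h2.mfderiv_eq, mfderiv_const] at h3
    exact (DFunLike.congr_fun h3 w).symm

variable [IsManifold (𝓡 2) ∞ M]

lemma Normal.diff_comb_eq_zero_of_frequently (h : Normal f ν U) (hp : p ∈ U) (a b : ℝ)
    (h0 : ∃ᶠ q in 𝓝 p, diff (comb a b f ν) q = 0) : diff (comb a b f ν) p = 0 := by
  obtain ⟨e, he, hpe, heU⟩ := exists_param p h.isOpen hp
  ext1 v
  obtain ⟨c, rfl⟩ := he.frame_surjective hpe v
  exact eq_of_frequently_eq (g := fun q => diff (comb a b f ν) q (frame e q c)) (c := 0)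
    ((he.continuousOn_diff_frame ((h.smooth_comb a b).mono heU) c).continuousAt
      (e.open_source.mem_nhds hpe)) (h0.mono fun q hq => by rw [hq]; rfl)

lemma Normal.eventually_isRegularPt_comb (h : Normal f ν U) (hp : p ∈ U) (a b : ℝ)
    (hr : IsRegularPt (comb a b f ν) p) : ∀ᶠ q in 𝓝 p, IsRegularPt (comb a b f ν) q := by
  obtain ⟨e, he, hpe, heU⟩ := exists_param p h.isOpen hp
  have cA := h.continuousAt_areaForm he heU hpe
  have cM := h.continuousAt_mixForm he heU hpe
  have cN := h.continuousAt_normalForm he heU hpe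
  have hc := ((cA.const_mul (a ^ 2)).add (cM.const_mul (a * b))).add (cN.const_mul (b ^ 2))
  have h2 := fun h0 => HypFront.not_isRegularPt_iff.2
    ((h.exists_kernel_comb_iff he hpe hp a b).2 h0) hr
  filter_upwards [hc.eventually_ne h2, e.open_source.mem_nhds hpe] with q hq hqe
  by_contra h3
  exact hq ((h.exists_kernel_comb_iff he hqe (heU hqe) a b).1
    (HypFront.not_isRegularPt_iff.1 h3))

/-- If the mixed area form of `f + ν` and `D` vanishes, where `D` is independent of `f + ν`, then
the differential of `f + ν` vanishes wherever it is singular. -/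
lemma Normal.diff_gauss_eq_zero (h : Normal f ν U) (hp : p ∈ U) (hi : PairInj f ν p) {a b : ℝ}
    (hab : b - a ≠ 0) (hm : ∀ v w, 2 * a * areaForm f ν p v w + (a + b) * mixForm f ν p v w +
      2 * b * normalForm f ν p v w = 0) (hr : ∃ v, v ≠ 0 ∧ diff (comb 1 1 f ν) p v = 0) :
    diff (comb 1 1 f ν) p = 0 := by
  obtain ⟨v, hv, hk⟩ := hr
  have := eq_zero_of_mixed (A := (diff (comb a b f ν) p).toLinearMap)
    (B := (diff (comb 1 1 f ν) p).toLinearMap)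
    (h.isFrame p hp) (h.perp_comb hp a b) (h.perp_comb hp 1 1) (h.sym_comb hp a b 1 1)
    (fun v w => by
      have := h.mixed_comb hp a b v w
      rw [hm v w, add_comm] at this
      exact this)
    (fun v h1 h2 => h.eq_zero_of_comb (a₁ := 1) (b₁ := 1) (a₂ := a) (b₂ := b) hp
      (by simpa using hab) hi h2 h1) hv hk
  ext1 w
  exact DFunLike.congr_fun this w

/-- The roles of `f + ν` and `a f + b ν` in `Normal.diff_gauss_eq_zero` are interchanged; `b - a` is
the determinant of their coefficients, so their differentials have no common kernel. -/
lemma Normal.diff_comb_eq_zero (h : Normal f ν U) (hp : p ∈ U) (hi : PairInj f ν p) {a b : ℝ}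
    (hab : b - a ≠ 0) (hm : ∀ v w, 2 * a * areaForm f ν p v w + (a + b) * mixForm f ν p v w +
      2 * b * normalForm f ν p v w = 0) (hr : ∃ v, v ≠ 0 ∧ diff (comb a b f ν) p v = 0) :
    diff (comb a b f ν) p = 0 := by
  obtain ⟨v, hv, hk⟩ := hr
  have := eq_zero_of_mixed (A := (diff (comb 1 1 f ν) p).toLinearMap)
    (B := (diff (comb a b f ν) p).toLinearMap)
    (h.isFrame p hp) (h.perp_comb hp 1 1) (h.perp_comb hp a b) (h.sym_comb hp 1 1 a b)
    (fun v w => (h.mixed_comb hp a b v w).trans (hm v w))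
    (fun v h1 h2 => h.eq_zero_of_comb (a₁ := 1) (b₁ := 1) (a₂ := a) (b₂ := b) hp
      (by simpa using hab) hi h1 h2) hv hk
  ext1 w
  exact DFunLike.congr_fun this w

/-- The unique continuation principle for the zeros of the differential of a combination. -/
lemma Normal.zero_or_isolated (h : Normal f ν U) (hp : p ∈ U) (hi : PairInj f ν p) {a b : ℝ}
    (hab : b - a ≠ 0) (hm : ∀ q ∈ U, ∀ v w, 2 * a * areaForm f ν q v w +
      (a + b) * mixForm f ν q v w + 2 * b * normalForm f ν q v w = 0)
    (h0 : diff (comb a b f ν) p = 0) :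
    (∀ᶠ q in 𝓝 p, diff (comb a b f ν) q = 0) ∨
      ∀ᶠ q in 𝓝[≠] p, diff (comb a b f ν) q ≠ 0 := by
  refine h.isolated_or_zero hp a b
    (fun q hq v w => (h.mixed_comb hq a b v w).trans (hm q hq v w)) fun v hv => ?_
  exact h.eq_zero_of_comb (a₁ := 1) (b₁ := 1) (a₂ := a) (b₂ := b) hp (by simpa using hab) hi hv
    (by rw [h0]; rfl)

end local_comb

end

end HypFront

namespace HypFront

noncomputable section

/-! ### Choosing the sign of the normal and gluing. -/

section global

variable {M : Type*} [TopologicalSpace M] [ChartedSpace (EuclideanSpace ℝ (Fin 2)) M]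
  [IsManifold (𝓡 2) ∞ M] {f ν ν' : M → R41} {U U' V : Set M} {p : M} {ε : ℝ}

/-- If `ε = -1` and the unit normal is constant near a point, then `f` lies in a totally geodesic
plane. -/
theorem inEquidistant_of_normal_const [ConnectedSpace M] (hd : Dense {q | IsRegularPt f q})
    (hH : LocallyHLW f) (hW : LocallyW (-1) f) (h : Normal f ν U) (hp : p ∈ U)
    (h0 : ∀ᶠ q in 𝓝 p, diff ν q = 0) : InEquidistant f := by
  set v := ν p with hv
  have hvv : lor v v = 1 := (h.isFrame p hp).nn
  set S : Set M := {q | ∀ᶠ x in 𝓝 q, lor (f x) v = 0} with hS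
  have hpS : p ∈ S := by
    filter_upwards [h.isOpen.mem_nhds hp,
      eventually_eq_of_diff_eq_zero h.isOpen hp h.smooth_normal h0] with x hx hxv
    rw [hv, ← hxv]
    exact (h.isFrame x hx).fn
  have hSo : IsOpen S := isOpen_iff_mem_nhds.2 fun q hq => eventually_eventually_nhds.2 hq
  -- For `ε = -1` the relation is the vanishing mixed area of `f + ν` and `ν` itself. So near a
  -- limit point of `S` the differential of the local normal either vanishes, making the normal
  -- constant and equal to `±v`, or has an isolated zero, contradicting the accumulation of points
  -- of `S`.
  have hSc : IsClosed S := by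
    rw [isClosed_iff_frequently]
    intro q hq
    obtain ⟨U₂, ν₂, hq₂, h₂, hr₂⟩ := hW q
    have rel : ∀ x ∈ U₂, WRel (-1) (1 - (-1)) f ν₂ x := fun x hx => h₂.wRel_of_dense hd hx hr₂
    have inj := h₂.pairInj_of_dense hd hH hq₂
    have sign : ∀ x ∈ S, x ∈ U₂ →
        (∀ᶠ y in 𝓝 x, v = ν₂ y) ∨ (∀ᶠ y in 𝓝 x, v = -ν₂ y) := by
      intro x hx hx₂
      obtain ⟨T, hT, hTo, hxT⟩ := mem_nhds_iff.1 hx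
      have hc : Normal f (fun _ => v) (T ∩ U₂) :=
        normal_const (hTo.inter h₂.isOpen) (h₂.smooth.mono Set.inter_subset_right)
          (fun y hy => (h₂.isFrame y hy.2).ff) hvv fun y hy => hT hy.1
      exact h₂.eventually_eq_or_neg hc hx₂ ⟨hxT, hx₂⟩ (Filter.Eventually.of_forall hd)
    have dzero : ∀ x ∈ S, x ∈ U₂ → diff ν₂ x = 0 := by
      intro x hx hx₂
      rcases sign x hx hx₂ with hs | hs
      · exact diff_eq_zero_of_eventuallyEq_const (c := v) (hs.mono fun y hy => hy.symm)
      · exact diff_eq_zero_of_eventuallyEq_const (c := -v) (hs.mono fun y hy => by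
          rw [hy, neg_neg])
    have hqU : ∀ᶠ x in 𝓝 q, x ∈ U₂ := h₂.isOpen.mem_nhds hq₂
    have hfr := hq.and_eventually hqU
    have key := h₂.diff_comb_eq_zero_of_frequently hq₂ 0 1 (by
      rw [comb_zero_one]; exact hfr.mono fun x hx => dzero x hx.1 hx.2)
    have alt := h₂.zero_or_isolated hq₂ inj (a := 0) (b := 1) (by norm_num) (by
      intro x hx u w
      linear_combination rel x hx u w) key
    rw [comb_zero_one] at alt
    rcases alt with alt | alt
    · have hc := eventually_eq_of_diff_eq_zero h₂.isOpen hq₂ h₂.smooth_normal alt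
      obtain ⟨x, ⟨hx, hx₂⟩, hxq⟩ := (hfr.and_eventually hc).exists
      have hvx : v = ν₂ q ∨ v = -ν₂ q := by
        rcases sign x hx hx₂ with hs | hs
        · left; rw [hs.self_of_nhds, hxq]
        · right; rw [hs.self_of_nhds, hxq]
      filter_upwards [hc, hqU] with y hy hy₂
      have := (h₂.isFrame y hy₂).fn
      rcases hvx with hvx | hvx
      · rw [hvx, ← hy, this]
      · rw [hvx, ← hy, lor_neg_right, this, neg_zero]
    · by_contra hqS
      rw [eventually_nhdsWithin_iff] at alt
      obtain ⟨x, ⟨hx, hx₂⟩, hx'⟩ := (hfr.and_eventually alt).exists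
      refine hx' ?_ (dzero x hx hx₂)
      rintro rfl
      exact hqS hx
  have huniv : S = Set.univ := IsClopen.eq_univ ⟨hSc, hSo⟩ ⟨p, hpS⟩
  refine ⟨v, by rw [hvv]; norm_num, 0, fun q => ?_⟩
  have hq : ∀ᶠ x in 𝓝 q, lor (f x) v = 0 := huniv.symm.subset (Set.mem_univ q)
  exact hq.self_of_nhds

/-- A unit normal and its opposite do not both satisfy the relation. -/
theorem not_both_signs [ConnectedSpace M] (hε : ε < 0) (hd : Dense {q | IsRegularPt f q})
    (hH : LocallyHLW f) (hW : LocallyW ε f) (hne : ¬ InEquidistant f) (h : Normal f ν U)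
    (h' : Normal f ν' U') (hp : p ∈ U) (hp' : p ∈ U') (hr : ∀ q ∈ U, WRel ε (1 - ε) f ν q)
    (hr' : ∀ q ∈ U', WRel ε (1 - ε) f ν' q) (hs : ∀ᶠ q in 𝓝 p, ν' q = -ν q) : False := by
  obtain ⟨T, hT, hTo, hpT⟩ := mem_nhds_iff.1 (eventually_eventually_nhds.2 hs)
  have hU₀ : IsOpen (T ∩ (U ∩ U')) := hTo.inter (h.isOpen.inter h'.isOpen)
  have hp₀ : p ∈ T ∩ (U ∩ U') := ⟨hpT, hp, hp'⟩
  have h₀ := h.mono hU₀ fun q hq => hq.2.1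
  have inj : ∀ q ∈ T ∩ (U ∩ U'), PairInj f ν q := fun q hq => h₀.pairInj_of_dense hd hH hq
  have mix0 : ∀ q ∈ T ∩ (U ∩ U'), ∀ v w, mixForm f ν q v w = 0 := by
    intro q hq v w
    have e1 := hr q hq.2.1 v w
    have e2 := (hr' q hq.2.2).of_neg (hT hq.1) v w
    -- Adding the relations for `ν` and `-ν` isolates the mixed form, the only one unaffected by the
    -- sign change.
    have : ε * mixForm f ν q v w = 0 := by linear_combination (e2 - e1) / 2
    exact (mul_eq_zero.1 this).resolve_left hε.ne
  have prop : ∀ q ∈ T ∩ (U ∩ U'), ∀ v w,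
      (1 - ε) * normalForm f ν q v w = (1 + ε) * areaForm f ν q v w := by
    intro q hq v w
    linear_combination hr q hq.2.1 v w + ε * mix0 q hq v w
  rcases lt_trichotomy ε (-1) with hlt | heq | hgt
  -- The constants are chosen so that `a² A + b² C = 0`. With `B = 0`, both `a f + b ν` and `a f - b
  -- ν` are then degenerate, and focal orthogonality would give `a² + b² = 0`.
  · have ha : 0 < Real.sqrt (-(1 + ε)) := Real.sqrt_pos.2 (by linarith)
    have hb : 0 < Real.sqrt (1 - ε) := Real.sqrt_pos.2 (by linarith)
    have ha2 : Real.sqrt (-(1 + ε)) ^ 2 = -(1 + ε) := Real.sq_sqrt (by linarith)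
    have hb2 : Real.sqrt (1 - ε) ^ 2 = 1 - ε := Real.sq_sqrt (by linarith)
    set a := Real.sqrt (-(1 + ε))
    set b := Real.sqrt (1 - ε)
    have ker : ∀ c : ℝ, c ^ 2 = b ^ 2 → ∀ q ∈ T ∩ (U ∩ U'),
        ∃ v, v ≠ 0 ∧ diff (comb a c f ν) q v = 0 := by
      intro c hc q hq
      obtain ⟨e, he, hqe, -⟩ := exists_param q hU₀ hq
      rw [h₀.exists_kernel_comb_iff he hqe hq, mix0 q hq, hc, ha2, hb2]
      linear_combination prop q hq (frame e q 1) (frame e q Complex.I)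
    have := h₀.lor_focal_eq_zero hp₀ (a₁ := a) (b₁ := b) (a₂ := a) (b₂ := -b)
      (by nlinarith [mul_pos ha hb]) inj (ker b rfl) (ker (-b) (by ring))
    nlinarith [mul_pos ha ha, mul_pos hb hb]
  -- Now `C = 0`, so `dν` has a kernel and, being trace-free relative to `df`, vanishes.
  · subst heq
    refine hne (inEquidistant_of_normal_const hd hH hW h₀ hp₀ ?_)
    filter_upwards [hU₀.mem_nhds hp₀] with q hq
    obtain ⟨e, he, hqe, -⟩ := exists_param q hU₀ hq
    have hker := (h₀.exists_kernel_comb_iff he hqe hq 0 1).2 (by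
      linear_combination prop q hq (frame e q 1) (frame e q Complex.I) / 2)
    rw [comb_zero_one] at hker
    exact h₀.diff_normal_eq_zero_of_mixForm hq (inj q hq) (mix0 q hq) hker
  -- At a regular point the relation makes `A C` positive, whereas a trace-free shape operator has
  -- nonpositive determinant.
  · obtain ⟨q, hq, hqr⟩ := hd.inter_open_nonempty _ hU₀ ⟨p, hp₀⟩
    have hω : areaForm f ν q (tbasis 0) (tbasis 1) ≠ 0 := fun h0 =>
      (not_isRegularPt_iff_wed (h₀.isFrame q hq) (h₀.perp_diff hq)).2 h0 hqr
    have hle : areaForm f ν q (tbasis 0) (tbasis 1) * normalForm f ν q (tbasis 0) (tbasis 1) ≤ 0 :=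
      wed_mul_wed_nonpos (A := (diff f q).toLinearMap) (B := (diff ν q).toLinearMap)
        (h₀.isFrame q hq) (h₀.perp_diff hq) (h₀.perp_diff_normal hq) (h₀.sym hq) (mix0 q hq) _ _
    have e := prop q hq (tbasis 0) (tbasis 1)
    have hsq : 0 < areaForm f ν q (tbasis 0) (tbasis 1) ^ 2 := by positivity
    have h1 : (1 - ε) * (areaForm f ν q (tbasis 0) (tbasis 1) *
        normalForm f ν q (tbasis 0) (tbasis 1)) =
        (1 + ε) * areaForm f ν q (tbasis 0) (tbasis 1) ^ 2 := by
      linear_combination areaForm f ν q (tbasis 0) (tbasis 1) * e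
    have h2 : 0 < (1 + ε) * areaForm f ν q (tbasis 0) (tbasis 1) ^ 2 :=
      mul_pos (by linarith) hsq
    rw [← h1] at h2
    exact absurd h2 (not_lt.2 (mul_nonpos_of_nonneg_of_nonpos (by linarith) hle))

/-- The local unit normals that satisfy the relation fit together. -/
theorem exists_global_normal [ConnectedSpace M] (hε : ε < 0) (hd : Dense {q | IsRegularPt f q})
    (hH : LocallyHLW f) (hW : LocallyW ε f) (hne : ¬ InEquidistant f) :
    ∃ ν : M → R41, Normal f ν Set.univ ∧ ∀ p, WRel ε (1 - ε) f ν p := by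
  choose U n hpU h hr using hW
  have rel : ∀ p, ∀ q ∈ U p, WRel ε (1 - ε) f (n p) q := fun p q hq =>
    (h p).wRel_of_dense hd hq (hr p)
  -- The diagonal choice `q ↦ n q q` is smooth because it agrees near each `p` with the single local
  -- field `n p`.
  have agree : ∀ p, ∀ q ∈ U p, n q q = n p q := by
    intro p q hq
    rcases (h p).eventually_eq_or_neg (h q) hq (hpU q) (Filter.Eventually.of_forall hd)
      with hs | hs
    · exact hs.self_of_nhds
    · exact (not_both_signs hε hd hH (fun p => ⟨U p, n p, hpU p, h p, hr p⟩) hne (h p) (h q) hq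
        (hpU q) (rel p) (rel q) hs).elim
  have near : ∀ p, ∀ᶠ q in 𝓝 p, (fun q => n q q) q = n p q := by
    intro p
    filter_upwards [(h p).isOpen.mem_nhds (hpU p)] with q hq using agree p q hq
  refine ⟨fun q => n q q, ⟨isOpen_univ, ?_, ?_, ?_, ?_⟩, ?_⟩
  · intro p _
    exact ((h p).smooth.contMDiffAt ((h p).isOpen.mem_nhds (hpU p))).contMDiffWithinAt
  · intro p _
    exact (((h p).smooth_normal.contMDiffAt ((h p).isOpen.mem_nhds (hpU p))).congr_of_eventuallyEq
      (near p)).contMDiffWithinAt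
  · intro p _
    exact (h p).isFrame p (hpU p)
  · intro p _
    exact (h p).perp p (hpU p)
  · intro p
    exact (rel p p (hpU p)).congr ((near p).mono fun q hq => hq.symm)

/-- A map with vanishing differential on a connected surface is constant. -/
lemma eq_of_diff_eq_zero [ConnectedSpace M] {g : M → R41}
    (hg : ContMDiffOn (𝓡 2) 𝓘(ℝ, R41) ∞ g Set.univ) (h0 : ∀ q, diff g q = 0) (p q : M) :
    g p = g q := by
  have hloc : IsLocallyConstant g := by
    rw [IsLocallyConstant.iff_eventually_eq]
    intro x
    exact eventually_eq_of_diff_eq_zero isOpen_univ (Set.mem_univ x) hg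
      (Filter.Eventually.of_forall h0)
  exact hloc.apply_eq_of_preconnectedSpace p q

end global

/-! ### Passing between fronts and Legendrian maps -/

section fronts

variable {M : Type*} [TopologicalSpace M] [ChartedSpace (EuclideanSpace ℝ (Fin 2)) M]
  {f ν : M → R41} {U : Set M} {ε : ℝ}

lemma IsFrontH3.normal (hf : IsFrontH3 f) (hU : IsOpen U) (h : IsUnitNormalOn S31 f ν U) :
    Normal f ν U where
  isOpen := hU
  smooth := hf.1.contMDiffOn
  smooth_normal := h.1
  isFrame p hp := ⟨(hf.2.1 p).1, (h.2 p hp).1, (h.2 p hp).2.1⟩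
  perp p hp := (h.2 p hp).2.2

lemma Normal.isUnitNormalOn (h : Normal f ν U) : IsUnitNormalOn S31 f ν U :=
  ⟨h.smooth_normal, fun p hp => ⟨(h.isFrame p hp).nn, (h.isFrame p hp).fn, h.perp p hp⟩⟩

variable [IsManifold (𝓡 2) ∞ M]

/-- The relation of the parallel immersion is carried back to `f` by `Normal.wRel_of_par`; and a
common kernel vector of `df` and `dν` would be a kernel vector of the parallel immersion. -/
lemma IsHLWFront.locallyHLW (hf : IsHLWFront f) : LocallyHLW f := by
  intro p
  obtain ⟨U, hU, hp, ν, hν, δ, hreg, a, b, hab, hrel⟩ := hf.2.2 p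
  have h := hf.1.normal hU hν
  -- The half compensates for the factor `2` with which `WRel` normalizes the coefficient of `H -
  -- 1`.
  refine ⟨U, ν, a / 2 * Real.exp δ ^ 2, b - 2 * (a / 2) * Real.sinh δ * Real.exp δ, hp, h,
    ?_, ?_, ?_⟩
  · intro q hq v h1 h2
    refine isRegularPt_iff.1 (hreg q hq) v ?_
    rw [par_eq_comb, h.diff_comb hq, h1, h2, smul_zero, smul_zero, add_zero]
  · by_cases ha : a = 0
    · right
      rintro h0
      apply hab
      have hb : b = 0 := by rw [ha] at h0; linarith
      rw [ha, hb]; norm_num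
    · left
      have := Real.exp_pos δ
      positivity
  · intro q hq
    refine h.wRel_of_par hq δ (((h.par δ).weingarten_iff hq (hreg q hq) (a / 2) b).1 ?_)
    have := hrel q hq
    linear_combination this

lemma locallyW_of_mem (hf : f ∈ W M ε) : LocallyW ε f := by
  intro p
  obtain ⟨U, hU, hp, ν, hν, hrel⟩ := hf.2 p
  have h := hf.1.1.normal hU hν
  exact ⟨U, ν, hp, h, fun q hq hr => (h.weingarten_iff hq hr _ _).1 (hrel q hq hr)⟩

/-- The time component of a parallel front is positive. -/
lemma par_mem_H3 (hf : ∀ p, f p ∈ H3) (h : Normal f ν U) {p : M} (hp : p ∈ U) (δ : ℝ) :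
    par δ f ν p ∈ H3 := by
  refine ⟨((h.par δ).isFrame p hp).ff, ?_⟩
  have F := h.isFrame p hp
  have h0 := (hf p).2
  obtain ⟨e1, e2, e3⟩ := F
  change 0 < Real.cosh δ * f p 0 + Real.sinh δ * ν p 0
  generalize f p = x at *
  generalize ν p = y at *
  -- Orthogonality and the Cauchy-Schwarz inequality on spatial parts give `x₀² y₀² ≤ (x₀² - 1)(y₀²
  -- + 1)`, that is, `y₀² + 1 ≤ x₀²`.
  have hlt : y 0 ^ 2 < x 0 ^ 2 := by
    simp only [lor] at e1 e2 e3
    have hC : (x 0 * y 0) ^ 2 ≤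
        (x 1 ^ 2 + x 2 ^ 2 + x 3 ^ 2) * (y 1 ^ 2 + y 2 ^ 2 + y 3 ^ 2) := by
      rw [show x 0 * y 0 = x 1 * y 1 + x 2 * y 2 + x 3 * y 3 by linarith]
      nlinarith [sq_nonneg (x 1 * y 2 - x 2 * y 1), sq_nonneg (x 1 * y 3 - x 3 * y 1),
        sq_nonneg (x 2 * y 3 - x 3 * y 2)]
    rw [show x 1 ^ 2 + x 2 ^ 2 + x 3 ^ 2 = x 0 ^ 2 - 1 by linarith,
      show y 1 ^ 2 + y 2 ^ 2 + y 3 ^ 2 = y 0 ^ 2 + 1 by linarith] at hC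
    nlinarith
  have habs : |y 0| < x 0 := abs_lt_of_sq_lt_sq hlt h0.le
  have hsc : |Real.sinh δ| < Real.cosh δ := by
    rw [abs_lt]
    have h1 := Real.cosh_add_sinh δ
    have h2 := Real.cosh_sub_sinh δ
    exact ⟨by linarith [Real.exp_pos δ], by linarith [Real.exp_pos (-δ)]⟩
  have h1 : |Real.sinh δ * y 0| < Real.cosh δ * x 0 := by
    rw [abs_mul]
    exact mul_lt_mul'' hsc habs (abs_nonneg _) (abs_nonneg _)
  linarith [(abs_lt.1 h1).1]

/-- The mean curvature of `ν_δ` with respect to `f_δ`. -/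
lemma Normal.meanCurv_par_eq_one_iff {p : M} (h : Normal f ν U) (hp : p ∈ U) (δ : ℝ)
    (hr : IsRegularPt (HypFront.par δ ν f) p) :
    meanCurv (HypFront.par δ ν f) (HypFront.par δ f ν) p = 1 ↔
      ∀ v w, 2 * Real.sinh δ * areaForm f ν p v w + (Real.sinh δ + Real.cosh δ) *
        mixForm f ν p v w + 2 * Real.cosh δ * normalForm f ν p v w = 0 := by
  rw [par_normal_eq_comb] at hr ⊢
  rw [par_eq_comb]
  have F := h.isFrame p hp
  have hg := h.perp_comb hp (Real.sinh δ) (Real.cosh δ)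
  have hn := h.perp_comb hp (Real.cosh δ) (Real.sinh δ)
  have hω := fun h0 => (not_isRegularPt_iff_wed F hg).2 h0 hr
  have hE : Real.cosh δ + Real.sinh δ ≠ 0 := by
    rw [Real.cosh_add_sinh]; exact (Real.exp_pos δ).ne'
  rw [meanCurv_eq F hg hn hr, div_eq_one_iff_eq (mul_ne_zero two_ne_zero hω)]
  -- The left side is minus the mixed area of `ν_δ` and `f_δ + ν_δ`; since `f_δ + ν_δ = e^δ (f +
  -- ν)`, a nonzero factor comes out.
  have key : ∀ v w, -(wed (f p) (ν p) (diff (comb (Real.sinh δ) (Real.cosh δ) f ν) p v)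
        (diff (comb (Real.cosh δ) (Real.sinh δ) f ν) p w) +
      wed (f p) (ν p) (diff (comb (Real.cosh δ) (Real.sinh δ) f ν) p v)
        (diff (comb (Real.sinh δ) (Real.cosh δ) f ν) p w)) -
      2 * wed (f p) (ν p) (diff (comb (Real.sinh δ) (Real.cosh δ) f ν) p v)
        (diff (comb (Real.sinh δ) (Real.cosh δ) f ν) p w) =
      -(Real.cosh δ + Real.sinh δ) * (2 * Real.sinh δ * areaForm f ν p v w +
        (Real.sinh δ + Real.cosh δ) * mixForm f ν p v w +
        2 * Real.cosh δ * normalForm f ν p v w) := by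
    intro v w
    simp only [h.diff_comb hp, wed_add_left, wed_add_right, wed_smul_left, wed_smul_right,
      areaForm, mixForm, normalForm]
    ring
  rw [← sub_eq_zero, key]
  constructor
  · intro h0
    exact forms_eq_zero_of_basis _ _ _ tbasis_span
      ((mul_eq_zero.1 h0).resolve_left (neg_ne_zero.2 hE))
  · intro h0
    rw [h0, mul_zero]

end fronts

end

end HypFront

namespace HypFront

noncomputable section

/-! ### The CMC-1 front `ν_δ`: existence, isolated singularities, uniqueness. -/

section main

variable {M : Type*} [TopologicalSpace M] [ChartedSpace (EuclideanSpace ℝ (Fin 2)) M]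
  [IsManifold (𝓡 2) ∞ M] {f ν : M → R41} {a b δ : ℝ}

/-- The vanishing of the mixed area form of `f + ν` and `a f + b ν`. -/
def MixedZero (a b : ℝ) (f ν : M → R41) (p : M) : Prop :=
  ∀ v w, 2 * a * areaForm f ν p v w + (a + b) * mixForm f ν p v w +
    2 * b * normalForm f ν p v w = 0

/-- After multiplication by `e^δ`, the coefficients `2 sinh δ`, `e^δ`, `2 cosh δ` become `e^{2δ} -
1`, `e^{2δ}`, `e^{2δ} + 1`. With `e^{2δ} = -ε` they are those of the Weingarten relation. -/
lemma WRel.mixedZero {ε : ℝ} {p : M} (hr : WRel ε (1 - ε) f ν p)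
    (hδ : Real.exp δ ^ 2 = -ε) : MixedZero (Real.sinh δ) (Real.cosh δ) f ν p := by
  intro v w
  have hE := Real.exp_pos δ
  have hEE : Real.exp δ * Real.exp (-δ) = 1 := by rw [← Real.exp_add]; simp
  refine (mul_eq_zero.1 (?_ : Real.exp δ * _ = 0)).resolve_left hE.ne'
  rw [Real.sinh_eq, Real.cosh_eq]
  have := hr v w
  linear_combination this + (areaForm f ν p v w + mixForm f ν p v w + normalForm f ν p v w) * hδ +
    (normalForm f ν p v w - areaForm f ν p v w) * hEE

/-- This is the coefficient determinant of `f + ν` and `ν_δ`; its nonvanishing lets immersivity of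
`(f, ν)` pass to that pair. -/
lemma cosh_sub_sinh_ne_zero (δ : ℝ) : Real.cosh δ - Real.sinh δ ≠ 0 := by
  rw [Real.cosh_sub_sinh]; exact (Real.exp_pos _).ne'

variable [ConnectedSpace M]

/-- If the differential of a combination vanishes near a point, the combination is constant. -/
theorem Normal.comb_const (h : Normal f ν Set.univ) (hi : ∀ p, PairInj f ν p) (hab : b - a ≠ 0)
    (hm : ∀ p, MixedZero a b f ν p) {p : M} (h0 : ∀ᶠ q in 𝓝 p, diff (comb a b f ν) q = 0)
    (x y : M) : comb a b f ν x = comb a b f ν y := by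
  set S : Set M := {q | ∀ᶠ x in 𝓝 q, diff (comb a b f ν) x = 0} with hS
  have hSo : IsOpen S := isOpen_iff_mem_nhds.2 fun q hq => eventually_eventually_nhds.2 hq
  have hSc : IsClosed S := by
    rw [isClosed_iff_frequently]
    intro q hq
    -- A limit point of `S` is a non-isolated zero of the differential, so only local vanishing is
    -- possible; the vanishing spreads over the connected surface.
    rcases h.zero_or_isolated (Set.mem_univ q) (hi q) hab (fun q _ => hm q)
      (h.diff_comb_eq_zero_of_frequently (Set.mem_univ q) a b
        (hq.mono fun x hx => hx.self_of_nhds)) with alt | alt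
    · exact alt
    · by_contra hqS
      obtain ⟨x, hx, hx'⟩ := (hq.and_eventually (eventually_nhdsWithin_iff.1 alt)).exists
      refine hx' ?_ hx.self_of_nhds
      rintro rfl
      exact hqS hx
  have huniv : S = Set.univ := IsClopen.eq_univ ⟨hSc, hSo⟩ ⟨p, h0⟩
  refine eq_of_diff_eq_zero (h.smooth_comb a b) (fun q => ?_) x y
  have hq : ∀ᶠ x in 𝓝 q, diff (comb a b f ν) x = 0 := huniv.symm.subset (Set.mem_univ q)
  exact hq.self_of_nhds

/-- If `ν_δ` is constant, then `f` lies in an equidistant surface. -/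
lemma Normal.inEquidistant_of_const (h : Normal f ν Set.univ) (δ : ℝ)
    (hc : ∀ x y, comb (Real.sinh δ) (Real.cosh δ) f ν x = comb (Real.sinh δ) (Real.cosh δ) f ν y) :
    InEquidistant f := by
  obtain ⟨p⟩ : Nonempty M := inferInstance
  have hcs := Real.cosh_sq δ
  refine ⟨comb (Real.sinh δ) (Real.cosh δ) f ν p, ?_, -Real.sinh δ, fun q => ?_⟩
  · have F := h.isFrame p (Set.mem_univ p)
    simp only [comb, lor_add_left, lor_add_right, lor_smul_left, lor_smul_right,
      lor_comm (ν p) (f p), F.ff, F.nn, F.fn]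
    nlinarith
  · have F := h.isFrame q (Set.mem_univ q)
    rw [hc p q]
    simp only [comb, lor_add_right, lor_smul_right, F.ff, F.fn]
    ring

/-- If the hyperbolic Gauss map `f + ν` is constant, then `f` lies in a horosphere. -/
lemma Normal.inHorosphere_of_const (h : Normal f ν Set.univ)
    (hc : ∀ x y, comb 1 1 f ν x = comb 1 1 f ν y) : InHorosphere f := by
  obtain ⟨p⟩ : Nonempty M := inferInstance
  have key : ∀ q, lor (f q) (comb 1 1 f ν p) = -1 := by
    intro q
    have F := h.isFrame q (Set.mem_univ q)
    rw [hc p q]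
    simp only [comb, lor_add_right, lor_smul_right, F.ff, F.fn]
    ring
  refine ⟨comb 1 1 f ν p, ?_, ?_, -1, key⟩
  · intro h0
    have := key p
    rw [h0, lor_zero_right] at this
    norm_num at this
  · have F := h.isFrame p (Set.mem_univ p)
    simp only [comb, lor_add_left, lor_add_right, lor_smul_left, lor_smul_right,
      lor_comm (ν p) (f p), F.ff, F.nn, F.fn]
    norm_num

/-- If the differential of the hyperbolic Gauss map vanishes at the regular points of `ν_δ`, then
the hyperbolic Gauss map is constant. -/
theorem Normal.gauss_const (h : Normal f ν Set.univ) (hi : ∀ p, PairInj f ν p)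
    (hab : b - a ≠ 0) (hex : ∃ p, IsRegularPt (comb a b f ν) p)
    (h0 : ∀ p, IsRegularPt (comb a b f ν) p → diff (comb 1 1 f ν) p = 0) (x y : M) :
    comb 1 1 f ν x = comb 1 1 f ν y := by
  set S : Set M := {q | diff (comb 1 1 f ν) q = 0} with hS
  -- Where `d(f + ν)` vanishes, the independent combination must be regular. Regularity is open and
  -- implies vanishing of `d(f + ν)`, so `S` is open as well as closed.
  have hreg : ∀ q ∈ S, IsRegularPt (comb a b f ν) q := by
    intro q hq
    refine isRegularPt_iff.2 fun v hv => ?_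
    refine h.eq_zero_of_comb (a₁ := 1) (b₁ := 1) (a₂ := a) (b₂ := b) (Set.mem_univ q)
      (by simpa using hab) (hi q) ?_ hv
    rw [show diff (comb 1 1 f ν) q = 0 from hq]; rfl
  have hSo : IsOpen S := isOpen_iff_mem_nhds.2 fun q hq => by
    filter_upwards [h.eventually_isRegularPt_comb (Set.mem_univ q) a b (hreg q hq)] with x hx
    exact h0 x hx
  have hSc : IsClosed S := by
    rw [isClosed_iff_frequently]
    intro q hq
    exact h.diff_comb_eq_zero_of_frequently (Set.mem_univ q) 1 1 hq
  have huniv : S = Set.univ := IsClopen.eq_univ ⟨hSc, hSo⟩ (hex.imp h0)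
  exact eq_of_diff_eq_zero (h.smooth_comb 1 1) (fun q => huniv.symm.subset (Set.mem_univ q)) x y

/-- The normal `ν_δ` is a CMC-1 front in de Sitter space if `f` is a front in hyperbolic space
whose relation has the matching parameter. -/
theorem Normal.isCMC1FrontS31 (h : Normal f ν Set.univ) (hf : ∀ p, f p ∈ H3)
    (hi : ∀ p, PairInj f ν p) (hne : ¬ InEquidistant f)
    (hm : ∀ p, MixedZero (Real.sinh δ) (Real.cosh δ) f ν p) :
    IsCMC1FrontS31 (HypFront.par δ ν f) (HypFront.par δ f ν) := by
  have hab := cosh_sub_sinh_ne_zero δ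
  have hP := h.par δ
  refine ⟨contMDiffOn_univ.1 hP.smooth_normal, fun p => (hP.isFrame p (Set.mem_univ p)).nn,
    ⟨hP.smooth, fun p hp => ⟨par_mem_H3 hf h hp δ, ?_, ?_⟩⟩, ?_, ?_, ?_⟩
  · rw [lor_comm]; exact (hP.isFrame p hp).fn
  · exact fun v => ((hP.legPt hp).Yp v).1
  · intro p hp v h1 h2
    rw [par_normal_eq_comb] at h1
    rw [par_eq_comb] at h2
    refine h.eq_zero_of_comb hp ?_ (hi p) h1 h2
    have := Real.cosh_sq δ
    nlinarith
  -- Without regular points, the differential of `ν_δ` would vanish everywhere by the trace-free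
  -- condition; `ν_δ` would be constant and `f` equidistant.
  · by_contra hno
    push Not at hno
    obtain ⟨p⟩ : Nonempty M := inferInstance
    refine hne (h.inEquidistant_of_const δ
      (h.comb_const hi hab hm (p := p) (Filter.Eventually.of_forall fun q => ?_)))
    have hq := HypFront.not_isRegularPt_iff.1 (hno q)
    rw [par_normal_eq_comb] at hq
    exact h.diff_comb_eq_zero (Set.mem_univ q) (hi q) hab (hm q) hq
  · exact fun p hr => (h.meanCurv_par_eq_one_iff (Set.mem_univ p) δ hr).2 (hm p)

/-- The singular points of `ν_δ` are isolated. -/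
theorem Normal.isolated_singularSet (h : Normal f ν Set.univ)
    (hi : ∀ p, PairInj f ν p) (hne : ¬ InEquidistant f)
    (hm : ∀ p, MixedZero (Real.sinh δ) (Real.cosh δ) f ν p) :
    ConsistsOfIsolatedPoints (singularSet (HypFront.par δ ν f)) := by
  have hab := cosh_sub_sinh_ne_zero δ
  rw [par_normal_eq_comb]
  have hsing : ∀ q ∈ singularSet (comb (Real.sinh δ) (Real.cosh δ) f ν),
      diff (comb (Real.sinh δ) (Real.cosh δ) f ν) q = 0 := fun q hq =>
    h.diff_comb_eq_zero (Set.mem_univ q) (hi q) hab (hm q) (HypFront.not_isRegularPt_iff.1 hq)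
  intro p hp
  rcases h.zero_or_isolated (Set.mem_univ p) (hi p) hab (fun q _ => hm q) (hsing p hp)
    with alt | alt
  · exact (hne (h.inEquidistant_of_const δ (h.comb_const hi hab hm alt))).elim
  · exact alt.mono fun q hq hs => hq (hsing q hs)

/-- Unless `f` lies in a horosphere, only one `ν_δ` is a CMC-1 front. -/
theorem Normal.eq_of_isCMC1FrontS31 (h : Normal f ν Set.univ)
    (hi : ∀ p, PairInj f ν p) (hne : ¬ InHorosphere f)
    (hm : ∀ p, MixedZero (Real.sinh δ) (Real.cosh δ) f ν p) {δ' : ℝ}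
    (h' : IsCMC1FrontS31 (HypFront.par δ' ν f) (HypFront.par δ' f ν)) : δ' = δ := by
  by_contra hδ
  obtain ⟨-, -, -, -, hex, hH⟩ := h'
  have hcurv : ∀ p, IsRegularPt (HypFront.par δ' ν f) p →
      MixedZero (Real.sinh δ') (Real.cosh δ') f ν p := fun p hr =>
    (h.meanCurv_par_eq_one_iff (Set.mem_univ p) δ' hr).1 (hH p hr)
  rw [par_normal_eq_comb] at hex hcurv
  refine hne (h.inHorosphere_of_const
    (h.gauss_const hi (cosh_sub_sinh_ne_zero δ') hex fun p hr => ?_))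
  refine h.diff_gauss_eq_zero (Set.mem_univ p) (hi p) (cosh_sub_sinh_ne_zero δ) (hm p) ?_
  obtain ⟨e, he, hpe, -⟩ := exists_param p isOpen_univ (Set.mem_univ p)
  rw [h.exists_kernel_comb_iff he hpe (Set.mem_univ p)]
  have e1 := hm p (frame e p 1) (frame e p Complex.I)
  have e2 := hcurv p hr (frame e p 1) (frame e p Complex.I)
  generalize areaForm f ν p (frame e p 1) (frame e p Complex.I) = A at *
  generalize mixForm f ν p (frame e p 1) (frame e p Complex.I) = B at *
  generalize normalForm f ν p (frame e p 1) (frame e p Complex.I) = C at *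
  have hEE : Real.exp δ * Real.exp (-δ) = 1 := by rw [← Real.exp_add]; simp
  have hEE' : Real.exp δ' * Real.exp (-δ') = 1 := by rw [← Real.exp_add]; simp
  rw [Real.sinh_eq, Real.cosh_eq] at e1 e2
  -- Multiplied by `e^δ` and `e^{δ'}`, the two conditions differ only in the coefficients `e^{2δ}`
  -- and `e^{2δ'}` of `A + B + C`, the area form of `f + ν`.
  have key : (Real.exp δ' ^ 2 - Real.exp δ ^ 2) * (A + B + C) = 0 := by
    linear_combination Real.exp δ' * e2 - Real.exp δ * e1 + (A - C) * hEE' - (A - C) * hEE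
  have hexp : Real.exp δ' ^ 2 - Real.exp δ ^ 2 ≠ 0 := by
    intro h0
    apply hδ
    refine Real.exp_injective ?_
    exact (pow_left_inj₀ (Real.exp_pos _).le (Real.exp_pos _).le two_ne_zero).1 (sub_eq_zero.1 h0)
  linear_combination (mul_eq_zero.1 key).resolve_left hexp

end main

end

end HypFront

theorem corollary3p2 {M : Type*} [TopologicalSpace M] [T2Space M] [SecondCountableTopology M]
    [ConnectedSpace M] [ChartedSpace (EuclideanSpace ℝ (Fin 2)) M] [IsManifold (𝓡 2) ∞ M]
    (ε : ℝ) (hε : ε < 0) (f : M → R41) (hf : f ∈ W M ε) (hne : ¬ InEquidistant f) :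
    (∃ ν : M → R41, IsUnitNormalOn S31 f ν Set.univ ∧ SatisfiesLW ε f ν Set.univ) ∧
    ∀ ν : M → R41, IsUnitNormalOn S31 f ν Set.univ → SatisfiesLW ε f ν Set.univ →
      (∃ δ : ℝ, IsCMC1FrontS31 (par δ ν f) (par δ f ν) ∧
        ConsistsOfIsolatedPoints (singularSet (par δ ν f))) ∧
      (¬ InHorosphere f → ∃! δ : ℝ, IsCMC1FrontS31 (par δ ν f) (par δ f ν)) := by
  have hH := hf.1.locallyHLW
  have hW := locallyW_of_mem hf
  have hd := dense_regular hε.ne hH hW hf.1.2.1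
  constructor
  · obtain ⟨ν, h, hr⟩ := exists_global_normal hε hd hH hW hne
    exact ⟨ν, h.isUnitNormalOn, fun p hp hreg => (h.weingarten_iff hp hreg _ _).2 (hr p)⟩
  · intro ν hν hLW
    have h := hf.1.1.normal isOpen_univ hν
    have hi : ∀ p, PairInj f ν p := fun p => h.pairInj_of_dense hd hH (Set.mem_univ p)
    have hrel : ∀ p, WRel ε (1 - ε) f ν p := fun p =>
      h.wRel_of_dense hd (Set.mem_univ p) fun q hq hreg =>
        (h.weingarten_iff hq hreg _ _).1 (hLW q hq hreg)
    -- The distance is forced by `e^{2δ} = -ε`; a real solution exists because `ε` is negative.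
    have hδ : Real.exp (Real.log (-ε) / 2) ^ 2 = -ε := by
      rw [← Real.exp_nat_mul]
      push_cast
      rw [mul_div_cancel₀ _ two_ne_zero, Real.exp_log (by linarith)]
    have hm := fun p => (hrel p).mixedZero hδ
    have hcmc := h.isCMC1FrontS31 hf.1.1.2.1 hi hne hm
    exact ⟨⟨_, hcmc, h.isolated_singularSet hi hne hm⟩, fun hhor =>
      ⟨_, hcmc, fun δ' h' => h.eq_of_isCMC1FrontS31 hi hhor hm h'⟩⟩
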